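/- **Computational model.** Fix a finite alphabet $\Sigma$, a set $L\subseteq\Sigma^*$, a pairing $\langle\cdot,\cdot\rangle:L\times L\to L$, a length $|\cdot|:L\to\mathbb N$ with $|\langle x,y\rangle|=|x|+|y|+cp$ and $|x|\le \mathrm{length}(x)$, a partial application $\{e\}(x)\in L$ and a time measure $T(e,x)\in\mathbb N$ for the pairs with $\{e\}(x)$ defined, such that, with constants $O(1)$ of the model: (a) one Turing machine computes $\{e\}(x)$ from $e,x$ in time $p(T(e,x)+|e|+|x|)$, $p$ a fixed polynomial; (b) there is an injection $\Phi:\{0,1\}^*\to L$ such that $\Phi$, $\Phi^{-1}$ are polynomial-time computable, $|\Phi(bw)|\le|\Phi(w)|+O(1)$, and $\Phi(w)\mapsto\Phi(bw)$ has a realizer running in time $O(1)$ for each bit $b$; (c) there are elements of $L$ for composition ($\langle x,y\rangle\mapsto z$, $|z|\le|x|+|y|+O(1)$, $\{z\}(w)\simeq\{y\}(\{x\}(w))$, with $O(1)$ overhead), identity, constants $y\mapsto x$, $y\mapsto\langle y,x\rangle$ (for each fixed $x$), $\langle x,y\rangle\mapsto y$, $\langle x,y\rangle\mapsto\langle y,x\rangle$,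 tensoring ($x\mapsto y$, $|y|\le|x|+O(1)$, $\{y\}(\langle z,w\rangle)\simeq\langle\{x\}(z),w\rangle$), $\langle x,\langle y,z\rangle\rangle\mapsto\langle\langle x,y\rangle,z\rangle$, evaluation ($\{e\}(\langle x,y\rangle)\simeq\{x\}(y)$) and currying ($\{e\}(x)=y$, $\{y\}(z)=u$, $|y|\le|x|+O(1)$, $|u|\le|y|+|z|+O(1)$, $\{u\}(w)\simeq\{x\}(\langle z,w\rangle)$), all with overhead $O(1)$, and for duplication $x\mapsto\langle x,x\rangle$ in time $O(|x|+1)$. **Length spaces.** A resource monoid is a commutative monoid $M$ with a compatible preorder in which $0$ is least and numbers $D(\alpha,\beta)\in\mathbb N$ for $\alpha\le\beta$ with $D(\alpha,\beta)+D(\beta,\gamma)\le D(\alpha,\gamma)$, $D(\alpha,\beta)\le D(\alpha+\gamma,\beta+\gamma)$, and $\|\alpha\|:=D(0,\alpha)$ unbounded. A length space over $M$ is a set $|A|$ with a relation $\alpha,e\Vdash_A a$ ($\alpha\in M,e\in L,a\in|A|$) such that $\alpha,e\Vdash a$ implies $|e|\le\|\alpha\|$; each $a$ has some $\alpha,e\Vdash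 a$; the relation is upward closed in $\alpha$; and $\alpha,e\Vdash a$, $\alpha,e\Vdash b$ imply $a=b$. A map $f:|A|\to|B|$ is realized by $e$ and majorized by $\varphi$ ($\varphi,e\Vdash_{A\multimap B}f$) if $|e|\le\|\varphi\|$ and whenever $\alpha,d\Vdash_A a$, $c=\{e\}(d)$ is defined and there is $\beta\le\varphi+\alpha$ with $\beta,c\Vdash_B f(a)$ and $T(e,d)\le D(\beta,\varphi+\alpha)$. Such maps are the morphisms and the elements of $A\multimap B$. $I$ has one element, realized by all $\alpha,e$ with $|e|\le\|\alpha\|$; $\alpha,e\Vdash_{A\otimes B}(a,b)$ iff $|e|\le\|\alpha\|$, $e=\langle f,g\rangle$, $\beta,f\Vdash_A a$, $\gamma,g\Vdash_B b$, $\beta+\gamma\le\alpha$ for some $f,g,\beta,\gamma$. $B_M$ is $\{0,1\}^*$ with $\alpha,\Phi(w)\Vdash w$ iff $|\Phi(w)|\le\|\alpha\|$. If $M$ carries operations $!,\S:M\to M$ with $\|\alpha\|\le\|!\alpha\|,\|\S\alpha\|$, then $!A$ (and likewise $\S A$) has the set $|A|$ and $\alpha,e\Vdash_{!A}a$ iff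 $\beta,e\Vdash_A a$ for some $\beta$ with $!\beta\le\alpha$. **Trees.** $\mathcal T$ consists of the trees $t::=\emptyset\mid(n,t,T)$, $n\in\mathbb N$, $T$ a finite nonempty set of trees, with $\emptyset$ neutral and $(n,t,T)+(m,u,U)=(n+m,t+u,T\cup U)$; $\mathrm{depth}(\emptyset)=0$, $\mathrm{depth}(n,t,T)=1+\max$ of the depths of $t$ and of the elements of $T$. Relations $\le^n_e$: $t\le^0_eu$ always, $\emptyset\le^{n}_eu$ always; $(m,t,T)\le^{n+1}_e\emptyset$ iff for some $d\ge0$, $m+d\le e$, $t\le^n_{d^2}\emptyset$ and $s\le^n_d\emptyset$ for all $s\in T$; $(m,t,T)\le_e^{n+1}(l,u,U)$ iff for some $d\ge0$, $m+d\le l+e$, $t\le^n_{d^2}u+\sum_{i=1}^df(i)$ for some $f:\{1,\dots,d\}\to U$, and for every $s\in T$ there is $z\in U$ with $s\le^n_dz$. Distances (where $\le^n_e$ holds; maxima over the $f$ for which the distance inside is defined): $D^0_e=0$, $D^{n+1}_e(\emptyset,\emptyset)=e+D^n_{e^2}(\emptyset,\emptyset)$, $D^{n+1}_e((m,t,T),\emptyset)=e-m+D^n_{(e-m)^2}(t,\emptyset)$,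 $D^{n+1}_e(\emptyset,(m,t,T))=m+e+\max_fD^n_{(m+e)^2}(\emptyset,t+\sum_{i=1}^{m+e}f(i))$ with $f$ into $T$, and $D^{n+1}_e((m,t,T),(l,u,U))=k+\max_fD^n_{k^2}(t,u+\sum_{i=1}^{k}f(i))$ with $k=l+e-m$ and $f$ into $U$. Put $t\le u$ iff $\mathrm{depth}(t)\le\mathrm{depth}(u)$ and $t\le_0^{\mathrm{depth}(u)}u$; $D(t,u)=D_0^{\mathrm{depth}(u)}(t,u)$; $!t=(1,\emptyset,\{t\})$, $\S t=(0,t,\{\emptyset\})$. A light length space is a length space over $\mathcal T$. The monoid $\mathcal T^-$ of trees with a time debt consists of the pairs $(t,k)$ with $k\le\|t\|$, added componentwise, with $(t,k)\le(u,l)$ iff $t\le u$ and $l\le k+D(t,u)$, $D((t,k),(u,l))=D(t,u)+k-l$, $!(t,k)=(!t,k)$, $\S(t,k)=(\S t,k)$. **Logic.** Formulas of LAL: $A::=\alpha\mid A\multimap A\mid A\otimes A\mid\forall\alpha.A\mid{!A}\mid\S A$. Rules, on intuitionistic sequents $\Gamma\vdash A$ with exchange: axiom $A\vdash A$; cut;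 weakening; the usual left and right rules of $\otimes$, $\multimap$ (multiplicative) and $\forall$ (second order); from $\Gamma,\Delta\vdash A$ infer $\S\Gamma,!\Delta\vdash\S A$; from $A\vdash B$ infer $!A\vdash{!B}$; from $\vdash A$ infer $\vdash{!A}$; contraction of $!A,!A$ to $!A$. With $M=\mathcal T$ or $\mathcal T^-$ and an environment $\eta$ of length spaces for the atoms, $[\![A]\!]_\eta$ is defined by the constructions above; $[\![\forall\alpha.A]\!]_\eta$ consists of the families $(a_S)_S$, $a_S\in[\![A]\!]_{\eta[\alpha\mapsto S]}$, indexed by all length spaces $S$ whose underlying set is the set of classes of a partial equivalence relation on $L$, for which some $\alpha,e$ satisfy $\alpha,e\Vdash a_S$ for all $S$ (this is $\alpha,e\Vdash(a_S)_S$). Every length space is canonically isomorphic to such an $S$ by a map that preserves majorized realizers. A morphism $[\![\Gamma]\!]_\eta\to[\![A]\!]_\eta$ ($[\![\Gamma]\!]$ the iterated tensor product starting with $I$) is the denotation of a proof of $\Gamma\vdash A$ if it is obtained from denotations of the premises of its last rule by the usual clause for that rule (for $\forall$ up to these canonical isomorphisms). Let $\mathit{List}=\forall\alpha.\,!(\alpha\multimap\alpha)\multimap{!(\alpha\multimap\alpha)}\multimap\S(\alpha\multimap\alpha)$.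 For $w=b_1\cdots b_n\in\{0,1\}^*$ let $\pi_w$ be the cut-free proof of $\vdash\mathit{List}$ that represents $w$, whose denotation sends $z_0,z_1$ to $z_{b_1}\circ\dots\circ z_{b_n}$. Let $Q_1,Q_2$ be finite words over $\{!,\S\}$. An element $F$ of $[\![Q_1\mathit{List}\multimap Q_2\mathit{List}]\!]_\eta$ *induces* $f:\{0,1\}^*\to\{0,1\}^*$ if for every $w$ there is a denotation $l$ of $\pi_w$ such that the component of $F(l)$ at the space $B_M$, applied to the two morphisms $s_b(v)=bv$ $(b=0,1)$ and to the empty string, is $f(w)$. **Theorem.** For every computational model as above, every LAL proof $\pi$ of $\vdash Q_1\mathit{List}\multimap Q_2\mathit{List}$ and every environment $\eta$: 1. (over $\mathcal T$) every element $F$ denoted by $\pi$ in light length spaces induces exactly one function $f:\{0,1\}^*\to\{0,1\}^*$, and $f$ is computable in polynomial time; 2. (over $\mathcal T^-$) $\pi$ denotes exactly one element $F$; it induces exactly one function $f:\{0,1\}^*\to\{0,1\}^*$, and $f$ is computable in polynomial time. -/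

import Mathlib

namespace LAL

/-- The set of trees: a tree is either `empty` or a triple `node n t T` with `n : ℕ`, `t` a tree
and `T` a finite nonempty set of trees. Trees are hereditarily finite, so they are represented by
natural numbers; `Tree.viewEquiv` and `Tree.induction` below say that this is the intended type. -/
structure Tree where
  code : ℕ

namespace Tree

theorem code_injective : Function.Injective Tree.code := by
  rintro ⟨a⟩ ⟨b⟩ h
  simpa using h

instance : DecidableEq Tree := fun a b =>
  decidable_of_iff (a.code = b.code) code_injective.eq_iff

/-- Finite sets of trees correspond to finite sets of codes. -/
def finsetEquiv : ℕ ≃ Finset Tree :=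
  Finset.equivBitIndices.trans
    (Equiv.finsetCongr ⟨Tree.mk, Tree.code, fun _ => rfl, fun _ => rfl⟩)

/-- The tree without any node. -/
def empty : Tree := ⟨0⟩

/-- The tree `node n t T`. -/
def node (n : ℕ) (t : Tree) (T : Finset Tree) (_hT : T.Nonempty) : Tree :=
  ⟨Nat.pair n (Nat.pair t.code (finsetEquiv.symm T - 1)) + 1⟩

theorem finsetEquiv_zero : finsetEquiv 0 = ∅ := by
  simp [finsetEquiv, Finset.equivBitIndices]

theorem finsetEquiv_succ_nonempty (k : ℕ) : (finsetEquiv (k + 1)).Nonempty := by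
  rw [Finset.nonempty_iff_ne_empty, ← finsetEquiv_zero]
  intro h
  exact absurd (finsetEquiv.injective h) (Nat.succ_ne_zero k)

theorem finsetEquiv_symm_pos {T : Finset Tree} (hT : T.Nonempty) : 0 < finsetEquiv.symm T := by
  rcases Nat.eq_zero_or_pos (finsetEquiv.symm T) with h | h
  · rw [Equiv.symm_apply_eq, finsetEquiv_zero] at h
    exact absurd h hT.ne_empty
  · exact h

theorem code_lt_of_mem {k : ℕ} {s : Tree} (h : s ∈ finsetEquiv k) : s.code < k := by
  simp only [finsetEquiv, Equiv.trans_apply, Equiv.finsetCongr_apply, Finset.mem_map,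
    Finset.equivBitIndices_apply, List.mem_toFinset] at h
  obtain ⟨a, ha, rfl⟩ := h
  exact Nat.lt_two_pow_self.trans_le (Nat.two_pow_le_of_mem_bitIndices ha)

/-- Decomposition of a tree: a tree is `empty` or a node, in exactly one way. -/
def viewEquiv : Tree ≃ Option (ℕ × Tree × {T : Finset Tree // T.Nonempty}) where
  toFun t := match t with
    | ⟨0⟩ => none
    | ⟨k + 1⟩ => some (k.unpair.1, ⟨k.unpair.2.unpair.1⟩,
        ⟨finsetEquiv (k.unpair.2.unpair.2 + 1), finsetEquiv_succ_nonempty _⟩)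
  invFun v := match v with
    | none => empty
    | some (n, t, T) => node n t T.1 T.2
  left_inv t := by
    rcases t with ⟨_ | k⟩ <;> simp [empty, node]
  right_inv v := by
    rcases v with _ | ⟨n, t, T, hT⟩
    · simp [empty]
    · have := finsetEquiv_symm_pos hT
      simp [node, Nat.sub_add_cancel this]

theorem viewEquiv_empty : viewEquiv empty = none :=
  viewEquiv.right_inv none

theorem viewEquiv_node (n : ℕ) (t : Tree) (T : Finset Tree) (hT : T.Nonempty) :
    viewEquiv (node n t T hT) = some (n, t, ⟨T, hT⟩) :=
  viewEquiv.right_inv (some (n, t, ⟨T, hT⟩))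

theorem code_lt_node (n : ℕ) (t : Tree) (T : Finset Tree) (hT : T.Nonempty) :
    t.code < (node n t T hT).code :=
  Nat.lt_succ_of_le ((Nat.left_le_pair _ _).trans (Nat.right_le_pair _ _))

theorem code_lt_node_of_mem (n : ℕ) (t : Tree) (T : Finset Tree) (hT : T.Nonempty) {s : Tree}
    (hs : s ∈ T) : s.code < (node n t T hT).code := by
  have h : s.code < finsetEquiv.symm T := code_lt_of_mem (by simpa using hs)
  have h1 : s.code ≤ finsetEquiv.symm T - 1 := by omega
  exact Nat.lt_succ_of_le (h1.trans ((Nat.right_le_pair _ _).trans (Nat.right_le_pair _ _)))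

theorem cases (t : Tree) : t = empty ∨ ∃ n u T hT, t = node n u T hT := by
  rcases h : viewEquiv t with _ | ⟨n, u, T, hT⟩
  · exact Or.inl (viewEquiv.injective (h.trans viewEquiv_empty.symm))
  · exact Or.inr ⟨n, u, T, hT, viewEquiv.injective (h.trans (viewEquiv_node n u T hT).symm)⟩

/-- Trees are well-founded: structural induction. -/
theorem induction {P : Tree → Prop} (h0 : P empty)
    (h1 : ∀ n t T (hT : T.Nonempty), P t → (∀ s ∈ T, P s) → P (node n t T hT)) (t : Tree) :
    P t := by
  induction hk : t.code using Nat.strong_induction_on generalizing t with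
  | _ k ih =>
    rcases cases t with rfl | ⟨n, u, T, hT, rfl⟩
    · exact h0
    · subst hk
      exact h1 n u T hT (ih _ (code_lt_node n u T hT) u rfl)
        fun s hs => ih _ (code_lt_node_of_mem n u T hT hs) s rfl

theorem view_lt {t : Tree} {n : ℕ} {u : Tree} {T : {T : Finset Tree // T.Nonempty}}
    (h : viewEquiv t = some (n, u, T)) : u.code < t.code ∧ ∀ s ∈ T.1, s.code < t.code := by
  obtain rfl : t = node n u T.1 T.2 :=
    viewEquiv.injective (h.trans (viewEquiv_node n u T.1 T.2).symm)
  exact ⟨code_lt_node _ _ _ _, fun s hs => code_lt_node_of_mem _ _ _ _ hs⟩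

/-- The sum of two trees. -/
def add (t u : Tree) : Tree :=
  match _ht : viewEquiv t, viewEquiv u with
  | none, _ => u
  | some _, none => t
  | some (n, t', T), some (m, u', U) =>
      node (n + m) (add t' u') (T.1 ∪ U.1) (T.2.mono Finset.subset_union_left)
termination_by t.code
decreasing_by exact (view_lt _ht).1

/-- The depth of a tree. -/
def depth (t : Tree) : ℕ :=
  match ht : viewEquiv t with
  | none => 0
  | some (_, t', T) => 1 + max (depth t') (T.1.attach.sup fun s => depth s.1)
termination_by t.code
decreasing_by
  · exact (view_lt ht).1
  · exact (view_lt ht).2 _ s.2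

theorem empty_add (u : Tree) : add empty u = u := by
  rw [add]
  split <;> simp_all [viewEquiv_empty]

theorem add_empty (u : Tree) : add u empty = u := by
  rcases cases u with rfl | ⟨n, u, T, hT, rfl⟩ <;> rw [add] <;> split <;>
    simp_all [viewEquiv_empty, viewEquiv_node]

theorem node_add_node (n m : ℕ) (t u : Tree) (T U : Finset Tree) (hT : T.Nonempty)
    (hU : U.Nonempty) : add (node n t T hT) (node m u U hU) =
      node (n + m) (add t u) (T ∪ U) (hT.mono Finset.subset_union_left) := by
  rw [add]
  split
  · simp_all [viewEquiv_node]
  · simp_all [viewEquiv_node]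
  · rename_i h1 h2
    rw [viewEquiv_node] at h1 h2
    cases h1
    cases h2
    rfl

theorem depth_empty : depth empty = 0 := by
  rw [depth]
  split <;> simp_all [viewEquiv_empty]

theorem depth_node (n : ℕ) (t : Tree) (T : Finset Tree) (hT : T.Nonempty) :
    depth (node n t T hT) = 1 + max (depth t) (T.sup depth) := by
  rw [depth]
  split
  · simp_all [viewEquiv_node]
  · rename_i h
    rw [viewEquiv_node] at h
    cases h
    rw [Finset.sup_attach T depth]

theorem add_comm' (t u : Tree) : add t u = add u t := by
  induction t using induction generalizing u with
  | h0 => rw [empty_add, add_empty]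
  | h1 n t T hT iht _ =>
    rcases cases u with rfl | ⟨m, u, U, hU, rfl⟩
    · rw [empty_add, add_empty]
    · simp only [node_add_node, Nat.add_comm n m, iht u, Finset.union_comm T U]

theorem add_assoc' (t u v : Tree) : add (add t u) v = add t (add u v) := by
  induction t using induction generalizing u v with
  | h0 => simp only [empty_add]
  | h1 n t T hT iht _ =>
    rcases cases u with rfl | ⟨m, u, U, hU, rfl⟩
    · simp only [empty_add, add_empty]
    · rcases cases v with rfl | ⟨k, v, V, hV, rfl⟩
      · simp only [add_empty]
      · simp only [node_add_node, Nat.add_assoc, iht, Finset.union_assoc]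

instance : Zero Tree := ⟨empty⟩

instance : Add Tree := ⟨add⟩

instance : AddCommMonoid Tree where
  add_assoc := add_assoc'
  zero_add := empty_add
  add_zero := add_empty
  add_comm := add_comm'
  nsmul := nsmulRec

theorem empty_eq : empty = 0 := rfl

/-- The relations `t ≤_e^n u` on trees. -/
def leN : ℕ → ℕ → Tree → Tree → Prop
  | 0, _, _, _ => True
  | n + 1, e, t, u =>
    match viewEquiv t, viewEquiv u with
    | none, _ => True
    | some (m, t', T), none =>
        ∃ d, m + d ≤ e ∧ leN n (d ^ 2) t' empty ∧ ∀ s ∈ T.1, leN n d s empty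
    | some (m, t', T), some (l, u', U) =>
        ∃ d, m + d ≤ l + e ∧
          (∃ f : Fin d → Tree, (∀ i, f i ∈ U.1) ∧ leN n (d ^ 2) t' (u' + ∑ i, f i)) ∧
          ∀ s ∈ T.1, ∃ z ∈ U.1, leN n d s z

open Classical in
/-- The numbers `D_e^n(t, u)`, relevant for `t ≤_e^n u` only. The maxima range over those functions
`f` for which the distance in question is defined. -/
noncomputable def distN : ℕ → ℕ → Tree → Tree → ℕ
  | 0, _, _, _ => 0
  | n + 1, e, t, u =>
    match viewEquiv t, viewEquiv u with
    | none, none => e + distN n (e ^ 2) empty empty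
    | none, some (m, u', U) =>
        (m + e) + ((Fintype.piFinset fun _ : Fin (m + e) => U.1).filter fun f =>
          leN n ((m + e) ^ 2) empty (u' + ∑ i, f i)).sup fun f =>
            distN n ((m + e) ^ 2) empty (u' + ∑ i, f i)
    | some (m, t', _), none => (e - m) + distN n ((e - m) ^ 2) t' empty
    | some (m, t', _), some (l, u', U) =>
        (l + e - m) + ((Fintype.piFinset fun _ : Fin (l + e - m) => U.1).filter fun f =>
          leN n ((l + e - m) ^ 2) t' (u' + ∑ i, f i)).sup fun f =>
            distN n ((l + e - m) ^ 2) t' (u' + ∑ i, f i)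

/-- The three components of a tree, `empty` being read as `node 0 empty {empty}`. -/
def parts (t : Tree) : ℕ × Tree × {T : Finset Tree // T.Nonempty} :=
  (viewEquiv t).getD (0, empty, ⟨{empty}, Finset.singleton_nonempty _⟩)

def root (t : Tree) : ℕ := (parts t).1
def sub (t : Tree) : Tree := (parts t).2.1
def kids (t : Tree) : Finset Tree := (parts t).2.2.1

theorem kids_nonempty (t : Tree) : (kids t).Nonempty := (parts t).2.2.2

@[simp] theorem root_zero : root 0 = 0 := by simp [root, parts, ← empty_eq, viewEquiv_empty]
@[simp] theorem sub_zero : sub 0 = 0 := by simp [sub, parts, ← empty_eq, viewEquiv_empty]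
@[simp] theorem kids_zero : kids 0 = {0} := by simp [kids, parts, ← empty_eq, viewEquiv_empty]

@[simp] theorem root_node (n : ℕ) (t : Tree) (T : Finset Tree) (hT : T.Nonempty) :
    root (node n t T hT) = n := by simp [root, parts, viewEquiv_node]
@[simp] theorem sub_node (n : ℕ) (t : Tree) (T : Finset Tree) (hT : T.Nonempty) :
    sub (node n t T hT) = t := by simp [sub, parts, viewEquiv_node]
@[simp] theorem kids_node (n : ℕ) (t : Tree) (T : Finset Tree) (hT : T.Nonempty) :
    kids (node n t T hT) = T := by simp [kids, parts, viewEquiv_node]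

theorem root_add (t u : Tree) : root (t + u) = root t + root u := by
  rcases cases t with rfl | ⟨n, t, T, hT, rfl⟩
  · simp [empty_eq]
  rcases cases u with rfl | ⟨m, u, U, hU, rfl⟩
  · simp [empty_eq]
  change root (add _ _) = _
  simp [node_add_node]

theorem sub_add (t u : Tree) : sub (t + u) = sub t + sub u := by
  rcases cases t with rfl | ⟨n, t, T, hT, rfl⟩
  · simp [empty_eq]
  rcases cases u with rfl | ⟨m, u, U, hU, rfl⟩
  · simp [empty_eq]
  change sub (add _ _) = _
  simp only [node_add_node, sub_node]
  rfl

theorem kids_add_subset (t u : Tree) : kids (t + u) ⊆ kids t ∪ kids u := by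
  rcases cases t with rfl | ⟨n, t, T, hT, rfl⟩
  · simp [empty_eq, Finset.subset_insert]
  rcases cases u with rfl | ⟨m, u, U, hU, rfl⟩
  · simp [empty_eq]
  change kids (add _ _) ⊆ _
  simp [node_add_node]

theorem mem_kids_add {t u z : Tree} (h : z ∈ kids t ∪ kids u) : z = 0 ∨ z ∈ kids (t + u) := by
  rcases cases t with rfl | ⟨n, t, T, hT, rfl⟩
  · simpa [empty_eq] using h
  rcases cases u with rfl | ⟨m, u, U, hU, rfl⟩
  · simpa [empty_eq, or_comm] using h
  right
  change z ∈ kids (add _ _)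
  simpa [node_add_node] using h

theorem zero_leN (n e : ℕ) (t : Tree) : leN n e 0 t := by
  cases n <;> simp [leN, ← empty_eq, viewEquiv_empty]

/-- Uniform description of the order. -/
theorem leN_succ (n e : ℕ) (t u : Tree) : leN (n + 1) e t u ↔
    ∃ d, root t + d ≤ root u + e ∧
      (∃ f : Fin d → Tree, (∀ i, f i ∈ kids u) ∧ leN n (d ^ 2) (sub t) (sub u + ∑ i, f i)) ∧
      ∀ s ∈ kids t, ∃ z ∈ kids u, leN n d s z := by
  rcases cases t with rfl | ⟨m, t, T, hT, rfl⟩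
  · obtain ⟨z, hz⟩ := kids_nonempty u
    simp only [empty_eq, zero_leN, true_iff]
    exact ⟨0, by simp, ⟨Fin.elim0, fun i => i.elim0, by simp [zero_leN]⟩, fun s hs =>
      ⟨z, hz, by simp only [kids_zero, Finset.mem_singleton] at hs; rw [hs]; exact zero_leN _ _ _⟩⟩
  rcases cases u with rfl | ⟨l, u, U, hU, rfl⟩
  · simp only [leN, viewEquiv_node, viewEquiv_empty]
    simp only [empty_eq, root_node, root_zero, sub_node, sub_zero, kids_node, kids_zero,
      Finset.mem_singleton, _root_.zero_add, exists_eq_left]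
    refine exists_congr fun d => and_congr_right fun _ => and_congr_left fun _ =>
      ⟨fun h => ⟨fun _ => 0, by simp, by simpa using h⟩, ?_⟩
    rintro ⟨f, hf, h⟩
    simpa [hf] using h
  · simp [leN, viewEquiv_node]

theorem leN_mono {n e e' : ℕ} {t u : Tree} (he : e ≤ e') (h : leN n e t u) : leN n e' t u := by
  cases n with
  | zero => trivial
  | succ n =>
    rw [leN_succ] at h ⊢
    obtain ⟨d, h1, h2⟩ := h
    exact ⟨d, by omega, h2⟩

theorem leN_refl (n e : ℕ) (t : Tree) : leN n e t t := by
  refine leN_mono (Nat.zero_le e) ?_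
  induction n generalizing t with
  | zero => trivial
  | succ n ih =>
    rw [leN_succ]
    exact ⟨0, by simp, ⟨Fin.elim0, fun i => i.elim0, by simpa using ih _⟩, fun s hs => ⟨s, hs, ih s⟩⟩

theorem leN_trans_compat (n : ℕ) :
    (∀ e d t u v, leN n e t u → leN n d u v → leN n (e + d) t v) ∧
      ∀ e t u v, leN n e t u → leN n e (t + v) (u + v) := by
  induction n with
  | zero => exact ⟨fun _ _ _ _ _ _ _ => trivial, fun _ _ _ _ _ => trivial⟩
  | succ n ih =>
    obtain ⟨tr, co⟩ := ih
    have ad : ∀ a b t t' u u', leN n a t t' → leN n b u u' → leN n (a + b) (t + u) (t' + u') := by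
      intro a b t t' u u' h1 h2
      have h3 := co _ _ _ u h1
      have h4 := co _ _ _ t' h2
      rw [add_comm u, add_comm u'] at h4
      exact tr _ _ _ _ _ h3 h4
    have su : ∀ d k (f g : Fin k → Tree), (∀ i, leN n d (f i) (g i)) →
        leN n (k * d) (∑ i, f i) (∑ i, g i) := by
      intro d k f g h
      induction k with
      | zero => simpa using leN_refl n 0 0
      | succ k ihk =>
        rw [Fin.sum_univ_succ, Fin.sum_univ_succ]
        have := ad _ _ _ _ _ _ (h 0) (ihk _ _ fun i => h i.succ)
        rwa [show (k + 1) * d = d + k * d by ring]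
    constructor
    · intro e d t u v h1 h2
      rw [leN_succ] at h1 h2 ⊢
      obtain ⟨c, hc, ⟨f, hf, hfl⟩, hk⟩ := h1
      obtain ⟨b, hb, ⟨g, hg, hgl⟩, hl⟩ := h2
      choose h hh hhl using fun i => hl (f i) (hf i)
      refine ⟨b + c, by omega, ⟨Fin.append g h, ?_, ?_⟩, ?_⟩
      · intro i
        induction i using Fin.addCases with
        | left i => simpa using hg i
        | right i => simpa using hh i
      · have h3 := tr _ _ _ _ _ hfl (ad _ _ _ _ _ _ hgl (su _ _ _ _ hhl))
        rw [Fin.sum_univ_add]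
        simp only [Fin.append_left, Fin.append_right]
        rw [← add_assoc]
        exact leN_mono (by nlinarith) h3
      · intro s hs
        obtain ⟨z, hz, hz2⟩ := hk s hs
        obtain ⟨w, hw, hw2⟩ := hl z hz
        exact ⟨w, hw, leN_mono (by omega) (tr _ _ _ _ _ hz2 hw2)⟩
    · intro e t u v h
      rw [leN_succ] at h ⊢
      obtain ⟨d, hd, ⟨f, hf, hfl⟩, hk⟩ := h
      obtain ⟨z0, hz0⟩ := kids_nonempty (u + v)
      have lift : ∀ z ∈ kids u ∪ kids v, ∃ w ∈ kids (u + v), leN n 0 z w := by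
        intro z hz
        rcases mem_kids_add hz with rfl | hz
        · exact ⟨z0, hz0, zero_leN _ _ _⟩
        · exact ⟨z, hz, leN_refl _ _ _⟩
      choose g hg hgl using fun i => lift (f i) (Finset.mem_union_left _ (hf i))
      refine ⟨d, by simp only [root_add]; omega, ⟨g, hg, ?_⟩, ?_⟩
      · rw [sub_add, sub_add]
        have h1 := co _ _ _ (sub v) hfl
        have h2 := ad _ _ _ _ _ _ (leN_refl n 0 (sub u + sub v)) (su _ _ _ _ hgl)
        rw [add_right_comm] at h1
        exact leN_mono (by simp) (tr _ _ _ _ _ h1 h2)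
      · intro s hs
        rcases Finset.mem_union.1 (kids_add_subset _ _ hs) with hs | hs
        · obtain ⟨z, hz, hsz⟩ := hk s hs
          obtain ⟨w, hw, hzw⟩ := lift z (Finset.mem_union_left _ hz)
          exact ⟨w, hw, leN_mono (by simp) (tr _ _ _ _ _ hsz hzw)⟩
        · obtain ⟨w, hw, hsw⟩ := lift s (Finset.mem_union_right _ hs)
          exact ⟨w, hw, leN_mono (by simp) hsw⟩

theorem leN_trans {n e d : ℕ} {t u v : Tree} (h1 : leN n e t u) (h2 : leN n d u v) :
    leN n (e + d) t v := (leN_trans_compat n).1 _ _ _ _ _ h1 h2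

theorem leN_add {n a b : ℕ} {t t' u u' : Tree} (h1 : leN n a t t') (h2 : leN n b u u') :
    leN n (a + b) (t + u) (t' + u') := by
  have h3 := (leN_trans_compat n).2 _ _ _ u h1
  have h4 := (leN_trans_compat n).2 _ _ _ t' h2
  rw [add_comm u, add_comm u'] at h4
  exact leN_trans h3 h4

theorem leN_sum {n d k : ℕ} {f g : Fin k → Tree} (h : ∀ i, leN n d (f i) (g i)) :
    leN n (k * d) (∑ i, f i) (∑ i, g i) := by
  induction k with
  | zero => simpa using leN_refl n 0 0
  | succ k ih =>
    rw [Fin.sum_univ_succ, Fin.sum_univ_succ, show (k + 1) * d = d + k * d by ring]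
    exact leN_add (h 0) (ih fun i => h i.succ)

/-- The functions over which the maximum in the distance is taken exist. -/
theorem exists_valid {n e k : ℕ} {t u : Tree} (hr : root t + k = root u + e)
    (h : leN (n + 1) e t u) : ∃ f : Fin k → Tree, (∀ i, f i ∈ kids u) ∧
      leN n (k ^ 2) (sub t) (sub u + ∑ i, f i) := by
  rw [leN_succ] at h
  obtain ⟨d, hd, ⟨f, hf, hfl⟩, -⟩ := h
  obtain ⟨z, hz⟩ := kids_nonempty u
  obtain ⟨r, rfl⟩ : ∃ r, k = d + r := ⟨k - d, by omega⟩
  refine ⟨Fin.append f fun _ => z, ?_, ?_⟩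
  · intro i
    induction i using Fin.addCases with
    | left i => simpa using hf i
    | right i => simpa using hz
  · rw [Fin.sum_univ_add]
    simp only [Fin.append_left, Fin.append_right]
    rw [← add_assoc]
    have h3 := leN_add hfl (zero_leN n 0 (∑ _i : Fin r, z))
    rw [add_zero (sub t)] at h3
    exact leN_mono (by nlinarith) h3

theorem root_le {n e : ℕ} {t u : Tree} (h : leN (n + 1) e t u) :
    ∃ k, root t + k = root u + e := by
  rw [leN_succ] at h
  obtain ⟨d, hd, -⟩ := h
  exact ⟨root u + e - root t, by omega⟩

/-- Description of the distance as a maximum, uniform in the form of the trees. -/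
theorem distN_succ {n e k : ℕ} {t u : Tree} (hr : root t + k = root u + e)
    (h : leN (n + 1) e t u) :
    (∃ f : Fin k → Tree, (∀ i, f i ∈ kids u) ∧
      leN n (k ^ 2) (sub t) (sub u + ∑ i, f i) ∧
      distN (n + 1) e t u = k + distN n (k ^ 2) (sub t) (sub u + ∑ i, f i)) ∧
    ∀ f : Fin k → Tree, (∀ i, f i ∈ kids u) →
      leN n (k ^ 2) (sub t) (sub u + ∑ i, f i) →
      k + distN n (k ^ 2) (sub t) (sub u + ∑ i, f i) ≤ distN (n + 1) e t u := by
  classical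
  have key : ∀ (t u : Tree) (U : Finset Tree) (s : ℕ),
      s = k + ((Fintype.piFinset fun _ : Fin k => U).filter fun f =>
        leN n (k ^ 2) t (u + ∑ i, f i)).sup (fun f => distN n (k ^ 2) t (u + ∑ i, f i)) →
      (∃ f : Fin k → Tree, (∀ i, f i ∈ U) ∧ leN n (k ^ 2) t (u + ∑ i, f i)) →
      (∃ f : Fin k → Tree, (∀ i, f i ∈ U) ∧ leN n (k ^ 2) t (u + ∑ i, f i) ∧
        s = k + distN n (k ^ 2) t (u + ∑ i, f i)) ∧
      ∀ f : Fin k → Tree, (∀ i, f i ∈ U) → leN n (k ^ 2) t (u + ∑ i, f i) →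
        k + distN n (k ^ 2) t (u + ∑ i, f i) ≤ s := by
    rintro t u U s rfl ⟨f0, hf0, hl0⟩
    constructor
    · obtain ⟨f, hf, hs⟩ := Finset.exists_mem_eq_sup
        ((Fintype.piFinset fun _ : Fin k => U).filter fun f => leN n (k ^ 2) t (u + ∑ i, f i))
        ⟨f0, by simpa using ⟨hf0, hl0⟩⟩ (fun f => distN n (k ^ 2) t (u + ∑ i, f i))
      simp only [Finset.mem_filter, Fintype.mem_piFinset] at hf
      exact ⟨f, hf.1, hf.2, by rw [hs]⟩
    · intro f hf hl
      refine Nat.add_le_add_left ?_ k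
      exact Finset.le_sup (f := fun f : Fin k → Tree => distN n (k ^ 2) t (u + ∑ i, f i))
        (by simpa using ⟨hf, hl⟩)
  have key0 : ∀ (t : Tree) (s : ℕ), s = k + distN n (k ^ 2) t 0 →
      (∃ f : Fin k → Tree, (∀ i, f i ∈ ({0} : Finset Tree)) ∧
        leN n (k ^ 2) t (0 + ∑ i, f i)) →
      (∃ f : Fin k → Tree, (∀ i, f i ∈ ({0} : Finset Tree)) ∧ leN n (k ^ 2) t (0 + ∑ i, f i) ∧
        s = k + distN n (k ^ 2) t (0 + ∑ i, f i)) ∧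
      ∀ f : Fin k → Tree, (∀ i, f i ∈ ({0} : Finset Tree)) → leN n (k ^ 2) t (0 + ∑ i, f i) →
        k + distN n (k ^ 2) t (0 + ∑ i, f i) ≤ s := by
    rintro t s rfl ⟨f0, hf0, hl0⟩
    have hz : ∀ f : Fin k → Tree, (∀ i, f i ∈ ({0} : Finset Tree)) → 0 + ∑ i, f i = 0 := by
      intro f hf
      simp only [Finset.mem_singleton] at hf
      simp [hf]
    exact ⟨⟨f0, hf0, hl0, by rw [hz f0 hf0]⟩, fun f hf _ => by rw [hz f hf]⟩
  have hv := exists_valid hr h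
  clear h
  rcases cases t with rfl | ⟨m, t, T, hT, rfl⟩
  · rcases cases u with rfl | ⟨l, u, U, hU, rfl⟩
    · rw [empty_eq, kids_zero, sub_zero] at *
      refine key0 0 _ ?_ hv
      obtain rfl : k = e := by simpa using hr
      rw [distN, ← empty_eq, viewEquiv_empty]
    · rw [empty_eq, kids_node, sub_zero, sub_node, root_zero, root_node] at *
      refine key 0 u U _ ?_ hv
      obtain rfl : k = l + e := by omega
      rw [distN, ← empty_eq, viewEquiv_empty, viewEquiv_node]
  · rcases cases u with rfl | ⟨l, u, U, hU, rfl⟩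
    · rw [empty_eq, kids_zero, sub_zero, sub_node, root_node, root_zero] at *
      refine key0 t _ ?_ hv
      obtain rfl : k = e - m := by omega
      rw [distN, ← empty_eq, viewEquiv_empty, viewEquiv_node]
    · rw [kids_node, sub_node, sub_node, root_node, root_node] at *
      refine key t u U _ ?_ hv
      obtain rfl : k = l + e - m := by omega
      rw [distN, viewEquiv_node, viewEquiv_node]

theorem distN_trans_compat (n : ℕ) :
    (∀ e d t u v, leN n e t u → leN n d u v →
      distN n e t u + distN n d u v ≤ distN n (e + d) t v) ∧
    ∀ e t u v, leN n e t u → distN n e t u ≤ distN n e (t + v) (u + v) := by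
  induction n with
  | zero => exact ⟨fun _ _ _ _ _ _ _ => by simp [distN], fun _ _ _ _ _ => by simp [distN]⟩
  | succ n ih =>
    obtain ⟨tr, co⟩ := ih
    have mono : ∀ a b t u v, leN n a t u → leN n b u v →
        distN n a t u ≤ distN n (a + b) t v := fun a b t u v h1 h2 =>
      (Nat.le_add_right _ _).trans (tr a b t u v h1 h2)
    have monoe : ∀ a b t u, a ≤ b → leN n a t u → distN n a t u ≤ distN n b t u := by
      intro a b t u hab h
      obtain ⟨c, rfl⟩ := Nat.exists_eq_add_of_le hab
      exact mono _ _ _ _ _ h (leN_refl _ _ _)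
    constructor
    · intro e d t u v h1 h2
      obtain ⟨a, ha⟩ := root_le h1
      obtain ⟨b, hb⟩ := root_le h2
      obtain ⟨⟨f, hf, hfl, hfe⟩, -⟩ := distN_succ ha h1
      obtain ⟨⟨g, hg, hgl, hge⟩, -⟩ := distN_succ hb h2
      have hab : root t + (b + a) = root v + (e + d) := by omega
      have hub := (distN_succ hab (leN_trans h1 h2)).2
      rw [hfe, hge]
      rw [leN_succ] at h2
      obtain ⟨c, hc, -, hk⟩ := h2
      have hcb : c ≤ b := by omega
      choose p hp hpl using fun i => hk (f i) (hf i)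
      have hsum := leN_sum fun i => leN_mono hcb (hpl i)
      have l1 := leN_add hgl (leN_refl n 0 (∑ i, f i))
      have l2 := leN_add (leN_refl n 0 (sub v + ∑ i, g i)) hsum
      have l3 := leN_trans (leN_trans hfl l1) l2
      have d1 := co _ _ _ (∑ i, f i) hgl
      have d2 := tr _ _ _ _ _ hfl l1
      have d3 := mono _ _ _ _ _ (leN_trans hfl l1) l2
      have hle : a ^ 2 + (b ^ 2 + 0) + (0 + a * b) ≤ (b + a) ^ 2 := by nlinarith
      have d4 := monoe _ _ _ _ hle l3
      have hs : sub v + ∑ i, Fin.append g p i = sub v + ∑ i, g i + ∑ i, p i := by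
        rw [Fin.sum_univ_add]
        simp only [Fin.append_left, Fin.append_right]
        rw [← add_assoc]
      have h5 := hub (Fin.append g p) (fun i => by
        induction i using Fin.addCases with
        | left i => simpa using hg i
        | right i => simpa using hp i) (by rw [hs]; exact leN_mono hle l3)
      rw [hs] at h5
      simp only [Nat.add_zero] at d2 d3 d4
      omega
    · intro e t u v h
      obtain ⟨a, ha⟩ := root_le h
      obtain ⟨⟨f, hf, hfl, hfe⟩, -⟩ := distN_succ ha h
      have hab : root (t + v) + a = root (u + v) + e := by
        simp only [root_add]
        omega
      have hub := (distN_succ hab ((leN_trans_compat (n + 1)).2 _ _ _ v h)).2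
      rw [hfe]
      obtain ⟨z0, hz0⟩ := kids_nonempty (u + v)
      have lift : ∀ z ∈ kids u, ∃ w ∈ kids (u + v), leN n 0 z w := by
        intro z hz
        rcases mem_kids_add (Finset.mem_union_left (kids v) hz) with rfl | hz
        · exact ⟨z0, hz0, zero_leN _ _ _⟩
        · exact ⟨z, hz, leN_refl _ _ _⟩
      choose g hg hgl using fun i => lift (f i) (hf i)
      have d1 := co _ _ _ (sub v) hfl
      have l1 := leN_add hfl (leN_refl n 0 (sub v))
      have l2 := leN_add (leN_refl n 0 (sub u + sub v)) (leN_sum hgl)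
      rw [add_right_comm] at d1 l1
      have d2 := mono _ _ _ _ _ l1 l2
      have l3 := leN_trans l1 l2
      simp only [Nat.add_zero, Nat.mul_zero] at d2 l3
      have h5 := hub g hg (by rw [sub_add, sub_add]; exact l3)
      rw [sub_add, sub_add] at h5
      omega

@[simp] theorem depth_zero : depth 0 = 0 := depth_empty

theorem depth_add (t u : Tree) : depth (t + u) = max (depth t) (depth u) := by
  induction t using induction generalizing u with
  | h0 => rw [empty_eq, _root_.zero_add, depth_zero, Nat.zero_max]
  | h1 n t T hT iht _ =>
    rcases cases u with rfl | ⟨m, u, U, hU, rfl⟩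
    · rw [empty_eq, _root_.add_zero, depth_zero, Nat.max_zero]
    · change depth (add _ _) = _
      rw [node_add_node, depth_node, depth_node, depth_node, Finset.sup_union]
      change 1 + max (depth (t + u)) _ = _
      rw [iht]
      omega

theorem depth_sum {k d : ℕ} {f : Fin k → Tree} (h : ∀ i, depth (f i) ≤ d) :
    depth (∑ i, f i) ≤ d := by
  induction k with
  | zero => simp
  | succ k ih =>
    rw [Fin.sum_univ_succ, depth_add]
    exact max_le (h 0) (ih fun i => h i.succ)

theorem depth_sub {t : Tree} {n : ℕ} (h : depth t ≤ n + 1) : depth (sub t) ≤ n := by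
  rcases cases t with rfl | ⟨m, t, T, hT, rfl⟩
  · simp [empty_eq]
  · rw [depth_node] at h
    rw [sub_node]
    omega

theorem depth_kids {t s : Tree} {n : ℕ} (h : depth t ≤ n + 1) (hs : s ∈ kids t) :
    depth s ≤ n := by
  rcases cases t with rfl | ⟨m, t, T, hT, rfl⟩
  · simp only [empty_eq, kids_zero, Finset.mem_singleton] at hs
    simp [hs]
  · rw [kids_node] at hs
    have := Finset.le_sup (f := depth) hs
    rw [depth_node] at h
    omega

theorem eq_zero_of_depth {t : Tree} (h : depth t ≤ 0) : t = 0 := by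
  rcases cases t with rfl | ⟨m, t, T, hT, rfl⟩
  · rfl
  · rw [depth_node] at h
    omega

theorem up_succ {n e : ℕ} {t u : Tree} (ht : depth t ≤ n) (hu : depth u ≤ n) (h : leN n e t u) :
    leN (n + 1) e t u ∧ distN n e t u ≤ distN (n + 1) e t u := by
  induction n generalizing e t u with
  | zero => exact ⟨by rw [eq_zero_of_depth ht]; exact zero_leN _ _ _, by simp [distN]⟩
  | succ n ih =>
    have hl : leN (n + 1 + 1) e t u := by
      have h' := h
      rw [leN_succ] at h' ⊢
      obtain ⟨d, hd, ⟨f, hf, hfl⟩, hk⟩ := h'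
      refine ⟨d, hd, ⟨f, hf, (ih (depth_sub ht) ?_ hfl).1⟩, fun s hs => ?_⟩
      · rw [depth_add]
        exact max_le (depth_sub hu) (depth_sum fun i => depth_kids hu (hf i))
      · obtain ⟨z, hz, hsz⟩ := hk s hs
        exact ⟨z, hz, (ih (depth_kids ht hs) (depth_kids hu hz) hsz).1⟩
    refine ⟨hl, ?_⟩
    obtain ⟨k, hk⟩ := root_le h
    obtain ⟨⟨f, hf, hfl, hfe⟩, -⟩ := distN_succ hk h
    have h2 := ih (depth_sub ht) (by
      rw [depth_add]
      exact max_le (depth_sub hu) (depth_sum fun i => depth_kids hu (hf i))) hfl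
    have h3 := (distN_succ hk hl).2 f hf h2.1
    rw [hfe]
    omega

theorem up {n n' e : ℕ} {t u : Tree} (ht : depth t ≤ n) (hu : depth u ≤ n) (hn : n ≤ n')
    (h : leN n e t u) : leN n' e t u ∧ distN n e t u ≤ distN n' e t u := by
  induction n', hn using Nat.le_induction with
  | base => exact ⟨h, le_rfl⟩
  | succ k hk ih =>
    have := up_succ (ht.trans hk) (hu.trans hk) ih.1
    exact ⟨this.1, ih.2.trans this.2⟩

/-- The order on trees. -/
def le (t u : Tree) : Prop := depth t ≤ depth u ∧ leN (depth u) 0 t u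

/-- The distance on trees. -/
noncomputable def dist (t u : Tree) : ℕ := distN (depth u) 0 t u

/-- `bang t = node 1 empty {t}`. -/
def bang (t : Tree) : Tree := node 1 empty {t} (Finset.singleton_nonempty _)

/-- `sec t = node 0 t {empty}`. -/
def sec (t : Tree) : Tree := node 0 t {empty} (Finset.singleton_nonempty _)

theorem dist_unbounded (n : ℕ) : ∃ t, n ≤ dist 0 t := by
  refine ⟨node n empty {empty} (Finset.singleton_nonempty _), ?_⟩
  have hd : depth (node n empty {empty} (Finset.singleton_nonempty _)) = 0 + 1 := by
    rw [depth_node, depth_empty, Finset.sup_singleton, depth_empty]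
    rfl
  rw [dist, hd]
  obtain ⟨⟨f, -, -, hfe⟩, -⟩ := distN_succ (k := n) (by simp) (zero_leN (0 + 1) 0
    (node n empty {empty} (Finset.singleton_nonempty _)))
  omega

theorem le_trans' {t u v : Tree} (h1 : le t u) (h2 : le u v) :
    le t v ∧ dist t u + dist u v ≤ dist t v := by
  have h3 := up h1.1 le_rfl h2.1 h1.2
  refine ⟨⟨h1.1.trans h2.1, leN_trans h3.1 h2.2⟩, ?_⟩
  have := (distN_trans_compat _).1 _ _ _ _ _ h3.1 h2.2
  have h4 := h3.2
  simp only [dist]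
  simp only [Nat.add_zero] at this
  omega

theorem le_add' {t u : Tree} (v : Tree) (h : le t u) :
    le (t + v) (u + v) ∧ dist t u ≤ dist (t + v) (u + v) := by
  have hd : depth u ≤ depth (u + v) := by rw [depth_add]; exact le_max_left _ _
  have h3 := up h.1 le_rfl hd h.2
  refine ⟨⟨?_, leN_add h3.1 (leN_refl _ 0 v)⟩, ?_⟩
  · have := h.1
    rw [depth_add, depth_add]
    omega
  · exact h3.2.trans ((distN_trans_compat _).2 _ _ _ _ h3.1)

theorem zero_le' (t : Tree) : le 0 t :=
  ⟨by simp, zero_leN _ _ _⟩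

theorem norm_bang (t : Tree) : dist 0 t ≤ dist 0 (bang t) := by
  have hd : depth (bang t) = depth t + 1 := by
    rw [bang, depth_node, depth_empty, Finset.sup_singleton, Nat.zero_max, Nat.add_comm]
  rw [dist, dist, hd]
  have h := (distN_succ (k := 1) (by simp [bang]) (zero_leN (depth t + 1) 0 (bang t))).2
    (fun _ => t) (by simp [bang]) (by rw [sub_zero]; exact zero_leN _ _ _)
  have h2 := (distN_trans_compat (depth t)).1 0 1 0 t t (zero_leN _ _ _) (leN_refl _ _ _)
  have hs : sub (bang t) + ∑ _i : Fin 1, t = t := by simp [bang, empty_eq]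
  rw [hs, sub_zero] at h
  simp only [_root_.zero_add, Nat.one_pow] at h h2
  omega

theorem norm_sec (t : Tree) : dist 0 t ≤ dist 0 (sec t) := by
  have hd : depth (sec t) = depth t + 1 := by
    rw [sec, depth_node, Finset.sup_singleton, depth_empty, Nat.max_zero, Nat.add_comm]
  rw [dist, dist, hd]
  have h := (distN_succ (k := 0) (by simp [sec]) (zero_leN (depth t + 1) 0 (sec t))).2
    (fun _ => 0) (by simp) (by rw [sub_zero]; exact zero_leN _ _ _)
  have hs : sub (sec t) + ∑ _i : Fin 0, (0 : Tree) = t := by simp [sec]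
  rw [hs, sub_zero] at h
  simpa using h

end Tree

/-! ### Resource monoids -/

/-- Resource monoids. The distance `dist a b` is meaningful only if `le a b`, and all the laws are
restricted to this case. -/
structure ResourceMonoid where
  Carrier : Type
  addCommMonoid : AddCommMonoid Carrier
  le : Carrier → Carrier → Prop
  dist : Carrier → Carrier → ℕ
  le_refl : ∀ a, le a a
  le_trans : ∀ {a b c}, le a b → le b c → le a c
  add_le_add : ∀ {a b} (c), le a b → le (a + c) (b + c)
  zero_le : ∀ a, le 0 a
  dist_triangle : ∀ {a b c}, le a b → le b c → dist a b + dist b c ≤ dist a c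
  dist_add : ∀ {a b} (c), le a b → dist a b ≤ dist (a + c) (b + c)
  dist_unbounded : ∀ n, ∃ a, n ≤ dist 0 a

attribute [instance] ResourceMonoid.addCommMonoid

namespace ResourceMonoid

variable (M : ResourceMonoid)

/-- The norm of an element. -/
def norm (a : M.Carrier) : ℕ := M.dist 0 a

variable {M}

theorem norm_mono {a b : M.Carrier} (h : M.le a b) : M.norm a ≤ M.norm b :=
  (Nat.le_add_right _ _).trans (M.dist_triangle (M.zero_le a) h)

theorem dist_mono {a b c : M.Carrier} (h : M.le a b) (h2 : M.le b c) :
    M.dist a b ≤ M.dist a c :=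
  (Nat.le_add_right _ _).trans (M.dist_triangle h h2)

theorem add_le_add_left {a b : M.Carrier} (c : M.Carrier) (h : M.le a b) :
    M.le (c + a) (c + b) := by
  rw [add_comm c a, add_comm c b]
  exact M.add_le_add c h

theorem add_le_add' {a b c d : M.Carrier} (h : M.le a b) (h2 : M.le c d) :
    M.le (a + c) (b + d) :=
  M.le_trans (M.add_le_add c h) (add_le_add_left b h2)

theorem le_add_right (a b : M.Carrier) : M.le a (a + b) := by
  have := add_le_add_left a (M.zero_le b)
  rwa [add_zero] at this

theorem le_add_left (a b : M.Carrier) : M.le a (b + a) := by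
  rw [add_comm]
  exact le_add_right a b

theorem norm_add (a b : M.Carrier) : M.norm a + M.norm b ≤ M.norm (a + b) := by
  have h1 := M.dist_triangle (M.zero_le a) (le_add_right a b)
  have h2 := M.dist_add a (M.zero_le b)
  rw [zero_add, add_comm b a] at h2
  simp only [norm]
  omega

end ResourceMonoid

/-- Resource monoids with the two operations that interpret the modalities. -/
structure LightMonoid extends ResourceMonoid where
  bang : Carrier → Carrier
  sec : Carrier → Carrier
  norm_le_bang : ∀ a, dist 0 a ≤ dist 0 (bang a)
  norm_le_sec : ∀ a, dist 0 a ≤ dist 0 (sec a)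

/-- The resource monoid of trees. -/
noncomputable def treeMonoid : LightMonoid where
  Carrier := Tree
  addCommMonoid := inferInstance
  le := Tree.le
  dist := Tree.dist
  le_refl _ := ⟨le_rfl, Tree.leN_refl _ _ _⟩
  le_trans h1 h2 := (Tree.le_trans' h1 h2).1
  add_le_add c h := (Tree.le_add' c h).1
  zero_le := Tree.zero_le'
  dist_triangle h1 h2 := (Tree.le_trans' h1 h2).2
  dist_add c h := (Tree.le_add' c h).2
  dist_unbounded := Tree.dist_unbounded
  bang := Tree.bang
  sec := Tree.sec
  norm_le_bang := Tree.norm_bang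
  norm_le_sec := Tree.norm_sec

/-- The pairs of an element `a` and a number that is at most the norm of `a`. -/
def debtSubmonoid (M : ResourceMonoid) : AddSubmonoid (M.Carrier × ℕ) where
  carrier := {p | p.2 ≤ M.norm p.1}
  add_mem' ha hb := (Nat.add_le_add ha hb).trans (ResourceMonoid.norm_add _ _)
  zero_mem' := Nat.zero_le _

/-- The resource monoid of the elements of `M` with a time debt: `(a, k)` stands for `a` after `k`
units of time have been consumed. -/
def withDebt (M : LightMonoid) : LightMonoid where
  Carrier := debtSubmonoid M.toResourceMonoid
  addCommMonoid := inferInstance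
  le p q := M.le p.1.1 q.1.1 ∧ q.1.2 ≤ p.1.2 + M.dist p.1.1 q.1.1
  dist p q := M.dist p.1.1 q.1.1 + p.1.2 - q.1.2
  le_refl p := ⟨M.le_refl _, Nat.le_add_right _ _⟩
  le_trans h1 h2 := ⟨M.le_trans h1.1 h2.1, by
    have := M.dist_triangle h1.1 h2.1
    have := h1.2
    have := h2.2
    omega⟩
  add_le_add c h := ⟨M.add_le_add c.1.1 h.1, by
    have := M.dist_add c.1.1 h.1
    have := h.2
    simp only [AddSubmonoid.coe_add, Prod.fst_add, Prod.snd_add]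
    omega⟩
  zero_le p := ⟨M.zero_le _, p.2.trans (Nat.le_add_left _ _)⟩
  dist_triangle h1 h2 := by
    have := M.dist_triangle h1.1 h2.1
    have := h1.2
    have := h2.2
    omega
  dist_add c h := by
    have := M.dist_add c.1.1 h.1
    simp only [AddSubmonoid.coe_add, Prod.fst_add, Prod.snd_add]
    omega
  dist_unbounded n := by
    obtain ⟨a, ha⟩ := M.dist_unbounded n
    exact ⟨⟨(a, 0), Nat.zero_le _⟩, by simpa using ha⟩
  bang p := ⟨(M.bang p.1.1, p.1.2), p.2.trans (M.norm_le_bang _)⟩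
  sec p := ⟨(M.sec p.1.1, p.1.2), p.2.trans (M.norm_le_sec _)⟩
  norm_le_bang p := by
    have := M.norm_le_bang p.1.1
    simp only [AddSubmonoid.coe_zero, Prod.fst_zero, Prod.snd_zero]
    omega
  norm_le_sec p := by
    have := M.norm_le_sec p.1.1
    simp only [AddSubmonoid.coe_zero, Prod.fst_zero, Prod.snd_zero]
    omega

/-! ### The computational model -/

/-- A function on binary strings is computable in polynomial time. -/
def PolyTime (f : List Bool → List Bool) : Prop :=
  Nonempty (Turing.TM2ComputableInPolyTime (id : List Bool → List Bool)
    (id : List Bool → List Bool) f)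

/-- Models of computation: a set `L` of strings over a finite alphabet with a partial application, a
time measure (relevant where the application is defined) and a length. All constants `O(1)` are
constants of the model. -/
structure CompModel where
  Sym : Type
  sym_finite : Finite Sym
  L : Set (List Sym)
  pair : L → L → L
  size : L → ℕ
  /-- The constant in the length of a pair. -/
  cp : ℕ
  size_pair : ∀ x y, size (pair x y) = size x + size y + cp
  size_le_length : ∀ x, size x ≤ x.1.length
  app : L → L → Part L
  time : L → L → ℕ
  /-- One Turing machine evaluates all applications, in time polynomial in the time measure and the
  lengths. -/
  invariance : ∃ (U : Turing.TM2ComputableAux (Option Sym) Sym) (p : Polynomial ℕ),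
    ∀ e x y, y ∈ app e x → Nonempty (Turing.TM2OutputsInTime U.tm
      ((e.1.map some ++ none :: x.1.map some).map U.inputAlphabet.invFun)
      (some (y.1.map U.outputAlphabet.invFun)) (p.eval (time e x + size e + size x)))
  /-- The embedding of binary strings. -/
  emb : List Bool → L
  emb_injective : Function.Injective emb
  emb_polyTime : Nonempty (Turing.TM2ComputableInPolyTime (id : List Bool → List Bool)
    (fun x : L => x.1) emb)
  emb_inv_polyTime : Nonempty (Turing.TM2ComputableInPolyTime (fun w => (emb w).1)
    (id : List Bool → List Bool) (id : List Bool → List Bool))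
  emb_cons : ∃ c, ∀ b : Bool, ∃ e, ∀ w, app e (emb w) = Part.some (emb (b :: w)) ∧
    time e (emb w) ≤ c ∧ size (emb (b :: w)) ≤ size (emb w) + c
  comp : ∃ e c, ∀ x y, ∃ z, app e (pair x y) = Part.some z ∧ time e (pair x y) ≤ c ∧
    size z ≤ size x + size y + c ∧ ∀ w, app z w = (app x w).bind (app y) ∧
      ∀ v ∈ app x w, ∀ u ∈ app y v, time z w ≤ time x w + time y v + c
  ident : ∃ e c, ∀ x, app e x = Part.some x ∧ time e x ≤ c
  const : ∀ x, ∃ e c, ∀ y, app e y = Part.some x ∧ time e y ≤ c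
  tensConst : ∀ x, ∃ e c, ∀ y, app e y = Part.some (pair y x) ∧ time e y ≤ c
  throwFirst : ∃ e c, ∀ x y, app e (pair x y) = Part.some y ∧ time e (pair x y) ≤ c
  swap : ∃ e c, ∀ x y, app e (pair x y) = Part.some (pair y x) ∧ time e (pair x y) ≤ c
  tens : ∃ e c, ∀ x, ∃ y, app e x = Part.some y ∧ time e x ≤ c ∧ size y ≤ size x + c ∧
    ∀ z w, app y (pair z w) = (app x z).map (fun v => pair v w) ∧
      ∀ v ∈ app x z, time y (pair z w) ≤ time x z + c
  assl : ∃ e c, ∀ x y z, app e (pair x (pair y z)) = Part.some (pair (pair x y) z) ∧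
    time e (pair x (pair y z)) ≤ c
  contr : ∃ e c, ∀ x, app e x = Part.some (pair x x) ∧ time e x ≤ c * (size x + 1)
  eval : ∃ e c, ∀ x y, app e (pair x y) = app x y ∧
    ∀ v ∈ app x y, time e (pair x y) ≤ time x y + c
  curry : ∃ e c, ∀ x, ∃ y, app e x = Part.some y ∧ time e x ≤ c ∧ size y ≤ size x + c ∧
    ∀ z, ∃ u, app y z = Part.some u ∧ time y z ≤ c ∧ size u ≤ size y + size z + c ∧
      ∀ w, app u w = app x (pair z w) ∧ ∀ v ∈ app x (pair z w), time u w ≤ time x (pair z w) + c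

theorem CompModel.pair_injective (C : CompModel) {x y x' y' : C.L}
    (h : C.pair x y = C.pair x' y') : x = x' ∧ y = y' := by
  obtain ⟨e, c, he⟩ := C.throwFirst
  obtain ⟨s, d, hs⟩ := C.swap
  have key : ∀ {a b a' b' : C.L}, C.pair a b = C.pair a' b' → b = b' := by
    intro a b a' b' h
    have h1 := (he a b).1
    rw [h, (he a' b').1] at h1
    exact (Part.some_injective h1).symm
  refine ⟨?_, key h⟩
  have h1 := (hs x y).1
  rw [h, (hs x' y').1] at h1
  exact (key (Part.some_injective h1)).symm

/-! ### Length spaces -/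

/-- The conditions on the realizability relation of a length space: `rel α e a` says that `e`
realizes `a` and `α` majorizes the realizer. -/
structure IsLengthSpace (M : ResourceMonoid) (C : CompModel) {X : Type}
    (rel : M.Carrier → C.L → X → Prop) : Prop where
  size_le : ∀ {α e a}, rel α e a → C.size e ≤ M.norm α
  exists_rel : ∀ a, ∃ α e, rel α e a
  mono : ∀ {α β e a}, rel α e a → M.le α β → rel β e a
  unique : ∀ {α e a b}, rel α e a → rel α e b → a = b

structure LengthSpace (M : ResourceMonoid) (C : CompModel) where
  Carrier : Type
  rel : M.Carrier → C.L → Carrier → Prop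
  isLengthSpace : IsLengthSpace M C rel

section LengthSpaces

variable {M : ResourceMonoid} {C : CompModel}

theorem IsLengthSpace.unique' {X : Type} {rel : M.Carrier → C.L → X → Prop}
    (h : IsLengthSpace M C rel) {α β : M.Carrier} {e : C.L} {a b : X} (ha : rel α e a)
    (hb : rel β e b) : a = b :=
  h.unique (h.mono ha (ResourceMonoid.le_add_right α β))
    (h.mono hb (ResourceMonoid.le_add_left β α))

/-- `e` realizes the morphism `f` and `φ` majorizes it. -/
def Realizes (A B : LengthSpace M C) (φ : M.Carrier) (e : C.L) (f : A.Carrier → B.Carrier) :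
    Prop :=
  C.size e ≤ M.norm φ ∧ ∀ α d a, A.rel α d a → ∃ β c, B.rel β c (f a) ∧ M.le β (φ + α) ∧
    c ∈ C.app e d ∧ C.time e d ≤ M.dist β (φ + α)

/-- Morphisms of length spaces. -/
abbrev Hom (A B : LengthSpace M C) : Type :=
  {f : A.Carrier → B.Carrier // ∃ φ e, Realizes A B φ e f}

/-- The unit `I`. -/
def unitSpace (M : ResourceMonoid) (C : CompModel) : LengthSpace M C where
  Carrier := Unit
  rel α e _ := C.size e ≤ M.norm α
  isLengthSpace :=
    { size_le := fun h => h
      exists_rel := fun _ => by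
        obtain ⟨e, -⟩ := C.ident
        obtain ⟨α, hα⟩ := M.dist_unbounded (C.size e)
        exact ⟨α, e, hα⟩
      mono := fun h h2 => h.trans (ResourceMonoid.norm_mono h2)
      unique := fun _ _ => rfl }

/-- The length space of binary strings. -/
def binSpace (M : ResourceMonoid) (C : CompModel) : LengthSpace M C where
  Carrier := List Bool
  rel α e w := e = C.emb w ∧ C.size e ≤ M.norm α
  isLengthSpace :=
    { size_le := fun h => h.2
      exists_rel := fun w => by
        obtain ⟨α, hα⟩ := M.dist_unbounded (C.size (C.emb w))
        exact ⟨α, _, rfl, hα⟩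
      mono := fun h h2 => ⟨h.1, h.2.trans (ResourceMonoid.norm_mono h2)⟩
      unique := fun h h2 => C.emb_injective (h.1.symm.trans h2.1) }

def tensorSpace (A B : LengthSpace M C) : LengthSpace M C where
  Carrier := A.Carrier × B.Carrier
  rel α e x := C.size e ≤ M.norm α ∧ ∃ f g β γ, A.rel β f x.1 ∧ B.rel γ g x.2 ∧
    e = C.pair f g ∧ M.le (β + γ) α
  isLengthSpace :=
    { size_le := fun h => h.1
      exists_rel := fun x => by
        obtain ⟨β, f, hf⟩ := A.isLengthSpace.exists_rel x.1
        obtain ⟨γ, g, hg⟩ := B.isLengthSpace.exists_rel x.2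
        obtain ⟨δ, hδ⟩ := M.dist_unbounded (C.size (C.pair f g))
        exact ⟨β + γ + δ, C.pair f g,
          le_trans hδ (ResourceMonoid.norm_mono (ResourceMonoid.le_add_left δ (β + γ))),
          f, g, β, γ, hf, hg, rfl, ResourceMonoid.le_add_right _ _⟩
      mono := fun h h2 => by
        obtain ⟨h1, f, g, β, γ, hf, hg, he, hl⟩ := h
        exact ⟨h1.trans (ResourceMonoid.norm_mono h2), f, g, β, γ, hf, hg, he, M.le_trans hl h2⟩
      unique := fun h h2 => by
        obtain ⟨-, f, g, β, γ, hf, hg, he, -⟩ := h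
        obtain ⟨-, f', g', β', γ', hf', hg', he', -⟩ := h2
        obtain ⟨rfl, rfl⟩ := C.pair_injective (he.symm.trans he')
        exact Prod.ext (A.isLengthSpace.unique' hf hf') (B.isLengthSpace.unique' hg hg') }

def lolliSpace (A B : LengthSpace M C) : LengthSpace M C where
  Carrier := Hom A B
  rel φ e f := Realizes A B φ e f.1
  isLengthSpace :=
    { size_le := fun h => h.1
      exists_rel := fun f => f.2
      mono := fun {φ ψ e f} h h2 => by
        refine ⟨h.1.trans (ResourceMonoid.norm_mono h2), fun α d a ha => ?_⟩
        obtain ⟨β, c, h3, h4, h5, h6⟩ := h.2 α d a ha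
        have h7 := M.add_le_add α h2
        exact ⟨β, c, h3, M.le_trans h4 h7, h5, h6.trans (ResourceMonoid.dist_mono h4 h7)⟩
      unique := fun {φ e f g} h h2 => by
        refine Subtype.ext (funext fun a => ?_)
        obtain ⟨α, d, ha⟩ := A.isLengthSpace.exists_rel a
        obtain ⟨β, c, h3, -, h5, -⟩ := h.2 α d a ha
        obtain ⟨β', c', h3', -, h5', -⟩ := h2.2 α d a ha
        obtain rfl := Part.mem_unique h5 h5'
        exact B.isLengthSpace.unique' h3 h3' }

/-- Length spaces whose underlying set is the set of equivalence classes of a partial equivalence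
relation on `L`. -/
structure SmallSpace (M : ResourceMonoid) (C : CompModel) where
  per : C.L → C.L → Prop
  symm : ∀ {x y}, per x y → per y x
  trans : ∀ {x y z}, per x y → per y z → per x z
  rel : M.Carrier → C.L → {c : Set C.L // ∃ x, per x x ∧ c = {y | per x y}} → Prop
  isLengthSpace : IsLengthSpace M C rel

def SmallSpace.toLengthSpace (S : SmallSpace M C) : LengthSpace M C where
  Carrier := {c : Set C.L // ∃ x, S.per x x ∧ c = {y | S.per x y}}
  rel := S.rel
  isLengthSpace := S.isLengthSpace

instance : Nonempty (SmallSpace M C) :=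
  ⟨{ per := fun _ _ => False
     symm := fun h => h
     trans := fun h _ => h
     rel := fun _ _ _ => False
     isLengthSpace :=
      { size_le := fun h => h.elim
        exists_rel := fun a => a.2.elim fun _ h => h.1.elim
        mono := fun h _ => h
        unique := fun h => h.elim } }⟩

/-- The relation of having a common realized element. -/
def commonRel (A : LengthSpace M C) (x y : C.L) : Prop :=
  ∃ a α β, A.rel α x a ∧ A.rel β y a

/-- An element of a length space as the set of its realizers. -/
def classOf (A : LengthSpace M C) (a : A.Carrier) :
    {c : Set C.L // ∃ x, commonRel A x x ∧ c = {y | commonRel A x y}} :=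
  ⟨{y | ∃ β, A.rel β y a}, by
    obtain ⟨α, x, h⟩ := A.isLengthSpace.exists_rel a
    refine ⟨x, ⟨a, α, α, h, h⟩, Set.ext fun y => ⟨?_, ?_⟩⟩
    · rintro ⟨β, hy⟩
      exact ⟨a, α, β, h, hy⟩
    · rintro ⟨b, γ, β, hx, hy⟩
      obtain rfl := A.isLengthSpace.unique' h hx
      exact ⟨β, hy⟩⟩

/-- The isomorphic copy of a length space among the small ones. -/
def canon (A : LengthSpace M C) : SmallSpace M C where
  per := commonRel A
  symm := by
    rintro x y ⟨a, α, β, hx, hy⟩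
    exact ⟨a, β, α, hy, hx⟩
  trans := by
    rintro x y z ⟨a, α, β, hx, hy⟩ ⟨b, γ, δ, hy', hz⟩
    obtain rfl := A.isLengthSpace.unique' hy hy'
    exact ⟨a, α, δ, hx, hz⟩
  rel α e c := ∃ a, A.rel α e a ∧ c = classOf A a
  isLengthSpace :=
    { size_le := fun ⟨_, h, _⟩ => A.isLengthSpace.size_le h
      exists_rel := by
        rintro ⟨c, x, ⟨a, α, β, hx, hy⟩, rfl⟩
        refine ⟨α, x, a, hx, Subtype.ext (Set.ext fun y => ⟨?_, ?_⟩)⟩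
        · rintro ⟨b, γ, δ, hx', hy'⟩
          obtain rfl := A.isLengthSpace.unique' hx hx'
          exact ⟨δ, hy'⟩
        · rintro ⟨δ, hy'⟩
          exact ⟨a, α, δ, hx, hy'⟩
      mono := fun ⟨a, h, hc⟩ h2 => ⟨a, A.isLengthSpace.mono h h2, hc⟩
      unique := by
        rintro α e c c' ⟨a, ha, rfl⟩ ⟨b, hb, rfl⟩
        rw [A.isLengthSpace.unique ha hb] }

/-- The isomorphism from a length space to its copy. -/
def toCanon (A : LengthSpace M C) (a : A.Carrier) : (canon A).toLengthSpace.Carrier := classOf A a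

/-- The product over all small length spaces, restricted to the families that have a common
majorized realizer. -/
def forallSpace (T : SmallSpace M C → LengthSpace M C) : LengthSpace M C where
  Carrier := {a : ∀ S, (T S).Carrier // ∃ α e, ∀ S, (T S).rel α e (a S)}
  rel α e a := ∀ S, (T S).rel α e (a.1 S)
  isLengthSpace :=
    { size_le := fun h => (T (Classical.arbitrary _)).isLengthSpace.size_le (h _)
      exists_rel := fun a => a.2
      mono := fun h h2 S => (T S).isLengthSpace.mono (h S) h2
      unique := fun h h2 => Subtype.ext (funext fun S => (T S).isLengthSpace.unique (h S) (h2 S)) }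

/-- Two elements, possibly of different length spaces, correspond to each other under the canonical
isomorphisms: they have the same majorized realizers. -/
def Same {A B : LengthSpace M C} (a : A.Carrier) (b : B.Carrier) : Prop :=
  ∀ α e, A.rel α e a ↔ B.rel α e b

end LengthSpaces

section LightLengthSpaces

variable {M : LightMonoid} {C : CompModel}

def bangSpace (A : LengthSpace M.toResourceMonoid C) : LengthSpace M.toResourceMonoid C where
  Carrier := A.Carrier
  rel t e a := ∃ u, A.rel u e a ∧ M.le (M.bang u) t
  isLengthSpace :=
    { size_le := fun ⟨u, h, hl⟩ => (A.isLengthSpace.size_le h).trans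
        ((M.norm_le_bang u).trans (ResourceMonoid.norm_mono hl))
      exists_rel := fun a => by
        obtain ⟨u, e, h⟩ := A.isLengthSpace.exists_rel a
        exact ⟨_, e, u, h, M.le_refl _⟩
      mono := fun ⟨u, h, hl⟩ h2 => ⟨u, h, M.le_trans hl h2⟩
      unique := fun ⟨_, h, _⟩ ⟨_, h2, _⟩ => A.isLengthSpace.unique' h h2 }

def secSpace (A : LengthSpace M.toResourceMonoid C) : LengthSpace M.toResourceMonoid C where
  Carrier := A.Carrier
  rel t e a := ∃ u, A.rel u e a ∧ M.le (M.sec u) t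
  isLengthSpace :=
    { size_le := fun ⟨u, h, hl⟩ => (A.isLengthSpace.size_le h).trans
        ((M.norm_le_sec u).trans (ResourceMonoid.norm_mono hl))
      exists_rel := fun a => by
        obtain ⟨u, e, h⟩ := A.isLengthSpace.exists_rel a
        exact ⟨_, e, u, h, M.le_refl _⟩
      mono := fun ⟨u, h, hl⟩ h2 => ⟨u, h, M.le_trans hl h2⟩
      unique := fun ⟨_, h, _⟩ ⟨_, h2, _⟩ => A.isLengthSpace.unique' h h2 }

end LightLengthSpaces

/-! ### Formulas and proofs of light affine logic -/

/-- Formulas; atoms are de Bruijn indices, `all` binds index `0`. -/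
inductive Formula : Type
  | var : ℕ → Formula
  | lolli : Formula → Formula → Formula
  | tensor : Formula → Formula → Formula
  | all : Formula → Formula
  | bang : Formula → Formula
  | sec : Formula → Formula

namespace Formula

def upRen (ρ : ℕ → ℕ) : ℕ → ℕ
  | 0 => 0
  | n + 1 => ρ n + 1

def rename : (ℕ → ℕ) → Formula → Formula
  | ρ, var n => var (ρ n)
  | ρ, lolli A B => lolli (rename ρ A) (rename ρ B)
  | ρ, tensor A B => tensor (rename ρ A) (rename ρ B)
  | ρ, all A => all (rename (upRen ρ) A)
  | ρ, bang A => bang (rename ρ A)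
  | ρ, sec A => sec (rename ρ A)

def shift (A : Formula) : Formula := rename Nat.succ A

def upSubst (σ : ℕ → Formula) : ℕ → Formula
  | 0 => var 0
  | n + 1 => shift (σ n)

def subst : (ℕ → Formula) → Formula → Formula
  | σ, var n => σ n
  | σ, lolli A B => lolli (subst σ A) (subst σ B)
  | σ, tensor A B => tensor (subst σ A) (subst σ B)
  | σ, all A => all (subst (upSubst σ) A)
  | σ, bang A => bang (subst σ A)
  | σ, sec A => sec (subst σ A)

/-- Instantiation of index `0` in `A` by `D`. -/
def inst (A D : Formula) : Formula :=
  subst (fun n => match n with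
    | 0 => D
    | n + 1 => var n) A

end Formula

open Formula in
/-- Proofs. Contexts are written from right to left: the head of the list is the rightmost formula
of the context, so that `Δ ++ Γ` is the context usually written `Γ, Δ`. -/
inductive Proof : List Formula → Formula → Type
  | ax (A : Formula) : Proof [A] A
  | cut {Γ Δ : List Formula} {A B : Formula} : Proof Γ A → Proof (A :: Δ) B → Proof (Δ ++ Γ) B
  | weak {Γ : List Formula} {A : Formula} (B : Formula) : Proof Γ A → Proof (B :: Γ) A
  | exch (Γ : List Formula) {Δ : List Formula} {A B D : Formula} :
      Proof (Γ ++ A :: B :: Δ) D → Proof (Γ ++ B :: A :: Δ) D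
  | tensorL {Γ : List Formula} {A B D : Formula} :
      Proof (B :: A :: Γ) D → Proof (tensor A B :: Γ) D
  | tensorR {Γ Δ : List Formula} {A B : Formula} :
      Proof Γ A → Proof Δ B → Proof (Δ ++ Γ) (tensor A B)
  | lolliL {Γ Δ : List Formula} {A B D : Formula} :
      Proof Γ A → Proof (B :: Δ) D → Proof (lolli A B :: (Δ ++ Γ)) D
  | lolliR {Γ : List Formula} {A B : Formula} : Proof (A :: Γ) B → Proof Γ (lolli A B)
  | allL {Γ : List Formula} {A B : Formula} (D : Formula) :
      Proof (inst A D :: Γ) B → Proof (all A :: Γ) B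
  | allR {Γ : List Formula} {A : Formula} : Proof (Γ.map shift) A → Proof Γ (all A)
  | secP {Γ Δ : List Formula} {A : Formula} :
      Proof (Δ ++ Γ) A → Proof (Δ.map bang ++ Γ.map sec) (sec A)
  | bangP1 {A B : Formula} : Proof [A] B → Proof [bang A] (bang B)
  | bangP2 {A : Formula} : Proof [] A → Proof [] (bang A)
  | contr {Γ : List Formula} {A B : Formula} :
      Proof (bang A :: bang A :: Γ) B → Proof (bang A :: Γ) B

/-! ### The interpretation -/

section Interpretation

variable {M : LightMonoid} {C : CompModel}

/-- Environments assign length spaces to atoms. -/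
def Env (M : LightMonoid) (C : CompModel) : Type 1 := ℕ → LengthSpace M.toResourceMonoid C

def Env.cons (S : LengthSpace M.toResourceMonoid C) (η : Env M C) : Env M C
  | 0 => S
  | n + 1 => η n

/-- The interpretation of formulas. -/
def interp : Formula → Env M C → LengthSpace M.toResourceMonoid C
  | .var n, η => η n
  | .lolli A B, η => lolliSpace (interp A η) (interp B η)
  | .tensor A B, η => tensorSpace (interp A η) (interp B η)
  | .all A, η => forallSpace fun S => interp A (Env.cons S.toLengthSpace η)
  | .bang A, η => bangSpace (interp A η)
  | .sec A, η => secSpace (interp A η)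

/-- The interpretation of contexts as iterated tensor products. -/
def ctx : List Formula → Env M C → LengthSpace M.toResourceMonoid C
  | [], _ => unitSpace M.toResourceMonoid C
  | A :: Γ, η => tensorSpace (ctx Γ η) (interp A η)

variable {η : Env M C}

/-- Concatenation of elements of contexts. -/
def joinCtx {Γ : List Formula} (g : (ctx Γ η).Carrier) :
    (Δ : List Formula) → (ctx Δ η).Carrier → (ctx (Δ ++ Γ) η).Carrier
  | [], _ => g
  | _ :: Δ, d => (joinCtx g Δ d.1, d.2)

/-- Exchange of two neighbours in a context. -/
def swapCtx {Δ : List Formula} {A B : Formula} : (Γ : List Formula) →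
    (ctx (Γ ++ B :: A :: Δ) η).Carrier → (ctx (Γ ++ A :: B :: Δ) η).Carrier
  | [], x => ((x.1.1, x.2), x.1.2)
  | _ :: Γ, x => (swapCtx Γ x.1, x.2)

/-- The identity, since the modalities do not change the underlying sets. -/
def unsec : (Γ : List Formula) → (ctx (Γ.map Formula.sec) η).Carrier → (ctx Γ η).Carrier
  | [], x => x
  | _ :: Γ, x => (unsec Γ x.1, x.2)

/-- The identity, since the modalities do not change the underlying sets. -/
def unmodal (Γ : List Formula) : (Δ : List Formula) →
    (ctx (Δ.map Formula.bang ++ Γ.map Formula.sec) η).Carrier → (ctx (Δ ++ Γ) η).Carrier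
  | [], x => unsec Γ x
  | _ :: Δ, x => (unmodal Γ Δ x.1, x.2)

/-- `Denotes π η F`: the morphism `F` is the denotation of the proof `π` in the environment `η`. -/
def Denotes : {Γ : List Formula} → {A : Formula} → Proof Γ A → (η : Env M C) →
    Hom (ctx Γ η) (interp A η) → Prop
  | _, _, .ax _, _, F => ∀ x, F.1 x = x.2
  | _, _, .cut (Δ := Δ) π ρ, η, F => ∃ G H, Denotes π η G ∧ Denotes ρ η H ∧
      ∀ g d, F.1 (joinCtx g Δ d) = H.1 (d, G.1 g)
  | _, _, .weak _ π, η, F => ∃ G, Denotes π η G ∧ ∀ x, F.1 x = G.1 x.1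
  | _, _, .exch Γ π, η, F => ∃ G, Denotes π η G ∧ ∀ x, F.1 x = G.1 (swapCtx Γ x)
  | _, _, .tensorL π, η, F => ∃ G, Denotes π η G ∧ ∀ g a b, F.1 (g, (a, b)) = G.1 ((g, a), b)
  | _, _, .tensorR (Δ := Δ) π ρ, η, F => ∃ G H, Denotes π η G ∧ Denotes ρ η H ∧
      ∀ g d, F.1 (joinCtx g Δ d) = (G.1 g, H.1 d)
  | _, _, .lolliL (Δ := Δ) π ρ, η, F => ∃ G H, Denotes π η G ∧ Denotes ρ η H ∧
      ∀ g d f, F.1 (joinCtx g Δ d, f) = H.1 (d, f.1 (G.1 g))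
  | _, _, .lolliR π, η, F => ∃ G, Denotes π η G ∧ ∀ g a, (F.1 g).1 a = G.1 (g, a)
  | _, _, .allL (A := A) D π, η, F => ∃ G, Denotes π η G ∧
      ∀ g a, ∃ b : (interp (Formula.inst A D) η).Carrier,
        Same (A := interp A (Env.cons (canon (interp D η)).toLengthSpace η))
          (a.1 (canon (interp D η))) b ∧ F.1 (g, a) = G.1 (g, b)
  | Γ, _, .allR π, η, F => ∀ S : SmallSpace M.toResourceMonoid C,
      ∃ G, Denotes π (Env.cons S.toLengthSpace η) G ∧
        ∀ g : (ctx Γ η).Carrier, ∃ g', Same g g' ∧ (F.1 g).1 S = G.1 g'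
  | _, _, .secP (Γ := Γ) (Δ := Δ) π, η, F => ∃ G, Denotes π η G ∧
      ∀ x, F.1 x = G.1 (unmodal Γ Δ x)
  | _, _, .bangP1 π, η, F => ∃ G, Denotes π η G ∧ ∀ x, F.1 x = G.1 x
  | _, _, .bangP2 π, η, F => ∃ G, Denotes π η G ∧ ∀ x, F.1 x = G.1 x
  | _, _, .contr π, η, F => ∃ G, Denotes π η G ∧ ∀ g a, F.1 (g, a) = G.1 ((g, a), a)

/-- The element denoted by a closed proof. -/
def IsDenotation {A : Formula} (π : Proof [] A) (η : Env M C) (a : (interp A η).Carrier) : Prop :=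
  ∃ F, Denotes π η F ∧ F.1 () = a

end Interpretation

/-! ### Binary lists -/

/-- `α ⊸ α` for the atom with index `0`. -/
def endo : Formula := .lolli (.var 0) (.var 0)

/-- `∀ α. !(α ⊸ α) ⊸ !(α ⊸ α) ⊸ §(α ⊸ α)`. -/
def listLAL : Formula := .all (.lolli (.bang endo) (.lolli (.bang endo) (.sec endo)))

inductive Modality : Type
  | bang : Modality
  | sec : Modality

/-- A word of modalities in front of a formula. -/
def mods : List Modality → Formula → Formula
  | [], A => A
  | .bang :: m, A => .bang (mods m A)
  | .sec :: m, A => .sec (mods m A)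

/-- One copy of `α ⊸ α` for every letter. -/
def letters : List Bool → List Formula
  | [] => []
  | _ :: w => endo :: letters w

/-- The proof of `α ⊸ α, …, α ⊸ α, α ⊢ α` that applies the functions one after the other. -/
def iterProof : (w : List Bool) → Proof (.var 0 :: (letters w ++ [])) (.var 0)
  | [] => .ax _
  | _ :: w => .exch [] (.lolliL (Δ := []) (iterProof w) (.ax _))

/-- Contraction of the hypotheses that belong to the letters into the two leftmost list entries: the
first entry collects the letters `true`, the second one the letters `false`. -/
def collect {A : Formula} : (w : List Bool) →
    Proof (.bang endo :: .bang endo :: ((letters w).map .bang ++ [])) A →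
      Proof [.bang endo, .bang endo] A
  | [], π => π
  | true :: w, π => collect w (.contr (.exch [.bang endo] π))
  | false :: w, π => collect w (.exch [] (.contr (.exch [.bang endo] (.exch [] π))))

/-- The cut-free proof that represents a binary string. -/
def listProof (w : List Bool) : Proof [] listLAL :=
  .allR (.lolliR (.lolliR (collect w
    (.weak _ (.weak _ (.secP (Γ := []) (Δ := letters w) (.lolliR (iterProof w))))))))

section Induced

variable {M : LightMonoid} {C : CompModel} {η : Env M C}

/-- The identity, since the modalities do not change the underlying sets. -/
def addMods {A : Formula} : (m : List Modality) → (interp A η).Carrier →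
    (interp (mods m A) η).Carrier
  | [], a => a
  | .bang :: m, a => addMods m a
  | .sec :: m, a => addMods m a

/-- The identity, since the modalities do not change the underlying sets. -/
def stripMods {A : Formula} : (m : List Modality) → (interp (mods m A) η).Carrier →
    (interp A η).Carrier
  | [], a => a
  | .bang :: m, a => stripMods m a
  | .sec :: m, a => stripMods m a

/-- The space of binary strings, as a small length space. -/
def binSmall (M : LightMonoid) (C : CompModel) : SmallSpace M.toResourceMonoid C :=
  canon (binSpace M.toResourceMonoid C)

/-- The element of `binSmall` that belongs to a string. -/
def str (M : LightMonoid) (C : CompModel) (w : List Bool) :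
    (binSmall M C).toLengthSpace.Carrier := toCanon (binSpace M.toResourceMonoid C) w

/-- `Reads l v`: the component of `l` at the space of binary strings, applied to the two functions
that append a letter on the left and to the empty string, yields `v`. -/
def Reads (l : (interp listLAL η).Carrier) (v : List Bool) : Prop :=
  ∃ s₀ s₁ : Hom (binSmall M C).toLengthSpace (binSmall M C).toLengthSpace,
    (∀ w, s₀.1 (str M C w) = str M C (false :: w)) ∧
    (∀ w, s₁.1 (str M C w) = str M C (true :: w)) ∧
    (((l.1 (binSmall M C)).1 s₀).1 s₁).1 (str M C []) = str M C v

/-- `InducedBy F f`: the element `F` of a space `m₁ List ⊸ m₂ List` induces the function `f` on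
binary strings. -/
def InducedBy {m₁ m₂ : List Modality}
    (F : (interp (.lolli (mods m₁ listLAL) (mods m₂ listLAL)) η).Carrier)
    (f : List Bool → List Bool) : Prop :=
  ∀ w, ∃ l, IsDenotation (listProof w) η l ∧ Reads (stripMods m₂ (F.1 (addMods m₁ l))) (f w)

end Induced

end LAL

/-! An element of a function space carries one code and one majorizer, and the majorizer bounds the
running time of the code on every input. Let `F` be an element of the space of functions from `Q₁
List` to `Q₂ List`, with code `r` and majorizer `φ`. That `F` induces a polynomial-time function
rests on three facts.

Inputs: for a word `w` there is a code `x w` that turns realizers of two endomorphisms into a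
realizer of their composition along `w`, and `x (w ++ [b])` is computed from `x w` by a fixed code
in bounded time (`exists_word_codes`). Currying `x w` gives a realizer of the denotation of the
proof for `w`. Its majorizer depends on the length `n` of `w` only, has bounded depth, and its
entries are polynomial in `n` (`exists_list_realizers`). The heart of this is `Tree.word_le`: a root
number linear in `n` allows copies to be drawn from the two hypotheses under `!`, one for each
letter and further ones that pay for the running time.

Distances: the norm of a tree is computed level by level, and each level replaces the bounds on the
numbers by polynomials in them. For bounded depth the norm is therefore polynomial in the entries
(`Tree.distN_le_normPoly`). As the depth does not depend on `w`, the code `r` runs in polynomial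
time.

Outputs: applying a list to the two functions that append a letter and to the empty string takes
time linear in the norm of its majorizer plus a fixed summand (`exists_reads`). This summand can be
moved out of the modalities `Q₂` (`Tree.exists_mods_add_le`).

So `f w` is obtained by folding `w`: the evaluating machine produces `x w` letter by letter, then
runs one final code composed of currying, `r` and reading off, and the result is decoded
(`polyTime_of_fold`, `exists_induced`). The strings involved stay polynomially long because a run
lengthens its input at most by a multiple of its running time.

Denotations are unique because every clause determines all values (`Denotes.unique`). Existence is
shown by induction with one code and one majorizer for all environments (`exists_denotes`). Two
rules obstruct this. In the right rule of the quantifier the majorizer of the result may depend on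
the instance, and in the functoriality of `!` the time spent under `!` must be found outside. Debts
remove both obstacles (`Paying`): recording the time as debt gives a majorizer that depends on the
bound and the time only, and debt passes through `!` unchanged. Over plain trees existence is shown
for proofs without these rules (`Proof.Plain`). The proofs that represent words have this form up to
the final quantifier, which is introduced by hand since realizer and majorizer do not depend on the
instance. -/

namespace LAL

open Turing

/-! ### Running Turing machines as subroutines -/

/-- `b` is reached from `a` in at most `t` steps. -/
def ReachesIn {σ : Type*} (f : σ → Option σ) (t : ℕ) (a b : σ) : Prop :=
  ∃ n ≤ t, (flip bind f)^[n] (some a) = some b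

namespace ReachesIn

variable {σ : Type*} {f : σ → Option σ} {s t : ℕ} {a b c : σ}

theorem iterate_none (f : σ → Option σ) (n : ℕ) : (flip bind f)^[n] none = none := by
  induction n with
  | zero => rfl
  | succ n ih => rw [Function.iterate_succ_apply]; exact ih

theorem refl (a : σ) : ReachesIn f 0 a a := ⟨0, le_rfl, rfl⟩

theorem head (h : f a = some b) (h2 : ReachesIn f t b c) : ReachesIn f (t + 1) a c := by
  obtain ⟨n, hn, h3⟩ := h2
  refine ⟨n + 1, by omega, ?_⟩
  rw [Function.iterate_succ_apply]
  change (flip bind f)^[n] (f a) = _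
  rw [h, h3]

theorem trans (h : ReachesIn f s a b) (h2 : ReachesIn f t b c) : ReachesIn f (s + t) a c := by
  obtain ⟨n, hn, h3⟩ := h
  obtain ⟨m, hm, h4⟩ := h2
  exact ⟨m + n, by omega, by rw [Function.iterate_add_apply, h3, h4]⟩

theorem mono (h : ReachesIn f s a b) (hst : s ≤ t) : ReachesIn f t a b :=
  h.imp fun _ h => ⟨h.1.trans hst, h.2⟩

theorem of_evals {m : ℕ} (h : StateTransition.EvalsToInTime f a (some b) m) :
    ReachesIn f m a b := ⟨h.steps, h.steps_le_m, h.evals_in_steps⟩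

theorem evals (h : ReachesIn f t a b) :
    Nonempty (StateTransition.EvalsToInTime f a (some b) t) := by
  obtain ⟨n, hn, h⟩ := h
  exact ⟨⟨⟨n, h⟩, hn⟩⟩

/-- Simulation of one transition function by another one. -/
theorem simulate {τ : Type*} {g : τ → Option τ} (e : σ → τ)
    (he : ∀ a b, f a = some b → g (e a) = some (e b)) (h : ReachesIn f t a b) :
    ReachesIn g t (e a) (e b) := by
  obtain ⟨n, hn, h⟩ := h
  refine mono ?_ hn
  clear hn
  induction n generalizing a with
  | zero => cases h; exact refl _
  | succ n ih =>
    rw [Function.iterate_succ_apply] at h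
    change (flip bind f)^[n] (f a) = _ at h
    cases h2 : f a with
    | none =>
      rw [h2] at h
      rw [iterate_none] at h
      cases h
    | some c =>
      rw [h2] at h
      exact head (he _ _ h2) (ih h)

/-- A quantity that grows by at most `B` in each step. -/
theorem measure_le (μ : σ → ℕ) (B : ℕ) (hB : ∀ a b, f a = some b → μ b ≤ μ a + B)
    (h : ReachesIn f t a b) : μ b ≤ μ a + B * t := by
  obtain ⟨n, hn, h⟩ := h
  have key : ∀ (n : ℕ) (a : σ), (flip bind f)^[n] (some a) = some b → μ b ≤ μ a + B * n := by
    intro n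
    induction n with
    | zero => intro a h; cases h; simp
    | succ n ih =>
      intro a h
      rw [Function.iterate_succ_apply] at h
      change (flip bind f)^[n] (f a) = _ at h
      cases h2 : f a with
      | none =>
        rw [h2] at h
        rw [iterate_none] at h
        cases h
      | some c =>
        rw [h2] at h
        have := ih c h
        have := hB _ _ h2
        rw [Nat.mul_succ]
        omega
  have := key n a h
  have := Nat.mul_le_mul_left B hn
  omega

end ReachesIn

/-! ### Stack growth of a machine in one step -/

section Growth

variable {K : Type} [DecidableEq K] [Fintype K] {Γ : K → Type} {Λ σ : Type}

/-- The number of symbols that a statement can push. -/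
def pushes : TM2.Stmt Γ Λ σ → ℕ
  | .push _ _ q => pushes q + 1
  | .peek _ _ q => pushes q
  | .pop _ _ q => pushes q
  | .load _ q => pushes q
  | .branch _ q r => pushes q + pushes r
  | .goto _ => 0
  | .halt => 0

theorem sum_length_update (S : ∀ k, List (Γ k)) (k : K) (l : List (Γ k)) :
    ∑ j, (Function.update S k l j).length + (S k).length = ∑ j, (S j).length + l.length := by
  rw [← Finset.add_sum_erase _ _ (Finset.mem_univ k),
    ← Finset.add_sum_erase Finset.univ (fun j => (S j).length) (Finset.mem_univ k),
    Function.update_self]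
  have : ∑ j ∈ Finset.univ.erase k, (Function.update S k l j).length =
      ∑ j ∈ Finset.univ.erase k, (S j).length :=
    Finset.sum_congr rfl fun j hj => by rw [Function.update_of_ne (Finset.ne_of_mem_erase hj)]
  rw [this]
  omega

/-- Only one arm of a branch is executed but `pushes` counts both, so the bound does not depend on
the internal state. -/
theorem sum_length_stepAux (q : TM2.Stmt Γ Λ σ) (v : σ) (S : ∀ k, List (Γ k)) :
    ∑ k, ((TM2.stepAux q v S).stk k).length ≤ ∑ k, (S k).length + pushes q := by
  induction q generalizing v S with
  | push k f q ih =>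
    have h1 := ih v (Function.update S k (f v :: S k))
    have h2 := sum_length_update S k (f v :: S k)
    simp only [TM2.stepAux, pushes, List.length_cons] at *
    omega
  | peek k f q ih => exact ih _ _
  | pop k f q ih =>
    have h1 := ih (f v (S k).head?) (Function.update S k (S k).tail)
    have h2 := sum_length_update S k (S k).tail
    have h3 : (S k).tail.length ≤ (S k).length := by simp
    simp only [TM2.stepAux, pushes] at *
    omega
  | load f q ih => exact ih _ _
  | branch f q r ih ih' =>
    have h1 := ih v S
    have h2 := ih' v S
    simp only [TM2.stepAux, pushes]
    cases f v <;> simp only [cond_true, cond_false] <;> omega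
  | goto f => simp [TM2.stepAux, pushes]
  | halt => simp [TM2.stepAux, pushes]

end Growth

/-- Updates of the empty stacks replace a case distinction with a cast along `k = tm.k₀`; stacks in
this form can be rewritten inside a family of machines. -/
theorem initList_eq (tm : FinTM2) (s : List (tm.Γ tm.k₀)) :
    initList tm s = ⟨some tm.main, tm.initialState, Function.update (fun _ => []) tm.k₀ s⟩ := by
  unfold initList
  congr 1
  funext k
  by_cases h : k = tm.k₀
  · subst h
    simp
  · simp [h]

theorem haltList_eq (tm : FinTM2) (s : List (tm.Γ tm.k₁)) :
    haltList tm s = ⟨none, tm.initialState, Function.update (fun _ => []) tm.k₁ s⟩ := by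
  unfold haltList
  congr 1
  funext k
  by_cases h : k = tm.k₁
  · subst h
    simp
  · simp [h]

theorem sum_length_single {K : Type} [DecidableEq K] [Fintype K] {Γ : K → Type} (k : K)
    (l : List (Γ k)) :
    ∑ j, ((Function.update (fun _ => []) k l : ∀ j, List (Γ j)) j).length = l.length := by
  have := sum_length_update (fun j => ([] : List (Γ j))) k l
  simpa using this

/-- The output of a machine is at most linearly longer than its input and its running time. -/
theorem exists_output_length_le (tm : FinTM2) : ∃ B, ∀ s s' t,
    ReachesIn tm.step t (initList tm s) (haltList tm s') → s'.length ≤ s.length + B * t := by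
  have := tm.ΛFin
  have := tm.kFin
  -- One step executes the statement of one label, so the sum over all labels bounds the growth of
  -- every step.
  refine ⟨∑ l, pushes (tm.m l), fun s s' t h => ?_⟩
  have := h.measure_le (fun c : tm.Cfg => ∑ k, (c.stk k).length) (∑ l, pushes (tm.m l)) (by
    rintro ⟨_ | l, v, S⟩ b hb
    · cases hb
    · cases hb
      have h1 := sum_length_stepAux (tm.m l) v S
      have h2 := Finset.single_le_sum (f := fun l => pushes (tm.m l)) (fun _ _ => Nat.zero_le _)
        (Finset.mem_univ l)
      exact h1.trans (Nat.add_le_add_left h2 _))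
  rw [initList_eq, haltList_eq] at this
  simpa only [sum_length_single] using this

/-! ### Several machines side by side inside one machine -/

section Family

variable {ι : Type} [DecidableEq ι] (tm : ι → FinTM2) {O : Type} [DecidableEq O] (Δ : O → Type)
  (Λ' σ' : Type)

/-- The stacks of a family of machines, together with further ones. -/
abbrev FamK (tm : ι → FinTM2) (O : Type) : Type := (Σ i, (tm i).K) ⊕ O

abbrev FamΓ : FamK tm O → Type
  | .inl p => (tm p.1).Γ p.2
  | .inr o => Δ o

abbrev FamΛ : Type := (Σ i, (tm i).Λ) ⊕ Λ'

abbrev Famσ : Type := (∀ i, (tm i).σ) × σ'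

abbrev FamStmt : Type := TM2.Stmt (FamΓ tm Δ) (FamΛ tm Λ') (Famσ tm σ')

abbrev FamCfg : Type := TM2.Cfg (FamΓ tm Δ) (FamΛ tm Λ') (Famσ tm σ')

variable {tm Δ Λ' σ'}

def famStk (S : ∀ i k, List ((tm i).Γ k)) (R : ∀ o, List (Δ o)) :
    ∀ k, List (FamΓ tm Δ k)
  | .inl p => S p.1 p.2
  | .inr o => R o

theorem update_famStk_inl (S : ∀ i k, List ((tm i).Γ k)) (R : ∀ o, List (Δ o)) (i : ι)
    (k : (tm i).K) (l : List ((tm i).Γ k)) :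
    Function.update (famStk S R) (.inl ⟨i, k⟩) l =
      famStk (Function.update S i (Function.update (S i) k l)) R := by
  funext j
  rcases j with ⟨i', k'⟩ | o
  · by_cases hi : i' = i
    · subst hi
      by_cases hk : k' = k
      · subst hk
        simp [famStk]
      · rw [Function.update_of_ne (by simpa using hk)]
        simp [famStk, hk]
    · rw [Function.update_of_ne (by
        intro h
        cases h
        exact hi rfl)]
      simp [famStk, hi]
  · rw [Function.update_of_ne (by simp)]
    rfl

theorem update_famStk_inr (S : ∀ i k, List ((tm i).Γ k)) (R : ∀ o, List (Δ o)) (o : O)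
    (l : List (Δ o)) :
    Function.update (famStk S R) (.inr o) l = famStk S (Function.update R o l) := by
  funext j
  rcases j with p | o'
  · rw [Function.update_of_ne (by simp)]
    rfl
  · by_cases ho : o' = o
    · subst ho
      simp [famStk]
    · rw [Function.update_of_ne (by simpa using ho)]
      simp [famStk, ho]

/-- A statement of one of the machines, as a statement of the whole family that continues at `ret`
when the machine halts. -/
def famStmt (i : ι) (ret : Λ') :
    TM2.Stmt (tm i).Γ (tm i).Λ (tm i).σ → FamStmt tm Δ Λ' σ'
  | .push k f q => .push (.inl ⟨i, k⟩) (fun v => f (v.1 i)) (famStmt i ret q)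
  | .peek k f q => .peek (.inl ⟨i, k⟩)
      (fun v o => (Function.update v.1 i (f (v.1 i) o), v.2)) (famStmt i ret q)
  | .pop k f q => .pop (.inl ⟨i, k⟩)
      (fun v o => (Function.update v.1 i (f (v.1 i) o), v.2)) (famStmt i ret q)
  | .load f q => .load (fun v => (Function.update v.1 i (f (v.1 i)), v.2)) (famStmt i ret q)
  | .branch f q r => .branch (fun v => f (v.1 i)) (famStmt i ret q) (famStmt i ret r)
  | .goto f => .goto fun v => .inl ⟨i, f (v.1 i)⟩
  | .halt => .goto fun _ => .inr ret

/-- A configuration of one of the machines, as a configuration of the whole family. -/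
def famCfg (i : ι) (ret : Λ') (vs : ∀ i, (tm i).σ) (s : σ') (S : ∀ i k, List ((tm i).Γ k))
    (R : ∀ o, List (Δ o)) (c : TM2.Cfg (tm i).Γ (tm i).Λ (tm i).σ) : FamCfg tm Δ Λ' σ' where
  l := some (match c.l with
    | some l => .inl ⟨i, l⟩
    | none => .inr ret)
  var := (Function.update vs i c.var, s)
  stk := famStk (Function.update S i c.stk) R

/-- Every clause of `famStmt` touches component `i` of the state and of the stacks only. Halting
becomes the jump to `ret`, which is why `famCfg` reads a missing label as `ret`. -/
theorem stepAux_famStmt (i : ι) (ret : Λ') (vs : ∀ i, (tm i).σ) (s : σ')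
    (S : ∀ i k, List ((tm i).Γ k)) (R : ∀ o, List (Δ o))
    (q : TM2.Stmt (tm i).Γ (tm i).Λ (tm i).σ) (v : (tm i).σ) (T : ∀ k, List ((tm i).Γ k)) :
    TM2.stepAux (famStmt (Δ := Δ) (σ' := σ') i ret q) (Function.update vs i v, s)
        (famStk (Function.update S i T) R) =
      famCfg i ret vs s S R (TM2.stepAux q v T) := by
  induction q generalizing v T with
  | push k f q ih =>
    rw [famStmt, TM2.stepAux, TM2.stepAux, update_famStk_inl, ← ih]
    simp [famStk]
  | peek k f q ih =>
    rw [famStmt, TM2.stepAux, TM2.stepAux, ← ih]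
    simp [famStk]
  | pop k f q ih =>
    rw [famStmt, TM2.stepAux, TM2.stepAux, update_famStk_inl, ← ih]
    simp [famStk]
  | load f q ih =>
    rw [famStmt, TM2.stepAux, TM2.stepAux, ← ih]
    simp
  | branch f q r ih ih' =>
    rw [famStmt, TM2.stepAux, TM2.stepAux, ih, ih']
    simp only [Function.update_self]
    cases f v <;> rfl
  | goto f => simp [famStmt, famCfg]
  | halt => simp [famStmt, famCfg]

/-- Calling one of the machines as a subroutine. -/
theorem ReachesIn.call {m : FamΛ tm Λ' → FamStmt tm Δ Λ' σ'} (i : ι) (ret : Λ')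
    (hm : ∀ l, m (.inl ⟨i, l⟩) = famStmt i ret ((tm i).m l)) {t : ℕ}
    {x : List ((tm i).Γ (tm i).k₀)} {y : List ((tm i).Γ (tm i).k₁)}
    (h : ReachesIn (tm i).step t (initList (tm i) x) (haltList (tm i) y)) (s : σ')
    (S : ∀ i k, List ((tm i).Γ k)) (R : ∀ o, List (Δ o)) :
    ReachesIn (TM2.step m) t
      ⟨some (.inl ⟨i, (tm i).main⟩), (fun i => (tm i).initialState, s), famStk
        (Function.update S i (Function.update (fun _ => []) (tm i).k₀ x)) R⟩
      ⟨some (.inr ret), (fun i => (tm i).initialState, s), famStk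
        (Function.update S i (Function.update (fun _ => []) (tm i).k₁ y)) R⟩ := by
  rw [initList_eq, haltList_eq] at h
  -- Steps correspond one to one, and the jump to `ret` happens within the step that halts, so the
  -- time bound `t` is kept.
  have := h.simulate (g := TM2.step m)
    (famCfg i ret (fun i => (tm i).initialState) s S R) (by
      rintro ⟨_ | l, v, T⟩ b hb
      · cases hb
      · cases hb
        refine congrArg some ?_
        exact (congrArg (fun q => TM2.stepAux q _ _) (hm l)).trans
          (stepAux_famStmt i ret _ s S R ((tm i).m l) v T))
  simpa only [famCfg, Function.update_eq_self] using this

end Family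

end LAL

namespace LAL

open Turing

/-! ### A machine that folds a word with one machine and decodes the result with another one -/

inductive FoldLabel : Type
  | start | loop | fill | drain | decode | done
  deriving DecidableEq

instance : Fintype FoldLabel :=
  ⟨{.start, .loop, .fill, .drain, .decode, .done}, fun l => by cases l <;> simp⟩

section Fold

variable {Sym : Type} (U : TM2ComputableAux (Option Sym) Sym)
  (V : TM2ComputableAux Sym Bool) (d : Bool → List Sym) (d' x₀ : List Sym)

/-- The two machines. -/
abbrev foldFam : Bool → FinTM2
  | false => U.tm
  | true => V.tm

/-- The remaining word and the accumulator. -/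
abbrev FoldΔ (Sym : Type) : Bool → Type
  | false => Bool
  | true => Sym

abbrev FoldStmt : Type := FamStmt (foldFam U V) (FoldΔ Sym) FoldLabel (Option Bool × Option Sym)

abbrev FoldCfg : Type := FamCfg (foldFam U V) (FoldΔ Sym) FoldLabel (Option Bool × Option Sym)

variable {U V} in
/-- Push all elements of a list. -/
def pushAll (k : FamK (foldFam U V) Bool) :
    List (FamΓ (foldFam U V) (FoldΔ Sym) k) → FoldStmt U V → FoldStmt U V
  | [], q => q
  | a :: l, q => .push k (fun _ => a) (pushAll k l q)

abbrev wordK : FamK (foldFam U V) Bool := .inr false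
abbrev accK : FamK (foldFam U V) Bool := .inr true
abbrev uIn : FamK (foldFam U V) Bool := .inl ⟨false, U.tm.k₀⟩
abbrev uOut : FamK (foldFam U V) Bool := .inl ⟨false, U.tm.k₁⟩
abbrev vIn : FamK (foldFam U V) Bool := .inl ⟨true, V.tm.k₀⟩
abbrev vOut : FamK (foldFam U V) Bool := .inl ⟨true, V.tm.k₁⟩

/-- Start `U`, applying the code `x`. -/
def fillWith (x : List Sym) : FoldStmt U V :=
  pushAll (uIn U V) (x.reverse.map fun s => U.inputAlphabet.symm (some s))
    (.load (fun v => (v.1, (v.2.1, none))) (.goto fun _ => .inl ⟨false, U.tm.main⟩))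

/-- The stacks of `U` and `V`, if at most one of them is not empty. -/
def only (i : Bool) (k : (foldFam U V i).K) (l : List ((foldFam U V i).Γ k)) :
    ∀ i k, List ((foldFam U V i).Γ k) :=
  Function.update (fun _ _ => []) i (Function.update (fun _ => []) k l)

def own (w : List Bool) (a : List Sym) : ∀ o, List (FoldΔ Sym o)
  | false => w
  | true => a

/-- Between calls both machines are in their initial states, since `initList` and `haltList` use
these. The registers `b` and `s` hold the current letter and the symbol being moved. -/
def conf (l : FamΛ (foldFam U V) FoldLabel) (b : Option Bool) (s : Option Sym)
    (S : ∀ i k, List ((foldFam U V i).Γ k)) (w : List Bool) (a : List Sym) : FoldCfg U V :=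
  ⟨some l, (fun i => (foldFam U V i).initialState, (b, s)), famStk S (own w a)⟩

/-- Empty stacks do not remember a selected machine. This is what allows a phase that ends with
empty stacks to be followed by one that fills a stack of another machine. -/
theorem only_nil (i : Bool) (k : (foldFam U V i).K) : only U V i k [] = fun _ _ => [] := by
  simp only [only]
  have : (Function.update (fun _ => []) k [] : ∀ j, List ((foldFam U V i).Γ j)) = fun _ => [] :=
    Function.update_eq_self (f := fun j => ([] : List ((foldFam U V i).Γ j))) k
  rw [this]
  exact Function.update_eq_self (f := fun i (j : (foldFam U V i).K) =>
    ([] : List ((foldFam U V i).Γ j))) i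

theorem update_only (i : Bool) (k : (foldFam U V i).K) (l l' : List ((foldFam U V i).Γ k))
    (R : ∀ o, List (FoldΔ Sym o)) :
    Function.update (famStk (only U V i k l) R) (.inl ⟨i, k⟩) l' =
      famStk (only U V i k l') R := by
  rw [update_famStk_inl]
  simp [only]

theorem famStk_only (i : Bool) (k : (foldFam U V i).K) (l : List ((foldFam U V i).Γ k))
    (R : ∀ o, List (FoldΔ Sym o)) : famStk (only U V i k l) R (.inl ⟨i, k⟩) = l := by
  simp [famStk, only]

theorem update_own_false (w w' : List Bool) (a : List Sym) :
    Function.update (own w a) false w' = own w' a := by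
  funext o
  cases o <;> simp [own]

theorem update_own_true (w : List Bool) (a a' : List Sym) :
    Function.update (own w a) true a' = own w a' := by
  funext o
  cases o <;> simp [own]

theorem stepAux_pushAll (k : FamK (foldFam U V) Bool)
    (l : List (FamΓ (foldFam U V) (FoldΔ Sym) k)) (q : FoldStmt U V)
    (v : Famσ (foldFam U V) (Option Bool × Option Sym))
    (T : ∀ k, List (FamΓ (foldFam U V) (FoldΔ Sym) k)) :
    TM2.stepAux (pushAll k l q) v T =
      TM2.stepAux q v (Function.update T k (l.reverse ++ T k)) := by
  induction l generalizing T with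
  | nil => simp [pushAll]
  | cons a l ih =>
    rw [pushAll, TM2.stepAux, ih]
    simp

theorem step_fillWith (b : Option Bool) (s : Option Sym) (x : List Sym)
    (l : List (U.tm.Γ U.tm.k₀)) (w : List Bool) (a : List Sym) :
    TM2.stepAux (fillWith U V x) (fun i => (foldFam U V i).initialState, (b, s))
      (famStk (only U V false U.tm.k₀ l) (own w a)) =
    conf U V (.inl ⟨false, U.tm.main⟩) b none
      (only U V false U.tm.k₀ (x.map (fun s => U.inputAlphabet.symm (some s)) ++ l)) w a := by
  rw [fillWith, stepAux_pushAll]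
  simp only [TM2.stepAux, conf]
  rw [famStk_only, update_only]
  simp

variable [Inhabited Sym]

/-- The accumulator stores its string in reverse, so moving it symbol by symbol onto an input stack
restores the order, and draining an output stack reverses it again. In `fill` the popped value is
pushed before it is tested: the `none` of the empty accumulator becomes the separator in front of
the argument. An exhausted word selects the final code `d'` and, after the call, the decoding phase.
-/
def foldProg : FamΛ (foldFam U V) FoldLabel → FoldStmt U V
  | .inl ⟨false, l⟩ => famStmt (tm := foldFam U V) false .drain (U.tm.m l)
  | .inl ⟨true, l⟩ => famStmt (tm := foldFam U V) true .done (V.tm.m l)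
  | .inr .start => pushAll (accK U V) x₀ (.goto fun _ => .inr .loop)
  | .inr .loop => .pop (wordK U V) (fun v o => (v.1, (o, none))) (.goto fun _ => .inr .fill)
  | .inr .fill => .pop (accK U V) (fun v o => (v.1, (v.2.1, o)))
      (.push (uIn U V) (fun v => U.inputAlphabet.symm v.2.2)
        (.branch (fun v => v.2.2.isSome) (.goto fun _ => .inr .fill)
          (.branch (fun v => v.2.1.isNone) (fillWith U V d')
            (.branch (fun v => v.2.1 = some true) (fillWith U V (d true))
              (fillWith U V (d false))))))
  | .inr .drain => .pop (uOut U V) (fun v o => (v.1, (v.2.1, o.map U.outputAlphabet)))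
      (.branch (fun v => v.2.2.isSome)
        (.push (accK U V) (fun v => v.2.2.getD default) (.goto fun _ => .inr .drain))
        (.goto fun v => .inr (if v.2.1.isSome then .loop else .decode)))
  | .inr .decode => .pop (accK U V) (fun v o => (v.1, (v.2.1, o)))
      (.branch (fun v => v.2.2.isSome)
        (.push (vIn U V) (fun v => V.inputAlphabet.symm (v.2.2.getD default))
          (.goto fun _ => .inr .decode))
        (.goto fun _ => .inl ⟨true, V.tm.main⟩))
  | .inr .done => .halt

noncomputable def foldMachine [Fintype Sym] : FinTM2 where
  K := FamK (foldFam U V) Bool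
  kFin := by
    have : ∀ i, Fintype (foldFam U V i).K := fun i => (foldFam U V i).kFin
    infer_instance
  k₀ := wordK U V
  k₁ := vOut U V
  Γ := FamΓ (foldFam U V) (FoldΔ Sym)
  Λ := FamΛ (foldFam U V) FoldLabel
  main := .inr .start
  ΛFin := by
    have : ∀ i, Fintype (foldFam U V i).Λ := fun i => (foldFam U V i).ΛFin
    infer_instance
  σ := Famσ (foldFam U V) (Option Bool × Option Sym)
  initialState := (fun i => (foldFam U V i).initialState, (none, none))
  σFin := by
    have : ∀ i, Fintype (foldFam U V i).σ := fun i => (foldFam U V i).σFin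
    infer_instance
  Γk₀Fin := inferInstanceAs (Fintype Bool)
  m := foldProg U V d d' x₀

local notation "stp" => TM2.step (foldProg U V d d' x₀)

theorem step_start (w : List Bool) :
    stp (conf U V (.inr .start) none none (fun _ _ => []) w []) =
      some (conf U V (.inr .loop) none none (fun _ _ => []) w x₀.reverse) := by
  simp only [conf, TM2.step, foldProg, stepAux_pushAll, TM2.stepAux]
  rw [update_famStk_inr, update_own_true]
  simp [famStk, own]

theorem step_loop (b : Option Bool) (w : List Bool) (a : List Sym) :
    stp (conf U V (.inr .loop) b none (fun _ _ => []) w a) =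
      some (conf U V (.inr .fill) w.head? none (only U V false U.tm.k₀ []) w.tail a) := by
  simp only [conf, TM2.step, foldProg, TM2.stepAux]
  rw [update_famStk_inr, update_own_false, only_nil]
  rfl

/-- The code that belongs to a letter or to the end of the word. -/
def codeAt : Option Bool → List Sym
  | none => d'
  | some b => d b

/-- The list `l` is the part of the argument already moved; the induction needs it arbitrary. -/
theorem run_fill (b : Option Bool) (s : Option Sym) (w : List Bool) (a : List Sym)
    (l : List (Option Sym)) :
    ReachesIn stp (a.length + 1)
      (conf U V (.inr .fill) b s (only U V false U.tm.k₀ (l.map U.inputAlphabet.symm)) w a)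
      (conf U V (.inl ⟨false, U.tm.main⟩) b none
        (only U V false U.tm.k₀ (((codeAt d d' b).map some ++ none ::
          (a.reverse.map some ++ l)).map U.inputAlphabet.symm)) w []) := by
  induction a generalizing s l with
  | nil =>
    refine ReachesIn.head ?_ (ReachesIn.refl _)
    simp only [conf, TM2.step, foldProg, TM2.stepAux]
    rw [update_famStk_inr, update_own_true, famStk_only, update_only]
    rcases b with _ | _ | _ <;>
    simp [famStk, own, step_fillWith, codeAt, conf, Function.comp_def]
  | cons x a ih =>
    refine ReachesIn.head (b := conf U V (.inr .fill) b (some x)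
      (only U V false U.tm.k₀ ((some x :: l).map U.inputAlphabet.symm)) w a) ?_ ?_
    · simp only [conf, TM2.step, foldProg, TM2.stepAux]
      rw [update_famStk_inr, update_own_true, famStk_only, update_only]
      simp [famStk, own]
    · have := ih (some x) (some x :: l)
      simpa using this

theorem run_drain (b : Option Bool) (s : Option Sym) (w : List Bool) (y a : List Sym) :
    ReachesIn stp (y.length + 1)
      (conf U V (.inr .drain) b s (only U V false U.tm.k₁ (y.map U.outputAlphabet.symm)) w a)
      (conf U V (.inr (if b.isSome then .loop else .decode)) b none (fun _ _ => []) w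
        (y.reverse ++ a)) := by
  induction y generalizing s a with
  | nil =>
    refine ReachesIn.head ?_ (ReachesIn.refl _)
    simp only [conf, TM2.step, foldProg, TM2.stepAux]
    rw [famStk_only, update_only]
    simp [← only_nil U V false U.tm.k₁]
  | cons x y ih =>
    refine ReachesIn.head (b := conf U V (.inr .drain) b (some x)
      (only U V false U.tm.k₁ (y.map U.outputAlphabet.symm)) w (x :: a)) ?_ ?_
    · simp only [conf, TM2.step, foldProg, TM2.stepAux]
      rw [famStk_only, update_only, update_famStk_inr, update_own_true]
      simp [famStk, own]
    · have := ih (some x) (x :: a)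
      simpa using this

theorem run_decode (s : Option Sym) (w : List Bool) (a l : List Sym) :
    ReachesIn stp (a.length + 1)
      (conf U V (.inr .decode) none s (only U V true V.tm.k₀ (l.map V.inputAlphabet.symm)) w a)
      (conf U V (.inl ⟨true, V.tm.main⟩) none none
        (only U V true V.tm.k₀ ((a.reverse ++ l).map V.inputAlphabet.symm)) w []) := by
  induction a generalizing s l with
  | nil =>
    refine ReachesIn.head ?_ (ReachesIn.refl _)
    simp only [conf, TM2.step, foldProg, TM2.stepAux]
    rw [update_famStk_inr, update_own_true]
    simp [famStk, own]
  | cons x a ih =>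
    refine ReachesIn.head (b := conf U V (.inr .decode) none (some x)
      (only U V true V.tm.k₀ ((x :: l).map V.inputAlphabet.symm)) w a) ?_ ?_
    · simp only [conf, TM2.step, foldProg, TM2.stepAux]
      rw [update_famStk_inr, update_own_true, famStk_only, update_only]
      simp [famStk, own]
    · have := ih (some x) (x :: l)
      simpa using this

/-- One application of `U` to the accumulator. -/
theorem run_apply {t : ℕ} {x y : List Sym} (b : Option Bool) (w : List Bool)
    (h : ReachesIn U.tm.step t
      (initList U.tm (((codeAt d d' w.head?).map some ++ none :: x.map some).map
        U.inputAlphabet.symm))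
      (haltList U.tm (y.map U.outputAlphabet.symm))) :
    ReachesIn stp (x.length + t + y.length + 3)
      (conf U V (.inr .loop) b none (fun _ _ => []) w x.reverse)
      (conf U V (.inr (if w.head?.isSome then .loop else .decode)) w.head? none (fun _ _ => [])
        w.tail y.reverse) := by
  have h1 := run_fill U V d d' x₀ w.head? none w.tail x.reverse []
  have h2 := ReachesIn.call (m := foldProg U V d d' x₀) (tm := foldFam U V) false .drain
    (fun _ => rfl) h (w.head?, none) (fun _ _ => []) (own w.tail [])
  have h3 := run_drain U V d d' x₀ w.head? none w.tail y []
  have h4 := ReachesIn.head (step_loop U V d d' x₀ b w x.reverse)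
    ((h1.trans (by rw [List.reverse_reverse, List.append_nil]; exact h2)).trans h3)
  simp only [List.append_nil, List.length_reverse] at h4
  exact h4.mono (by omega)

theorem run_done {t : ℕ} {y : List Sym} {v : List Bool}
    (h : ReachesIn V.tm.step t (initList V.tm (y.map V.inputAlphabet.symm))
      (haltList V.tm (v.map V.outputAlphabet.symm))) :
    ReachesIn stp (y.length + t + 2)
      (conf U V (.inr .decode) none none (fun _ _ => []) [] y.reverse)
      ⟨none, (fun i => (foldFam U V i).initialState, (none, none)),
        famStk (only U V true V.tm.k₁ (v.map V.outputAlphabet.symm)) (own [] [])⟩ := by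
  have h1 := run_decode U V d d' x₀ none [] y.reverse []
  have h2 := ReachesIn.call (m := foldProg U V d d' x₀) (tm := foldFam U V) true .done
    (fun _ => rfl) h (none, none) (fun _ _ => []) (own [] [])
  have h3 : ReachesIn stp 1 ⟨some (.inr .done), (fun i => (foldFam U V i).initialState,
      (none, none)), famStk (only U V true V.tm.k₁ (v.map V.outputAlphabet.symm)) (own [] [])⟩
      ⟨none, (fun i => (foldFam U V i).initialState, (none, none)),
        famStk (only U V true V.tm.k₁ (v.map V.outputAlphabet.symm)) (own [] [])⟩ :=
    ReachesIn.head rfl (ReachesIn.refl _)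
  rw [List.reverse_reverse, List.append_nil, List.map_nil, only_nil, List.length_reverse] at h1
  exact ((h1.trans h2).trans h3).mono (by omega)

theorem eval_mono (p : Polynomial ℕ) {a b : ℕ} (h : a ≤ b) : p.eval a ≤ p.eval b := by
  induction p using Polynomial.induction_on' with
  | add p q hp hq => simpa using Nat.add_le_add hp hq
  | monomial n c => simpa using Nat.mul_le_mul_left c (Nat.pow_le_pow_left h n)

/-- Folding a word with one machine, in polynomially bounded time for each letter, and decoding the
result with a polynomial-time machine takes polynomial time. -/
theorem polyTime_of_fold [Finite Sym] {U : TM2ComputableAux (Option Sym) Sym}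
    {V : TM2ComputableAux Sym Bool} {d : Bool → List Sym} {d' : List Sym} {p q : Polynomial ℕ}
    {x y : List Bool → List Sym} {f : List Bool → List Bool}
    (hx : ∀ w b, ReachesIn U.tm.step (p.eval w.length)
      (initList U.tm (((d b).map some ++ none :: (x w).map some).map U.inputAlphabet.symm))
      (haltList U.tm ((x (w ++ [b])).map U.outputAlphabet.symm)))
    (hy : ∀ w, ReachesIn U.tm.step (p.eval w.length)
      (initList U.tm ((d'.map some ++ none :: (x w).map some).map U.inputAlphabet.symm))
      (haltList U.tm ((y w).map U.outputAlphabet.symm)))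
    (hf : ∀ w, ReachesIn V.tm.step (q.eval (y w).length)
      (initList V.tm ((y w).map V.inputAlphabet.symm))
      (haltList V.tm ((f w).map V.outputAlphabet.symm))) : PolyTime f := by
  have := Fintype.ofFinite Sym
  obtain ⟨B, hB⟩ := exists_output_length_le U.tm
  -- `D` covers any of the codes and the separator, so one call lengthens the accumulator by at most
  -- `D + B * p.eval n`. The factor `n + 1` in `G` counts the letters and the final call; `G` thus
  -- bounds every string that ever occurs.
  set D := (d true).length + (d false).length + d'.length + 1 with hD
  let G : Polynomial ℕ := .C (x []).length + (.X + 1) * (.C D + .C B * p)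
  have hG : ∀ n, G.eval n = (x []).length + (n + 1) * (D + B * p.eval n) := by
    intro n
    simp [G]
  have hxl : ∀ w, (x w).length ≤ (x []).length + w.length * (D + B * p.eval w.length) := by
    intro w
    induction w using List.reverseRecOn with
    | nil => simp
    | append_singleton w b ih =>
      have h1 := hB _ _ _ (hx w b)
      have h2 : (d b).length + 1 ≤ D := by cases b <;> omega
      have h3 : p.eval w.length ≤ p.eval (w.length + 1) := eval_mono p (Nat.le_succ _)
      simp only [List.length_map, List.length_append, List.length_cons, List.length_nil] at h1 ⊢
      have h4 : B * p.eval w.length ≤ B * p.eval (w.length + 1) := Nat.mul_le_mul_left B h3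
      have h5 : w.length * (D + B * p.eval w.length) ≤
          w.length * (D + B * p.eval (w.length + 1)) := Nat.mul_le_mul_left _ (by omega)
      simp only [Nat.zero_add, Nat.succ_mul]
      omega
  have hxG : ∀ w n, w.length ≤ n → (x w).length ≤ G.eval n := by
    intro w n h
    refine le_trans ?_ (eval_mono G h)
    rw [hG, Nat.succ_mul]
    have := hxl w
    omega
  have hyG : ∀ w, (y w).length ≤ G.eval w.length := by
    intro w
    have h1 := hB _ _ _ (hy w)
    have h2 := hxl w
    simp only [List.length_map, List.length_append, List.length_cons] at h1
    rw [hG, Nat.succ_mul]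
    omega
  -- Induction on the unread part `v`, with the processed prefix `u` arbitrary. All bounds are
  -- evaluated at the length of the whole word, so every letter has the same price.
  have run : ∀ v u b, ReachesIn (TM2.step (foldProg U V d d' (x [])))
      ((v.length + 1) * (2 * G.eval (u ++ v).length + p.eval (u ++ v).length + 3))
      (conf U V (.inr .loop) b none (fun _ _ => []) v (x u).reverse)
      (conf U V (.inr .decode) none none (fun _ _ => []) [] (y (u ++ v)).reverse) := by
    intro v
    induction v with
    | nil =>
      intro u b
      have h1 := run_apply U V d d' (x []) (x := x u) (y := y u) b [] (hy u)
      have := hxG u _ le_rfl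
      have := hyG u
      rw [List.append_nil, List.length_nil]
      exact h1.mono (by omega)
    | cons c v ih =>
      intro u b
      have h1 := run_apply U V d d' (x []) (x := x u) (y := x (u ++ [c])) b (c :: v) (hx u c)
      have h2 := ih (u ++ [c]) (some c)
      rw [List.append_assoc, List.singleton_append] at h2
      refine (h1.trans h2).mono ?_
      have h3 := hxG u (u ++ c :: v).length (by simp)
      have h4 := hxG (u ++ [c]) (u ++ c :: v).length (by simp)
      have h5 := eval_mono p (show u.length ≤ (u ++ c :: v).length by simp)
      rw [List.length_cons, Nat.succ_mul (v.length + 1)]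
      omega
  refine ⟨{
    tm := foldMachine U V d d' (x [])
    inputAlphabet := Equiv.refl Bool
    outputAlphabet := V.outputAlphabet
    time := (.X + 1) * (2 * G + p + 3) + G + q.comp G + 3
    outputsFun := fun w => Classical.choice ?_ }⟩
  have h1 := ((ReachesIn.head (step_start U V d d' (x []) w) (run w [] none)).trans
    (run_done U V d d' (x []) (hf w)))
  have h2 := eval_mono q (hyG w)
  have h3 := hyG w
  refine ReachesIn.evals ?_
  simp only [id_eq]
  rw [initList_eq, haltList_eq]
  have h4 : (foldMachine U V d d' (x [])).step =
    TM2.step (foldProg U V d d' (x [])) := rfl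
  rw [h4]
  have e1 : (⟨some (foldMachine U V d d' (x [])).main, (foldMachine U V d d' (x [])).initialState,
      Function.update (fun _ => []) (foldMachine U V d d' (x [])).k₀
        (w.map (Equiv.refl Bool).invFun)⟩ :
      FoldCfg U V) = conf U V (.inr .start) none none (fun _ _ => []) w [] := by
    refine congrArg (TM2.Cfg.mk _ _) (funext fun k => ?_)
    rcases k with k | _ | _ <;> simp [foldMachine, famStk, own]
  have e2 : (⟨none, (foldMachine U V d d' (x [])).initialState,
      Function.update (fun _ => []) (foldMachine U V d d' (x [])).k₁
        ((f w).map V.outputAlphabet.invFun)⟩ : FoldCfg U V) =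
      ⟨none, (fun i => (foldFam U V i).initialState, (none, none)),
        famStk (only U V true V.tm.k₁ ((f w).map V.outputAlphabet.symm)) (own [] [])⟩ := by
    refine congrArg (TM2.Cfg.mk _ _) ?_
    rw [← update_only U V true V.tm.k₁ []]
    refine congrArg (fun T => Function.update T (vOut U V) _) (funext fun k => ?_)
    rw [only_nil]
    rcases k with k | _ | _ <;> rfl
  have h5 := h1.mono (t := ((.X + 1) * (2 * G + p + 3) + G + q.comp G + 3 : Polynomial ℕ).eval
    w.length) ?_
  · rw [← e1, ← e2] at h5
    exact h5
  simp only [List.nil_append, Polynomial.eval_add, Polynomial.eval_mul, Polynomial.eval_comp,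
    Polynomial.eval_X, Polynomial.eval_one, Polynomial.eval_ofNat]
  omega

end Fold

end LAL

namespace LAL
namespace Tree

/-! ### Estimates for trees -/

theorem distN_mono {n a b : ℕ} {t u : Tree} (hab : a ≤ b) (h : leN n a t u) :
    distN n a t u ≤ distN n b t u := by
  obtain ⟨c, rfl⟩ := Nat.exists_eq_add_of_le hab
  exact (Nat.le_add_right _ _).trans ((distN_trans_compat n).1 a c t u u h (leN_refl _ _ _))

/-- Pass from `0` to `a` and then to `a + b`; by compatibility the second leg is at least the
distance from `0` to `b`. The level is fixed here, in contrast to the norm. -/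
theorem distN_zero_add (n : ℕ) (a b : Tree) :
    distN n 0 0 a + distN n 0 0 b ≤ distN n 0 0 (a + b) := by
  have h1 := (distN_trans_compat n).2 0 0 b a (zero_leN _ _ _)
  have h2 := (distN_trans_compat n).1 0 0 0 a (a + b) (zero_leN _ _ _) (by
    have := leN_add (leN_refl n 0 a) (zero_leN n 0 b)
    rwa [add_zero a] at this)
  rw [_root_.zero_add, add_comm b a] at h1
  simp only [Nat.add_zero] at h2
  omega

theorem distN_nsmul (n k : ℕ) (a : Tree) : k * distN n 0 0 a ≤ distN n 0 0 (k • a) := by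
  induction k with
  | zero => simp
  | succ k ih =>
    rw [succ_nsmul, Nat.succ_mul]
    exact (Nat.add_le_add_right ih _).trans (distN_zero_add n _ _)

/-- The norm uses the depth of `a` as its level, and higher levels only enlarge distances. -/
theorem norm_le_distN {n : ℕ} {a : Tree} (h : depth a ≤ n) : dist 0 a ≤ distN n 0 0 a :=
  (up (by simp) le_rfl h (zero_leN _ _ _)).2

theorem le_refl' (t : Tree) : le t t := ⟨le_rfl, leN_refl _ _ _⟩

@[simp] theorem root_sec (t : Tree) : root (sec t) = 0 := root_node _ _ _ _
@[simp] theorem sub_sec (t : Tree) : sub (sec t) = t := sub_node _ _ _ _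
@[simp] theorem kids_sec (t : Tree) : kids (sec t) = {0} := kids_node _ _ _ _
@[simp] theorem root_bang (t : Tree) : root (bang t) = 1 := root_node _ _ _ _
@[simp] theorem sub_bang (t : Tree) : sub (bang t) = 0 := sub_node _ _ _ _
@[simp] theorem kids_bang (t : Tree) : kids (bang t) = {t} := kids_node _ _ _ _

theorem depth_sec (t : Tree) : depth (sec t) = depth t + 1 := by
  rw [sec, depth_node, Finset.sup_singleton, depth_empty, Nat.max_zero, Nat.add_comm]

theorem depth_bang (t : Tree) : depth (bang t) = depth t + 1 := by
  rw [bang, depth_node, depth_empty, Finset.sup_singleton, Nat.zero_max, Nat.add_comm]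

/-- The neutral tree is read as having the child `0`, which a sum need not keep; nonzero depth
excludes this case. -/
theorem mem_kids_add_of_pos {t u z : Tree} (h : z ∈ kids t ∪ kids u) (ht : depth t ≠ 0)
    (hu : depth u ≠ 0) : z ∈ kids (t + u) := by
  rcases cases t with rfl | ⟨n, t, T, hT, rfl⟩
  · exact absurd depth_zero ht
  rcases cases u with rfl | ⟨m, u, U, hU, rfl⟩
  · exact absurd depth_zero hu
  change z ∈ kids (add _ _)
  simpa [node_add_node] using h

/-- Both roots are `0`, so no child is drawn and the comparison one level up is that of the
subtrees. -/
theorem sec_le_sec {t u : Tree} (h : le t u) :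
    le (sec t) (sec u) ∧ dist t u ≤ dist (sec t) (sec u) := by
  have h1 : leN (depth u + 1) 0 (sec t) (sec u) := by
    rw [leN_succ]
    exact ⟨0, by simp, ⟨Fin.elim0, fun i => i.elim0, by simpa using h.2⟩, by
      simpa using leN_refl _ _ _⟩
  refine ⟨⟨by simpa only [depth_sec] using Nat.succ_le_succ h.1, by rwa [depth_sec]⟩, ?_⟩
  rw [dist, dist, depth_sec]
  simpa using (distN_succ (k := 0) (by simp) h1).2 Fin.elim0 (fun i => i.elim0)
    (by simpa using h.2)

theorem sec_add (t u : Tree) : sec (t + u) = sec t + sec u := by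
  change _ = add (sec t) (sec u)
  rw [sec, sec, sec, node_add_node]
  congr 1

/-- The root number `1` of `bang t` pays for drawing one child, which is `t` itself. -/
theorem sec_le_bang (t : Tree) : le (sec t) (bang t) := by
  refine ⟨by rw [depth_sec, depth_bang], ?_⟩
  rw [depth_bang, leN_succ]
  exact ⟨1, by simp, ⟨fun _ => t, by simp, by simpa using leN_refl _ _ _⟩, by
    simpa using zero_leN _ _ _⟩

theorem bang_le_bang {t u : Tree} (h : le t u) : le (bang t) (bang u) := by
  refine ⟨by simpa only [depth_bang] using Nat.succ_le_succ h.1, ?_⟩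
  rw [depth_bang, leN_succ]
  exact ⟨0, by simp, ⟨Fin.elim0, fun i => i.elim0, by simpa using leN_refl _ _ _⟩, by
    simpa using h.2⟩

/-- A tree is finite, so an error that exceeds all its data absorbs it. It matters that the error
works at every level `n`. -/
theorem exists_leN_zero (t : Tree) : ∃ d, ∀ n, leN n d t 0 := by
  induction t using induction with
  | h0 => exact ⟨0, fun n => zero_leN _ _ _⟩
  | h1 m t T hT iht ihT =>
    obtain ⟨d, hd⟩ := iht
    choose! g hg using ihT
    set e := d + T.sup g
    refine ⟨m + e, fun n => ?_⟩
    rcases n with _ | n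
    · trivial
    rw [leN_succ]
    refine ⟨e, by simp, ⟨fun _ => 0, by simp, ?_⟩, fun s hs => ⟨0, by simp, ?_⟩⟩
    · simpa using leN_mono (show d ≤ e ^ 2 by
        have : e ≤ e ^ 2 := Nat.le_self_pow (by norm_num) e
        omega) (hd n)
    · rw [kids_node] at hs
      have := Finset.le_sup (f := g) hs
      exact leN_mono (by omega) (hg s hs n)

/-- The promotion of a sum with a fixed summand. -/
theorem exists_bang_add_le (s : Tree) : ∃ s', ∀ t, le (bang (t + s)) (s' + bang t) := by
  obtain ⟨d, hd⟩ := exists_leN_zero s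
  -- The root number `d` provides the error within which the child `t + s` is below the child `t`.
  -- The child `s` only serves to reach the depth of `t + s`.
  refine ⟨node d 0 {s} (Finset.singleton_nonempty _), fun t => ?_⟩
  have h1 : depth (node d 0 {s} (Finset.singleton_nonempty _) + bang t) =
      max (depth s) (depth t) + 1 := by
    rw [depth_add, depth_bang, depth_node, Finset.sup_singleton, depth_zero]
    omega
  refine ⟨by rw [h1, depth_bang, depth_add, max_comm], ?_⟩
  rw [h1, leN_succ]
  refine ⟨d, by simp [root_add, Nat.add_comm], ⟨fun _ => t, fun _ => ?_, by
    simpa using zero_leN _ _ _⟩, fun z hz => ⟨t, ?_, ?_⟩⟩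
  · exact mem_kids_add_of_pos (by simp) (by rw [depth_node]; omega) (by rw [depth_bang]; omega)
  · exact mem_kids_add_of_pos (by simp) (by rw [depth_node]; omega) (by rw [depth_bang]; omega)
  · obtain rfl : z = t + s := by simpa using hz
    simpa using leN_add (leN_refl _ 0 t) (hd _)

/-! ### Majorizers for contraction and for words -/

/-- A leaf with a given number. -/
def leaf (n : ℕ) (t : Tree) : Tree := node n t {0} (Finset.singleton_nonempty _)

@[simp] theorem root_leaf (n : ℕ) (t : Tree) : root (leaf n t) = n := root_node _ _ _ _
@[simp] theorem sub_leaf (n : ℕ) (t : Tree) : sub (leaf n t) = t := sub_node _ _ _ _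
@[simp] theorem kids_leaf (n : ℕ) (t : Tree) : kids (leaf n t) = {0} := kids_node _ _ _ _

theorem depth_leaf (n : ℕ) (t : Tree) : depth (leaf n t) = depth t + 1 := by
  rw [leaf, depth_node, Finset.sup_singleton, depth_zero, Nat.max_zero, Nat.add_comm]

/-- A lower bound for distances: a list of children of the larger tree may be chosen. -/
theorem le_and_dist_of_list {t u : Tree} {n k : ℕ} (ht : depth t ≤ n + 1) (hu : depth u = n + 1)
    (hk : root t + k = root u) (hkids : ∀ s ∈ kids t, ∃ z ∈ kids u, leN n k s z) (x y : Tree)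
    (l : List Tree) (hl : ∀ z ∈ l, z ∈ kids u) (hlk : l.length = k) (hx : sub t = x)
    (hxy : sub u + l.sum = x + y) : le t u ∧ k + distN n 0 0 y ≤ dist t u := by
  subst hlk
  have hs : ∑ i : Fin l.length, l.get i = l.sum := by
    rw [← List.sum_ofFn, List.ofFn_get]
  have h0 : leN n 0 (sub t) (sub u + ∑ i, l.get i) := by
    rw [hs, hxy, hx]
    simpa using leN_add (leN_refl n 0 x) (zero_leN n 0 y)
  have h1 : leN (n + 1) 0 t u := by
    rw [leN_succ]
    exact ⟨_, by omega, ⟨l.get, fun i => hl _ (List.get_mem _ _), leN_mono (Nat.zero_le _) h0⟩,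
      hkids⟩
  refine ⟨⟨by omega, by rwa [hu]⟩, ?_⟩
  have h2 := (distN_succ (k := l.length) (by omega) h1).2 l.get
    (fun i => hl _ (List.get_mem _ _)) (leN_mono (Nat.zero_le _) h0)
  rw [dist, hu]
  -- Lowering the error to `0` can only lower the distance. What remains is the distance from `x` to
  -- `x + y`, which is at least that from `0` to `y`.
  refine le_trans (Nat.add_le_add_left (le_trans ?_ (distN_mono (Nat.zero_le _) h0)) _) h2
  rw [hs, hxy, hx]
  have := (distN_trans_compat n).2 0 0 y x (zero_leN _ _ _)
  rwa [_root_.zero_add, add_comm y x] at this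

/-- Contraction, with time for the duplication. -/
theorem exists_contr (c : ℕ) : ∃ s, ∀ t, le (bang t + bang t) (s + bang t) ∧
    c * (dist 0 t + 1) ≤ dist (bang t + bang t) (s + bang t) := by
  -- The roots are `2` on the left and `c + 2` on the right, so `c` children can be drawn; `c`
  -- copies of `t` contribute `c` times its norm, and the number `c` itself gives the summand `1`.
  refine ⟨leaf (c + 1) 0, fun t => ?_⟩
  have h1 : depth (leaf (c + 1) 0 + bang t) = depth t + 1 := by
    rw [depth_add, depth_leaf, depth_bang, depth_zero]
    omega
  have h2 : t ∈ kids (leaf (c + 1) 0 + bang t) :=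
    mem_kids_add_of_pos (by simp) (by rw [depth_leaf]; omega) (by rw [depth_bang]; omega)
  have h3 := le_and_dist_of_list (t := bang t + bang t) (k := c)
    (by rw [depth_add, depth_bang, max_self]) h1
    (by simp only [root_add, root_bang, root_leaf]; omega)
    (fun s hs => ⟨t, h2, by
      obtain rfl : s = t := by simpa using kids_add_subset _ _ hs
      exact leN_refl _ _ _⟩) 0 (c • t) (.replicate c t)
    (fun z hz => by rwa [List.eq_of_mem_replicate hz]) (by simp) (by simp [sub_add])
    (by simp [sub_add])
  refine ⟨h3.1, le_trans ?_ h3.2⟩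
  have h4 := distN_nsmul (depth t) c t
  have h5 := Nat.mul_le_mul_left c (norm_le_distN (le_refl (depth t)))
  rw [Nat.mul_succ]
  omega

/-- A majorizer for words of length `n`. -/
def wordTree (r : Tree) (c n : ℕ) : Tree := leaf (n + 2 * (c * (n + 1))) ((n + 1) • r)

/-- With `p = c * (n + 1)` the root on the right is `n + 2 * p + 2` and the one on the left is `0`.
Of the children that may be drawn, `n` are spent on the letters of `w`, so that the subtree on the
right contains that on the left. The others are `p + 1` copies of each of the two trees, and they
make up the distance. -/
theorem word_le (r : Tree) (c : ℕ) (t : Bool → Tree) (w : List Bool) :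
    le (sec ((w.length + 1) • r + (w.map t).sum))
        (wordTree r c w.length + bang (t false) + bang (t true)) ∧
      c * (w.length + 1) * (dist 0 (t false) + dist 0 (t true) + 1) ≤
        dist (sec ((w.length + 1) • r + (w.map t).sum))
          (wordTree r c w.length + bang (t false) + bang (t true)) := by
  set n := w.length with hn
  set x := (n + 1) • r + (w.map t).sum with hx
  have hw : depth (w.map t).sum ≤ max (depth (t false)) (depth (t true)) := by
    clear hx x hn n
    induction w with
    | nil => simp
    | cons b w ih =>
      rw [List.map_cons, List.sum_cons, depth_add]
      cases b <;> omega
  have hd0 : depth (wordTree r c n + bang (t false)) ≠ 0 := by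
    rw [depth_add, depth_bang]
    omega
  have hd : depth (wordTree r c n + bang (t false) + bang (t true)) =
      max (max (depth ((n + 1) • r)) (depth (t false))) (depth (t true)) + 1 := by
    rw [depth_add, depth_add, depth_bang, depth_bang, wordTree, depth_leaf]
    omega
  have hkt : ∀ b, t b ∈ kids (wordTree r c n + bang (t false) + bang (t true)) := by
    intro b
    refine mem_kids_add_of_pos ?_ hd0 (by rw [depth_bang]; omega)
    cases b
    · exact Finset.mem_union_left _ (mem_kids_add_of_pos (by simp)
        (by rw [wordTree, depth_leaf]; omega) (by rw [depth_bang]; omega))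
    · simp
  set p := c * (n + 1) with hp
  have h3 := le_and_dist_of_list (t := sec x) (k := n + 2 * p + 2)
    (by
      rw [depth_sec, hx, depth_add]
      have := hw
      omega) hd
    (by simp only [root_add, root_bang, root_sec, wordTree, root_leaf, ← hp]; omega)
    (fun s hs => ⟨t false, hkt false, by
      obtain rfl : s = 0 := by simpa using hs
      exact zero_leN _ _ _⟩) x ((p + 1) • t false + (p + 1) • t true)
    (w.map t ++ (.replicate (p + 1) (t false) ++ .replicate (p + 1) (t true)))
    (fun z hz => by
      rw [List.mem_append, List.mem_append] at hz
      rcases hz with hz | hz | hz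
      · obtain ⟨b, -, rfl⟩ := List.mem_map.1 hz
        exact hkt b
      · rw [List.eq_of_mem_replicate hz]
        exact hkt false
      · rw [List.eq_of_mem_replicate hz]
        exact hkt true)
    (by
      simp only [List.length_append, List.length_map, List.length_replicate, ← hn]
      omega) (by simp)
    (by simp [sub_add, wordTree, hx, add_assoc])
  refine ⟨h3.1, le_trans ?_ h3.2⟩
  set N := max (max (depth ((n + 1) • r)) (depth (t false))) (depth (t true))
  have h4 := distN_zero_add N ((p + 1) • t false) ((p + 1) • t true)
  have h5 := distN_nsmul N (p + 1) (t false)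
  have h6 := distN_nsmul N (p + 1) (t true)
  have h7 := Nat.mul_le_mul (Nat.le_succ p) (norm_le_distN (show depth (t false) ≤ N by omega))
  have h8 := Nat.mul_le_mul (Nat.le_succ p) (norm_le_distN (show depth (t true) ≤ N by omega))
  rw [Nat.mul_add, Nat.mul_add, Nat.mul_one]
  simp only [Nat.succ_eq_add_one] at h7 h8
  omega

/-! ### Polynomial bounds for the norm -/

/-- All numbers in the first `n` levels of a tree are at most `N`. -/
def Bounded : ℕ → ℕ → Tree → Prop
  | 0, _, _ => True
  | n + 1, N, t => root t ≤ N ∧ Bounded n N (sub t) ∧ ∀ s ∈ kids t, Bounded n N s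

theorem Bounded.mono {n N N' : ℕ} {t : Tree} (h : Bounded n N t) (hN : N ≤ N') :
    Bounded n N' t := by
  induction n generalizing t with
  | zero => trivial
  | succ n ih => exact ⟨h.1.trans hN, ih h.2.1, fun s hs => ih (h.2.2 s hs)⟩

theorem bounded_zero (n N : ℕ) : Bounded n N 0 := by
  induction n with
  | zero => trivial
  | succ n ih => exact ⟨by simp, by simpa using ih, by simpa using ih⟩

theorem Bounded.add {n N N' : ℕ} {t u : Tree} (h : Bounded n N t) (h' : Bounded n N' u) :
    Bounded n (N + N') (t + u) := by
  induction n generalizing t u with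
  | zero => trivial
  | succ n ih =>
    refine ⟨by rw [root_add]; exact Nat.add_le_add h.1 h'.1, by rw [sub_add]; exact ih h.2.1 h'.2.1,
      fun s hs => ?_⟩
    rcases Finset.mem_union.1 (kids_add_subset _ _ hs) with hs | hs
    · exact (h.2.2 s hs).mono (Nat.le_add_right _ _)
    · exact (h'.2.2 s hs).mono (Nat.le_add_left _ _)

theorem Bounded.sum {n N k : ℕ} {f : Fin k → Tree} (h : ∀ i, Bounded n N (f i)) :
    Bounded n (k * N) (∑ i, f i) := by
  induction k with
  | zero => exact (bounded_zero n _)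
  | succ k ih =>
    rw [Fin.sum_univ_succ, show (k + 1) * N = N + k * N by ring]
    exact (h 0).add (ih fun i => h i.succ)

theorem exists_bounded (t : Tree) : ∃ N, ∀ n, Bounded n N t := by
  induction t using induction with
  | h0 => exact ⟨0, fun n => bounded_zero _ _⟩
  | h1 m t T hT iht ihT =>
    obtain ⟨N, hN⟩ := iht
    choose! g hg using ihT
    refine ⟨m + N + T.sup g, fun n => ?_⟩
    rcases n with _ | n
    · trivial
    refine ⟨by rw [root_node]; omega, by rw [sub_node]; exact (hN n).mono (by omega),
      fun s hs => ?_⟩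
    rw [kids_node] at hs
    have := Finset.le_sup (f := g) hs
    exact (hg s hs n).mono (by omega)

/-- A polynomial that bounds the norm of trees with `n` levels. -/
noncomputable def normPoly : ℕ → Polynomial ℕ → Polynomial ℕ → Polynomial ℕ
  | 0, _, _ => 0
  | n + 1, e, N => (N + e) + normPoly n ((N + e) ^ 2) ((N + e + 1) * N)

/-- One level adds the number `k` of drawn children to the distance, and `k` is at most the root
bound `N` plus the error `e`. It leaves the error `k ^ 2` and a subtree to which `k` children have
been added, hence with numbers at most `(k + 1) * N`. -/
theorem distN_le_normPoly {n : ℕ} {e N : Polynomial ℕ} {e' x : ℕ} {t : Tree}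
    (he : e' ≤ e.eval x) (h : Bounded n (N.eval x) t) :
    distN n e' 0 t ≤ (normPoly n e N).eval x := by
  induction n generalizing e N e' t with
  | zero => simp [distN]
  | succ n ih =>
    obtain ⟨⟨f, hf, hfl, hfe⟩, -⟩ := distN_succ (k := root t + e') (by simp)
      (zero_leN (n + 1) e' t)
    have hk : root t + e' ≤ (N + e).eval x := by
      rw [Polynomial.eval_add]
      exact Nat.add_le_add h.1 he
    rw [hfe, normPoly, Polynomial.eval_add, sub_zero]
    refine Nat.add_le_add hk (ih ?_ ?_)
    · rw [Polynomial.eval_pow]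
      exact Nat.pow_le_pow_left hk 2
    · refine (h.2.1.add (Bounded.sum fun i => h.2.2 _ (hf i))).mono ?_
      rw [Polynomial.eval_mul, Polynomial.eval_add (q := 1), Polynomial.eval_one, Nat.add_mul _ 1,
        Nat.one_mul, Nat.add_comm (N.eval x)]
      exact Nat.add_le_add_right (Nat.mul_le_mul_right _ hk) _

/-- A family of trees of bounded depth in which all numbers are polynomially bounded. -/
def PolyFamily (T : ℕ → Tree) : Prop :=
  (∃ d, ∀ x, depth (T x) ≤ d) ∧ ∃ N : Polynomial ℕ, ∀ x n, Bounded n (N.eval x) (T x)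

/-- Bounded depth means that the recursion of `normPoly` has a fixed length, so one polynomial
serves the whole family. -/
theorem PolyFamily.norm_le {T : ℕ → Tree} (h : PolyFamily T) :
    ∃ P : Polynomial ℕ, ∀ x, dist 0 (T x) ≤ P.eval x := by
  obtain ⟨⟨d, hd⟩, N, hN⟩ := h
  exact ⟨normPoly d 0 N, fun x => (norm_le_distN (hd x)).trans
    (distN_le_normPoly (by simp) (hN x d))⟩

theorem polyFamily_const (t : Tree) : PolyFamily fun _ => t := by
  obtain ⟨N, hN⟩ := exists_bounded t
  exact ⟨⟨_, fun _ => le_rfl⟩, .C N, fun x n => by simpa using hN n⟩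

theorem PolyFamily.add {T U : ℕ → Tree} (hT : PolyFamily T) (hU : PolyFamily U) :
    PolyFamily fun x => T x + U x := by
  obtain ⟨⟨d, hd⟩, N, hN⟩ := hT
  obtain ⟨⟨d', hd'⟩, N', hN'⟩ := hU
  refine ⟨⟨max d d', fun x => ?_⟩, N + N', fun x n => ?_⟩
  · rw [depth_add]
    exact max_le_max (hd x) (hd' x)
  · rw [Polynomial.eval_add]
    exact (hN x n).add (hN' x n)

theorem PolyFamily.sec {T : ℕ → Tree} (hT : PolyFamily T) : PolyFamily fun x => sec (T x) := by
  obtain ⟨⟨d, hd⟩, N, hN⟩ := hT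
  refine ⟨⟨d + 1, fun x => ?_⟩, N, fun x n => ?_⟩
  · rw [depth_sec]
    exact Nat.succ_le_succ (hd x)
  · rcases n with _ | n
    · trivial
    · exact ⟨by simp, by simpa using hN x n, by simpa using bounded_zero _ _⟩

theorem PolyFamily.bang {T : ℕ → Tree} (hT : PolyFamily T) : PolyFamily fun x => bang (T x) := by
  obtain ⟨⟨d, hd⟩, N, hN⟩ := hT
  refine ⟨⟨d + 1, fun x => ?_⟩, N + 1, fun x n => ?_⟩
  · rw [depth_bang]
    exact Nat.succ_le_succ (hd x)
  · have : (N + 1).eval x = N.eval x + 1 := by simp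
    rw [this]
    rcases n with _ | n
    · trivial
    · exact ⟨by simp, by simpa using bounded_zero _ _, by simpa using (hN x n).mono (Nat.le_succ _)⟩

/-- Adding copies of `r` does not increase the depth; it multiplies the bound on the numbers. -/
theorem polyFamily_wordTree (r : Tree) (c : ℕ) : PolyFamily (wordTree r c) := by
  obtain ⟨K, hK⟩ := exists_bounded r
  have hd : ∀ k : ℕ, depth (k • r) ≤ depth r := by
    intro k
    induction k with
    | zero => simp
    | succ k ih =>
      rw [succ_nsmul, depth_add]
      exact max_le ih le_rfl
  have hb : ∀ k n : ℕ, Bounded n (k * K) (k • r) := by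
    intro k n
    induction k with
    | zero => simpa using bounded_zero _ _
    | succ k ih =>
      rw [succ_nsmul, Nat.succ_mul]
      exact ih.add (hK n)
  refine ⟨⟨depth r + 1, fun x => ?_⟩,
    .X + 2 * (.C c * (.X + 1)) + (.X + 1) * .C K, fun x n => ?_⟩
  · rw [wordTree, depth_leaf]
    exact Nat.succ_le_succ (hd _)
  · rcases n with _ | n
    · trivial
    have h : (.X + 2 * (.C c * (.X + 1)) + (.X + 1) * .C K : Polynomial ℕ).eval x =
        x + 2 * (c * (x + 1)) + (x + 1) * K := by simp
    rw [h]
    refine ⟨by simp [wordTree], ?_, by simpa [wordTree] using bounded_zero _ _⟩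
    rw [wordTree, sub_leaf]
    exact (hb _ n).mono (Nat.le_add_left _ _)

theorem le_norm_wordTree (r : Tree) (c n : ℕ) : c * (n + 1) ≤ dist 0 (wordTree r c n) := by
  have hd : depth (wordTree r c n) = depth ((n + 1) • r) + 1 := depth_leaf _ _
  rw [dist, hd]
  have := (distN_succ (k := n + 2 * (c * (n + 1))) (by simp [wordTree])
    (zero_leN (depth ((n + 1) • r) + 1) 0 (wordTree r c n))).2 (fun _ => 0)
    (by simp [wordTree]) (by simpa using zero_leN _ _ _)
  omega

end Tree
end LAL

namespace LAL

/-! ### The properties of the two resource monoids that are used -/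

/-- A resource monoid over the trees in which the modalities have the properties needed for the
rules that do not introduce `!` under hypotheses or quantifiers. -/
structure Grounded (M : LightMonoid) where
  maj : M.Carrier → Tree
  maj_add : ∀ a b, maj (a + b) = maj a + maj b
  maj_le : ∀ {a b}, M.le a b → Tree.le (maj a) (maj b)
  maj_bang : ∀ a, maj (M.bang a) = Tree.bang (maj a)
  maj_sec : ∀ a, maj (M.sec a) = Tree.sec (maj a)
  norm_le : ∀ a, M.norm a ≤ Tree.dist 0 (maj a)
  sec_le_sec : ∀ {a b}, M.le a b → M.le (M.sec a) (M.sec b) ∧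
    M.dist a b ≤ M.dist (M.sec a) (M.sec b)
  sec_add : ∀ a b, M.sec (a + b) = M.sec a + M.sec b
  sec_le_bang : ∀ a, M.le (M.sec a) (M.bang a)
  contr : ∀ c : ℕ, ∃ φ, ∀ a, M.le (M.bang a + M.bang a) (φ + M.bang a) ∧
    c * (M.norm a + 1) ≤ M.dist (M.bang a + M.bang a) (φ + M.bang a)
  word : ∀ (κ : M.Carrier) (c : ℕ), ∃ α : ℕ → M.Carrier,
    Tree.PolyFamily (fun n => maj (α n)) ∧ (∀ n, c * (n + 1) ≤ M.norm (α n)) ∧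
    ∀ (a : Bool → M.Carrier) (w : List Bool),
      M.le (M.sec ((w.length + 1) • κ + (w.map a).sum))
        (α w.length + M.bang (a false) + M.bang (a true)) ∧
      c * (w.length + 1) * (M.norm (a false) + M.norm (a true) + 1) ≤
        M.dist (M.sec ((w.length + 1) • κ + (w.map a).sum))
          (α w.length + M.bang (a false) + M.bang (a true))

/-- Time can be paid in a way that depends only on the bound and the time. -/
structure Paying (M : LightMonoid) : Prop where
  pay : ∀ γ T, ∃ γ', ∀ β, M.le β γ → T ≤ M.dist β γ →
    M.le β γ' ∧ M.le γ' γ ∧ T ≤ M.dist γ' γ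
  payBang : ∀ φ, ∃ φ', ∀ β δ T, M.le δ (φ + β) → T ≤ M.dist δ (φ + β) →
    ∃ δ', M.le δ δ' ∧ M.le (M.bang δ') (φ' + M.bang β) ∧
      T ≤ M.dist (M.bang δ') (φ' + M.bang β)

noncomputable def groundedTree : Grounded treeMonoid where
  maj := fun t => t
  maj_add _ _ := rfl
  maj_le h := h
  maj_bang _ := rfl
  maj_sec _ := rfl
  norm_le _ := le_rfl
  sec_le_sec := Tree.sec_le_sec
  sec_add := Tree.sec_add
  sec_le_bang := Tree.sec_le_bang
  contr := Tree.exists_contr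
  word r c := ⟨Tree.wordTree r c, Tree.polyFamily_wordTree r c, Tree.le_norm_wordTree r c,
    Tree.word_le r c⟩

/-! ### Properties of the trees with a time debt -/

section Debt

/-- The tree of a tree with debt. -/
def debtFst (p : (withDebt treeMonoid).Carrier) : Tree := p.1.1

/-- The debt of a tree with debt. -/
def debtSnd (p : (withDebt treeMonoid).Carrier) : ℕ := p.1.2

def mkDebt (t : Tree) (k : ℕ) (h : k ≤ Tree.dist 0 t) : (withDebt treeMonoid).Carrier :=
  ⟨(t, k), h⟩

theorem debt_le {p q : (withDebt treeMonoid).Carrier} : (withDebt treeMonoid).le p q ↔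
    Tree.le (debtFst p) (debtFst q) ∧
      debtSnd q ≤ debtSnd p + Tree.dist (debtFst p) (debtFst q) := Iff.rfl

theorem debt_dist (p q : (withDebt treeMonoid).Carrier) : (withDebt treeMonoid).dist p q =
    Tree.dist (debtFst p) (debtFst q) + debtSnd p - debtSnd q := rfl

theorem debtSnd_le (p : (withDebt treeMonoid).Carrier) : debtSnd p ≤ Tree.dist 0 (debtFst p) := p.2

theorem debtFst_add (p q : (withDebt treeMonoid).Carrier) :
    debtFst (p + q) = debtFst p + debtFst q := rfl

theorem debtSnd_add (p q : (withDebt treeMonoid).Carrier) :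
    debtSnd (p + q) = debtSnd p + debtSnd q := rfl

theorem debt_norm_le (p : (withDebt treeMonoid).Carrier) :
    (withDebt treeMonoid).norm p ≤ Tree.dist 0 (debtFst p) := by
  rw [ResourceMonoid.norm, debt_dist]
  change Tree.dist 0 _ + 0 - _ ≤ _
  omega

theorem debtFst_mk (t : Tree) (k : ℕ) (h : k ≤ Tree.dist 0 t) : debtFst (mkDebt t k h) = t := rfl
theorem debtSnd_mk (t : Tree) (k : ℕ) (h : k ≤ Tree.dist 0 t) : debtSnd (mkDebt t k h) = k := rfl

theorem debtFst_bang (p : (withDebt treeMonoid).Carrier) :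
    debtFst ((withDebt treeMonoid).bang p) = Tree.bang (debtFst p) := rfl
theorem debtSnd_bang (p : (withDebt treeMonoid).Carrier) :
    debtSnd ((withDebt treeMonoid).bang p) = debtSnd p := rfl

theorem debtFst_sec (p : (withDebt treeMonoid).Carrier) :
    debtFst ((withDebt treeMonoid).sec p) = Tree.sec (debtFst p) := rfl
theorem debtSnd_sec (p : (withDebt treeMonoid).Carrier) :
    debtSnd ((withDebt treeMonoid).sec p) = debtSnd p := rfl

theorem debtFst_nsmul (k : ℕ) (p : (withDebt treeMonoid).Carrier) :
    debtFst (k • p) = k • debtFst p := by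
  induction k with
  | zero => rw [zero_nsmul, zero_nsmul]; rfl
  | succ k ih => rw [succ_nsmul, succ_nsmul, debtFst_add, ih]

theorem debtFst_sum (l : List (withDebt treeMonoid).Carrier) :
    debtFst l.sum = (l.map debtFst).sum := by
  induction l with
  | nil => rfl
  | cons p l ih => rw [List.sum_cons, debtFst_add, ih, List.map_cons, List.sum_cons]

noncomputable def groundedDebt : Grounded (withDebt treeMonoid) where
  maj := debtFst
  maj_add _ _ := rfl
  maj_le h := h.1
  maj_bang _ := rfl
  maj_sec _ := rfl
  norm_le := debt_norm_le
  sec_le_sec {p q} h := by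
    have h1 := Tree.sec_le_sec (debt_le.1 h).1
    have h2 := (debt_le.1 h).2
    rw [debt_le, debt_dist, debt_dist, debtFst_sec, debtFst_sec, debtSnd_sec, debtSnd_sec]
    exact ⟨⟨h1.1, by omega⟩, by omega⟩
  sec_add p q := Subtype.ext (Prod.ext (Tree.sec_add _ _) rfl)
  sec_le_bang p := debt_le.2 ⟨Tree.sec_le_bang _, Nat.le_add_right _ _⟩
  contr c := by
    obtain ⟨s, hs⟩ := Tree.exists_contr c
    refine ⟨mkDebt s 0 (Nat.zero_le _), fun p => ?_⟩
    have h1 := hs (debtFst p)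
    have h2 := debt_norm_le p
    have h3 : c * ((withDebt treeMonoid).norm p + 1) ≤ c * (Tree.dist 0 (debtFst p) + 1) :=
      Nat.mul_le_mul_left c (by omega)
    rw [debt_le, debt_dist]
    simp only [debtFst_add, debtSnd_add, debtFst_bang, debtSnd_bang, debtFst_mk, debtSnd_mk]
    exact ⟨⟨h1.1, by omega⟩, by omega⟩
  word κ c := by
    -- The debts of `a false` and `a true` occur on the larger side even if the word lacks these
    -- letters. They are at most the norms of the trees, and the surplus of `c + 1` over `c` pays
    -- for them.
    refine ⟨fun n => mkDebt (Tree.wordTree (debtFst κ) (c + 1) n) 0 (Nat.zero_le _),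
      Tree.polyFamily_wordTree _ _, fun n => ?_, fun a w => ?_⟩
    · have h1 := Tree.le_norm_wordTree (debtFst κ) (c + 1) n
      have h2 : c * (n + 1) ≤ (c + 1) * (n + 1) := Nat.mul_le_mul_right _ (Nat.le_succ c)
      rw [ResourceMonoid.norm, debt_dist, debtFst_mk, debtSnd_mk]
      change _ ≤ Tree.dist 0 _ + 0 - 0
      omega
    · have h1 := Tree.word_le (debtFst κ) (c + 1) (fun b => debtFst (a b)) w
      have h2 := debtSnd_le (a false)
      have h3 := debtSnd_le (a true)
      have h4 := debt_norm_le (a false)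
      have h5 := debt_norm_le (a true)
      have h6 : debtFst (((w.length + 1) • κ + (w.map a).sum)) =
          (w.length + 1) • debtFst κ + (w.map fun b => debtFst (a b)).sum := by
        rw [debtFst_add, debtFst_nsmul, debtFst_sum, List.map_map]
        rfl
      rw [debt_le, debt_dist]
      simp only [debtFst_add ((_ : (withDebt treeMonoid).Carrier) + _), debtFst_add (mkDebt _ _ _),
        debtSnd_add ((_ : (withDebt treeMonoid).Carrier) + _), debtSnd_add (mkDebt _ _ _),
        debtFst_bang, debtSnd_bang, debtFst_sec, debtSnd_sec, debtFst_mk, debtSnd_mk, h6]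
      set X := Tree.dist 0 (debtFst (a false)) + Tree.dist 0 (debtFst (a true)) + 1 with hX
      have h7 : (c + 1) * (w.length + 1) * X = c * (w.length + 1) * X + (w.length + 1) * X := by
        ring
      have h8 : X ≤ (w.length + 1) * X := Nat.le_mul_of_pos_left _ (Nat.succ_pos _)
      have h9 : c * (w.length + 1) * ((withDebt treeMonoid).norm (a false) +
          (withDebt treeMonoid).norm (a true) + 1) ≤ c * (w.length + 1) * X :=
        Nat.mul_le_mul_left _ (by omega)
      exact ⟨⟨h1.1, by omega⟩, by omega⟩

/-- Keep the tree of the upper bound and add the time `T` to its debt: the result lies between every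
admissible element and the bound. Under `!` the debt is unchanged, so only the trees need an extra
summand, given by `Tree.exists_bang_add_le`. -/
theorem payingDebt : Paying (withDebt treeMonoid) where
  pay γ T := by
    by_cases h : ∃ β, (withDebt treeMonoid).le β γ ∧ T ≤ (withDebt treeMonoid).dist β γ
    · have key : ∀ β, (withDebt treeMonoid).le β γ → T ≤ (withDebt treeMonoid).dist β γ →
          debtSnd γ + T ≤ debtSnd β + Tree.dist (debtFst β) (debtFst γ) := by
        intro β h1 h2
        rw [debt_le] at h1
        rw [debt_dist] at h2
        omega
      obtain ⟨β, h1, h2⟩ := h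
      have h3 := key β h1 h2
      have h4 := (Tree.le_trans' (Tree.zero_le' _) h1.1).2
      have h5 := debtSnd_le β
      -- The larger debt is admissible because some `β` permits the time `T`: its debt is at most
      -- the norm of its tree, and norm plus distance is at most the norm of the tree of `γ`.
      refine ⟨mkDebt (debtFst γ) (debtSnd γ + T) (by
        change Tree.dist 0 (debtFst β) + Tree.dist (debtFst β) (debtFst γ) ≤
          Tree.dist 0 (debtFst γ) at h4
        omega), fun δ h6 h7 => ?_⟩
      have h8 := key δ h6 h7
      rw [debt_le, debt_le, debt_dist, debtFst_mk, debtSnd_mk]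
      exact ⟨⟨h6.1, h8⟩, ⟨Tree.le_refl' _, by omega⟩, by omega⟩
    · exact ⟨γ, fun β h1 h2 => absurd ⟨β, h1, h2⟩ h⟩
  payBang φ := by
    obtain ⟨s, hs⟩ := Tree.exists_bang_add_le (debtFst φ)
    refine ⟨mkDebt s 0 (Nat.zero_le _), fun β δ T h1 h2 => ?_⟩
    have h4 := (Tree.le_trans' (Tree.zero_le' _) h1.1).2
    have h5 := debtSnd_le δ
    rw [debt_le] at h1
    rw [debt_dist] at h2
    rw [debtFst_add, debtSnd_add] at h1 h2
    change Tree.dist 0 (debtFst δ) + Tree.dist (debtFst δ) (debtFst φ + debtFst β) ≤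
      Tree.dist 0 (debtFst φ + debtFst β) at h4
    refine ⟨mkDebt (debtFst φ + debtFst β) (debtSnd φ + debtSnd β + T) (by omega), ?_⟩
    have h6 := hs (debtFst β)
    rw [add_comm (debtFst β)] at h6
    rw [debt_le, debt_le, debt_dist]
    simp only [debtFst_add, debtSnd_add, debtFst_bang, debtSnd_bang, debtFst_mk, debtSnd_mk]
    exact ⟨⟨h1.1, by omega⟩, ⟨h6, by omega⟩, by omega⟩

end Debt

end LAL

namespace LAL

/-! ### Uniformly realized families of maps -/

namespace ResourceMonoid

variable {M : ResourceMonoid}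

theorem le_of_eq {a b : M.Carrier} (h : a = b) : M.le a b := h ▸ M.le_refl a

/-- A summand on the larger side makes its whole norm available as additional time. -/
theorem dist_add_norm_le {a b : M.Carrier} (h : M.le b a) (t : M.Carrier) :
    M.dist b a + M.norm t ≤ M.dist b (t + a) := by
  have h1 := M.dist_triangle h (le_add_left a t)
  have h2 := M.dist_add a (M.zero_le t)
  rw [zero_add] at h2
  simp only [norm]
  omega

/-- A majorizer that covers a fixed time and a fixed size. -/
theorem exists_cover (n : ℕ) (κ : M.Carrier) : ∃ φ, n ≤ M.norm φ ∧ ∀ α β t,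
    M.le β (κ + α) → t ≤ M.dist β (κ + α) + n → M.le β (φ + α) ∧ t ≤ M.dist β (φ + α) := by
  obtain ⟨τ, hτ⟩ := M.dist_unbounded n
  refine ⟨τ + κ, hτ.trans (norm_mono (le_add_right τ κ)), fun α β t h h2 => ?_⟩
  rw [add_assoc]
  refine ⟨M.le_trans h (le_add_left _ _), ?_⟩
  have := dist_add_norm_le h τ
  change n ≤ M.norm τ at hτ
  omega

theorem exists_le_norm (n : ℕ) : ∃ a, n ≤ M.norm a := M.dist_unbounded n

theorem norm_le_norm_add_left (a b : M.Carrier) : M.norm a ≤ M.norm (b + a) :=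
  norm_mono (le_add_left a b)

end ResourceMonoid

open ResourceMonoid

namespace CompModel

variable (C : CompModel)

/-- `z` is a composition of `x` and `y` up to the constant `c`. -/
def IsComp (c : ℕ) (x y z : C.L) : Prop :=
  C.size z ≤ C.size x + C.size y + c ∧ ∀ w, C.app z w = (C.app x w).bind (C.app y) ∧
    ∀ v ∈ C.app x w, ∀ u ∈ C.app y v, C.time z w ≤ C.time x w + C.time y v + c

variable {C}

theorem IsComp.mem {c : ℕ} {x y z w v u : C.L} (h : C.IsComp c x y z) (hv : v ∈ C.app x w)
    (hu : u ∈ C.app y v) : u ∈ C.app z w ∧ C.time z w ≤ C.time x w + C.time y v + c := by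
  obtain ⟨h1, h2⟩ := h.2 w
  exact ⟨by rw [h1]; exact Part.mem_bind hv hu, h2 v hv u hu⟩

end CompModel

section Unif

variable {M : ResourceMonoid} {C : CompModel}

/-- The summand `κ` pays for the overhead of composition in time and in length. It depends on `c`
only, so composing repeatedly adds one copy of `κ` each time; the majorizers of words need this. -/
theorem exists_realizes_comp (M : ResourceMonoid) (C : CompModel) (c : ℕ) : ∃ κ : M.Carrier,
    ∀ {x y z : C.L}, C.IsComp c x y z → ∀ {A B D : LengthSpace M C} {φ ψ : M.Carrier}
      {f : A.Carrier → B.Carrier} {g : B.Carrier → D.Carrier}, Realizes A B φ x f →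
      Realizes B D ψ y g → Realizes A D (κ + (φ + ψ)) z (fun a => g (f a)) := by
  obtain ⟨κ, hκ⟩ := exists_le_norm (M := M) c
  refine ⟨κ, fun {x y z} hz {A B D φ ψ f g} hf hg => ⟨?_, fun α d a ha => ?_⟩⟩
  · have h1 := norm_add κ (φ + ψ)
    have h2 := norm_add φ ψ
    have := hz.1
    have := hf.1
    have := hg.1
    omega
  · obtain ⟨β, v, hv, hβ, hv2, hv3⟩ := hf.2 α d a ha
    obtain ⟨γ, u, hu, hγ, hu2, hu3⟩ := hg.2 β v _ hv
    obtain ⟨h1, h2⟩ := hz.mem hv2 hu2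
    have h3 := add_le_add_left ψ hβ
    have h4 := M.dist_add ψ hβ
    rw [add_comm β, add_comm (φ + α)] at h4
    have h5 := M.dist_triangle hγ h3
    have h6 := M.le_trans hγ h3
    have h7 := dist_add_norm_le h6 κ
    rw [show κ + (φ + ψ) + α = κ + (ψ + (φ + α)) by abel]
    exact ⟨γ, u, hu, M.le_trans h6 (le_add_left _ _), h1, by omega⟩

variable {I : Type*}

/-- A family of maps that have a common realizer and a common majorizer. -/
def Unif (A B : I → LengthSpace M C) (f : ∀ i, (A i).Carrier → (B i).Carrier) : Prop :=
  ∃ φ e, ∀ i, Realizes (A i) (B i) φ e (f i)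

namespace Unif

variable {A B D X : I → LengthSpace M C}

/-- Time may be exceeded by a constant and the size of the code may be ignored: both are absorbed by
enlarging the common majorizer once. -/
theorem of_step {f : ∀ i, (A i).Carrier → (B i).Carrier} (e : C.L) (c : ℕ) (κ : M.Carrier)
    (h : ∀ i α d a, (A i).rel α d a → ∃ y β, y ∈ C.app e d ∧ (B i).rel β y (f i a) ∧
      M.le β (κ + α) ∧ C.time e d ≤ M.dist β (κ + α) + c) : Unif A B f := by
  obtain ⟨φ, h1, h2⟩ := exists_cover (M := M) (c + C.size e) κ
  refine ⟨φ, e, fun i => ⟨by omega, fun α d a ha => ?_⟩⟩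
  obtain ⟨y, β, h3, h4, h5, h6⟩ := h i α d a ha
  obtain ⟨h7, h8⟩ := h2 α β (C.time e d) h5 (by omega)
  exact ⟨β, y, h4, h7, h3, h8⟩

/-- Maps that are realized by the identity. -/
theorem of_rel {f : ∀ i, (A i).Carrier → (B i).Carrier} (κ : M.Carrier)
    (h : ∀ i α d a, (A i).rel α d a → ∃ β, (B i).rel β d (f i a) ∧ M.le β (κ + α)) :
    Unif A B f := by
  obtain ⟨e, c, he⟩ := C.ident
  refine of_step e c κ fun i α d a ha => ?_
  obtain ⟨β, h1, h2⟩ := h i α d a ha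
  exact ⟨d, β, by rw [(he d).1]; exact Part.mem_some d, h1, h2,
    (he d).2.trans (Nat.le_add_left _ _)⟩

theorem of_rel_self {f : ∀ i, (A i).Carrier → (B i).Carrier}
    (h : ∀ i α d a, (A i).rel α d a → (B i).rel α d (f i a)) : Unif A B f :=
  of_rel 0 fun i α d a ha => ⟨α, h i α d a ha, le_of_eq (zero_add α).symm⟩

theorem comp {f : ∀ i, (A i).Carrier → (B i).Carrier} {g : ∀ i, (B i).Carrier → (D i).Carrier}
    (hg : Unif B D g) (hf : Unif A B f) : Unif A D fun i a => g i (f i a) := by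
  obtain ⟨e, c, he⟩ := C.comp
  obtain ⟨κ, hκ⟩ := exists_realizes_comp M C c
  obtain ⟨φ, x, hx⟩ := hf
  obtain ⟨ψ, y, hy⟩ := hg
  obtain ⟨z, -, -, hz⟩ := he x y
  exact ⟨_, z, fun i => hκ hz (hx i) (hy i)⟩

theorem reindex {J : Type*} {f : ∀ i, (A i).Carrier → (B i).Carrier} (hf : Unif A B f)
    (r : J → I) : Unif (fun j => A (r j)) (fun j => B (r j)) fun j => f (r j) := by
  obtain ⟨φ, e, h⟩ := hf
  exact ⟨φ, e, fun j => h (r j)⟩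

theorem tensLeft {f : ∀ i, (A i).Carrier → (B i).Carrier} (hf : Unif A B f)
    (X : I → LengthSpace M C) :
    Unif (fun i => tensorSpace (A i) (X i)) (fun i => tensorSpace (B i) (X i))
      fun i a => (f i a.1, a.2) := by
  obtain ⟨e, c, he⟩ := C.tens
  obtain ⟨φ, x, hx⟩ := hf
  obtain ⟨y, -, -, hy, hyx⟩ := he x
  -- A pair is longer than its components by `cp`; the summand `κ` keeps the new pair below the norm
  -- of its majorizer.
  obtain ⟨κ, hκ⟩ := exists_le_norm (M := M) C.cp
  refine of_step y c (φ + κ) ?_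
  rintro i α d ⟨a, a'⟩ ⟨-, g, h, β, γ, hg, hh, rfl, hl⟩
  obtain ⟨δ, v, hv, hδ, hv2, hv3⟩ := (hx i).2 β g a hg
  obtain ⟨h1, h2⟩ := hyx g h
  have h3 := M.add_le_add (γ + κ) hδ
  have h4 := M.dist_add (γ + κ) hδ
  have h5 : M.le (φ + β + (γ + κ)) (φ + κ + α) := by
    rw [show φ + β + (γ + κ) = φ + κ + (β + γ) by abel]
    exact add_le_add_left _ hl
  refine ⟨C.pair v h, δ + (γ + κ), ?_, ⟨?_, v, h, δ, γ, hv, hh, rfl, ?_⟩, M.le_trans h3 h5, ?_⟩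
  · rw [h1]
    exact Part.mem_map _ hv2
  · rw [C.size_pair]
    have := (B i).isLengthSpace.size_le hv
    have := (X i).isLengthSpace.size_le hh
    have := norm_add δ (γ + κ)
    have := norm_add γ κ
    omega
  · exact add_le_add_left _ (le_add_right _ _)
  · have := h2 v hv2
    have := dist_mono h3 h5
    omega

theorem swap : Unif (fun i => tensorSpace (A i) (B i)) (fun i => tensorSpace (B i) (A i))
    fun _ a => (a.2, a.1) := by
  obtain ⟨e, c, he⟩ := C.swap
  refine of_step e c 0 ?_
  rintro i α d ⟨a, b⟩ ⟨hs, g, h, β, γ, hg, hh, rfl, hl⟩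
  obtain ⟨h1, h2⟩ := he g h
  refine ⟨C.pair h g, α, by rw [h1]; exact Part.mem_some _, ⟨?_, h, g, γ, β, hh, hg, rfl, ?_⟩,
    le_of_eq (zero_add α).symm, h2.trans (Nat.le_add_left _ _)⟩
  · rw [C.size_pair] at hs ⊢
    omega
  · rwa [add_comm]

theorem tensRight {f : ∀ i, (A i).Carrier → (B i).Carrier} (hf : Unif A B f)
    (X : I → LengthSpace M C) :
    Unif (fun i => tensorSpace (X i) (A i)) (fun i => tensorSpace (X i) (B i))
      fun i a => (a.1, f i a.2) :=
  swap.comp ((hf.tensLeft X).comp swap)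

theorem assl : Unif (fun i => tensorSpace (A i) (tensorSpace (B i) (D i)))
    (fun i => tensorSpace (tensorSpace (A i) (B i)) (D i)) fun _ a => ((a.1, a.2.1), a.2.2) := by
  obtain ⟨e, c, he⟩ := C.assl
  obtain ⟨κ, hκ⟩ := exists_le_norm (M := M) C.cp
  refine of_step e c κ ?_
  rintro i α d ⟨a, b, b'⟩ ⟨hs, x, q, β, γ, hx, ⟨-, y, z, γ1, γ2, hy, hz, rfl, hl2⟩, rfl, hl⟩
  obtain ⟨h1, h2⟩ := he x y z
  refine ⟨C.pair (C.pair x y) z, κ + α, by rw [h1]; exact Part.mem_some _,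
    ⟨?_, C.pair x y, z, κ + (β + γ1), γ2, ⟨?_, x, y, β, γ1, hx, hy, rfl, le_add_left _ _⟩, hz, rfl,
    ?_⟩, M.le_refl _, h2.trans (Nat.le_add_left _ _)⟩
  · have := norm_le_norm_add_left α κ
    rw [C.size_pair, C.size_pair] at hs ⊢
    omega
  · rw [C.size_pair]
    have := (A i).isLengthSpace.size_le hx
    have := (B i).isLengthSpace.size_le hy
    have := norm_add κ (β + γ1)
    have := norm_add β γ1
    omega
  · rw [add_assoc, add_assoc]
    exact add_le_add_left _ (M.le_trans (add_le_add_left _ hl2) hl)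

/-- The model provides one direction of associativity. The other one arises by reversing the order
of the factors before and after. -/
theorem assr : Unif (fun i => tensorSpace (tensorSpace (A i) (B i)) (D i))
    (fun i => tensorSpace (A i) (tensorSpace (B i) (D i))) fun _ a => (a.1.1, (a.1.2, a.2)) := by
  have h1 : Unif (fun i => tensorSpace (tensorSpace (A i) (B i)) (D i))
      (fun i => tensorSpace (D i) (tensorSpace (B i) (A i))) fun _ a => (a.2, (a.1.2, a.1.1)) :=
    swap.comp (swap.tensLeft D)
  have h2 : Unif (fun i => tensorSpace (tensorSpace (D i) (B i)) (A i))
      (fun i => tensorSpace (A i) (tensorSpace (B i) (D i))) fun _ a => (a.2, (a.1.2, a.1.1)) :=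
    swap.comp (swap.tensLeft A)
  exact h2.comp (assl.comp h1)

theorem snd : Unif (fun i => tensorSpace (A i) (B i)) B fun _ a => a.2 := by
  obtain ⟨e, c, he⟩ := C.throwFirst
  refine of_step e c 0 ?_
  rintro i α d ⟨a, b⟩ ⟨-, g, h, β, γ, hg, hh, rfl, hl⟩
  obtain ⟨h1, h2⟩ := he g h
  refine ⟨h, γ, by rw [h1]; exact Part.mem_some _, hh, ?_, h2.trans (Nat.le_add_left _ _)⟩
  rw [zero_add]
  exact M.le_trans (le_add_left _ _) hl

theorem fst : Unif (fun i => tensorSpace (A i) (B i)) A fun _ a => a.1 := snd.comp swap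

theorem eval : Unif (fun i => tensorSpace (lolliSpace (A i) (B i)) (A i)) B
    fun _ a => a.1.1 a.2 := by
  obtain ⟨e, c, he⟩ := C.eval
  refine of_step e c 0 ?_
  rintro i α d ⟨f, a⟩ ⟨-, g, h, β, γ, hg, hh, rfl, hl⟩
  obtain ⟨h1, h2⟩ := he g h
  obtain ⟨δ, v, hv, hδ, hv2, hv3⟩ := hg.2 γ h a hh
  refine ⟨v, δ, by rw [h1]; exact hv2, hv, ?_, ?_⟩
  · rw [zero_add]
    exact M.le_trans hδ hl
  · have := h2 v hv2
    have := dist_mono hδ hl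
    rw [zero_add]
    omega

theorem curry {f : ∀ i, (A i).Carrier × (B i).Carrier → (D i).Carrier}
    (hf : Unif (fun i => tensorSpace (A i) (B i)) D f) :
    ∃ g : ∀ i, (A i).Carrier → Hom (B i) (D i), (∀ i a b, (g i a).1 b = f i (a, b)) ∧
      Unif A (fun i => lolliSpace (B i) (D i)) g := by
  obtain ⟨e, c, he⟩ := C.curry
  obtain ⟨φ, x, hx⟩ := hf
  obtain ⟨y, -, -, hy, hyx⟩ := he x
  obtain ⟨κ, hκ⟩ := exists_le_norm (M := M) C.cp
  -- Currying adds one `c` to the length of `x` and another one when the argument arrives; the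
  -- second also covers the extra time. The summand `κ` pays for the pair to which `x` is finally
  -- applied.
  obtain ⟨ψ, hψ, hψ2⟩ := exists_cover (M := M) (C.size x + c + c) (φ + κ)
  have key : ∀ i α d a, (A i).rel α d a → ∃ u, C.app y d = Part.some u ∧ C.time y d ≤ c ∧
      Realizes (B i) (D i) (ψ + α) u fun b => f i (a, b) := by
    intro i α d a ha
    obtain ⟨u, h1, h2, h3, h4⟩ := hyx d
    refine ⟨u, h1, h2, ?_, fun γ w b hb => ?_⟩
    · have := (A i).isLengthSpace.size_le ha
      have := norm_add ψ α
      omega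
    · obtain ⟨h5, h6⟩ := h4 w
      obtain ⟨δ, v, hv, hδ, hv2, hv3⟩ := (hx i).2 (κ + (α + γ)) (C.pair d w) (a, b) (by
        refine ⟨?_, d, w, α, γ, ha, hb, rfl, le_add_left _ _⟩
        rw [C.size_pair]
        have := (A i).isLengthSpace.size_le ha
        have := (B i).isLengthSpace.size_le hb
        have := norm_add κ (α + γ)
        have := norm_add α γ
        omega)
      rw [← add_assoc] at hδ hv3
      have := h6 v hv2
      obtain ⟨h7, h8⟩ := hψ2 (α + γ) δ (C.time u w) hδ (by omega)
      rw [← add_assoc] at h7 h8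
      exact ⟨δ, v, hv, h7, by rw [h5]; exact hv2, h8⟩
  refine ⟨fun i a => ⟨fun b => f i (a, b), ?_⟩, fun _ _ _ => rfl, of_step y c ψ ?_⟩
  · obtain ⟨α, d, ha⟩ := (A i).isLengthSpace.exists_rel a
    obtain ⟨u, -, -, h⟩ := key i α d a ha
    exact ⟨_, u, h⟩
  · intro i α d a ha
    obtain ⟨u, h1, h2, h3⟩ := key i α d a ha
    exact ⟨u, ψ + α, by rw [h1]; exact Part.mem_some u, h3, M.le_refl _,
      h2.trans (Nat.le_add_left _ _)⟩

/-- Elements with a common majorized realizer. -/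
theorem ofPoint {a : ∀ i, (B i).Carrier} {α : M.Carrier} {x : C.L}
    (h : ∀ i, (B i).rel α x (a i)) : Unif A B fun i _ => a i := by
  obtain ⟨e, c, he⟩ := C.const x
  refine of_step e c α fun i β d b hb => ⟨x, α, ?_, h i, le_add_right _ _, ?_⟩
  · rw [(he d).1]
    exact Part.mem_some x
  · exact (he d).2.trans (Nat.le_add_left _ _)

/-- All members run the same code on the same realizer of the unit, so they share the resulting
code; the bound `φ + α` is common as well. -/
theorem point {f : ∀ i, (unitSpace M C).Carrier → (B i).Carrier}
    (h : Unif (fun _ => unitSpace M C) B f) : ∃ α x, ∀ i, (B i).rel α x (f i ()) := by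
  obtain ⟨φ, e, h⟩ := h
  obtain ⟨d, -⟩ := C.ident
  obtain ⟨α, hα⟩ := exists_le_norm (M := M) (C.size d)
  by_cases hI : Nonempty I
  · obtain ⟨i₀⟩ := hI
    obtain ⟨-, y, -, -, hy, -⟩ := (h i₀).2 α d () hα
    refine ⟨φ + α, y, fun i => ?_⟩
    obtain ⟨β, y', h1, h2, h3, -⟩ := (h i).2 α d () hα
    obtain rfl := Part.mem_unique hy h3
    exact (B i).isLengthSpace.mono h1 h2
  · exact ⟨0, d, fun i => absurd ⟨i⟩ hI⟩

/-- Adding a component with a common majorized realizer. -/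
theorem pairPoint {a : ∀ i, (B i).Carrier} {α : M.Carrier} {x : C.L}
    (h : ∀ i, (B i).rel α x (a i)) :
    Unif A (fun i => tensorSpace (A i) (B i)) fun i b => (b, a i) := by
  obtain ⟨e, c, he⟩ := C.tensConst x
  obtain ⟨κ, hκ⟩ := exists_le_norm (M := M) C.cp
  refine of_step e c (κ + α) fun i β d b hb => ⟨C.pair d x, κ + α + β, ?_,
    ⟨?_, d, x, β, α, hb, h i, rfl, ?_⟩, M.le_refl _, (he d).2.trans (Nat.le_add_left _ _)⟩
  · rw [(he d).1]
    exact Part.mem_some _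
  · rw [C.size_pair]
    have := (A i).isLengthSpace.size_le hb
    have := (B i).isLengthSpace.size_le (h i)
    have := norm_add (κ + α) β
    have := norm_add κ α
    omega
  · rw [add_comm β, add_assoc]
    exact le_add_left _ _

end Unif

/-! ### Quantifier introduction and the modalities -/

section Modal

variable {M : LightMonoid} {C : CompModel} {I : Type*}
  {A B D X : I → LengthSpace M.toResourceMonoid C}

namespace Unif

/-- For different `S` the computed code is the same but the majorizer of the result may vary. The
element given by `pay` lies above all of them and still leaves the time that the computation takes.
-/
theorem forallGen (hM : Paying M) {T : I → SmallSpace M.toResourceMonoid C →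
      LengthSpace M.toResourceMonoid C}
    {f : ∀ p : I × SmallSpace M.toResourceMonoid C, (A p.1).Carrier → (T p.1 p.2).Carrier}
    (hf : Unif (fun p : I × SmallSpace M.toResourceMonoid C => A p.1) (fun p => T p.1 p.2) f) :
    ∃ g : ∀ i, (A i).Carrier → (forallSpace (T i)).Carrier,
      (∀ i a S, (g i a).1 S = f (i, S) a) ∧ Unif A (fun i => forallSpace (T i)) g := by
  obtain ⟨φ, e, h⟩ := hf
  have key : ∀ i α d a, (A i).rel α d a → ∃ β y, (∀ S, (T i S).rel β y (f (i, S) a)) ∧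
      M.le β (φ + α) ∧ y ∈ C.app e d ∧ C.time e d ≤ M.dist β (φ + α) := by
    intro i α d a ha
    obtain ⟨γ, hγ⟩ := hM.pay (φ + α) (C.time e d)
    obtain ⟨β, y, h1, h2, h3, h4⟩ := (h (i, Classical.arbitrary _)).2 α d a ha
    obtain ⟨h5, h6, h7⟩ := hγ β h2 h4
    refine ⟨γ, y, fun S => ?_, h6, h3, h7⟩
    obtain ⟨β', y', h1', h2', h3', h4'⟩ := (h (i, S)).2 α d a ha
    obtain rfl := Part.mem_unique h3 h3'
    exact (T i S).isLengthSpace.mono h1' (hγ β' h2' h4').1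
  refine ⟨fun i a => ⟨fun S => f (i, S) a, ?_⟩, fun _ _ _ => rfl, φ, e, fun i =>
    ⟨(h (i, Classical.arbitrary _)).1, key i⟩⟩
  obtain ⟨α, d, ha⟩ := (A i).isLengthSpace.exists_rel a
  obtain ⟨β, y, h1, -⟩ := key i α d a ha
  exact ⟨β, y, h1⟩

/-- Duplicating a code takes time linear in its length. The length is at most the norm of the
majorizer under `!`, and this is what `Grounded.contr` pays for. -/
theorem bangContr (hM : Grounded M) : Unif (fun i => bangSpace (A i))
    (fun i => tensorSpace (bangSpace (A i)) (bangSpace (A i))) fun _ a => (a, a) := by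
  obtain ⟨e, c, he⟩ := C.contr
  obtain ⟨κ, hκ⟩ := exists_le_norm (M := M.toResourceMonoid) C.cp
  obtain ⟨φ, hφ⟩ := hM.contr c
  refine of_step e 0 (φ + κ) ?_
  rintro i α d a ⟨u, hu, hl⟩
  obtain ⟨h1, h2⟩ := he d
  have h3 := (A i).isLengthSpace.size_le hu
  have h4 := M.norm_le_bang u
  obtain ⟨h5, h6⟩ := hφ u
  have h7 := M.add_le_add κ h5
  have h8 := M.dist_add κ h5
  have h9 : M.le (φ + M.bang u + κ) (φ + κ + α) := by
    rw [show φ + M.bang u + κ = φ + κ + M.bang u by abel]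
    exact add_le_add_left _ hl
  refine ⟨C.pair d d, M.bang u + M.bang u + κ, by rw [h1]; exact Part.mem_some _,
    ⟨?_, d, d, M.bang u, M.bang u, ⟨u, hu, M.le_refl _⟩, ⟨u, hu, M.le_refl _⟩, rfl,
      le_add_right _ _⟩, M.le_trans h7 h9, ?_⟩
  · rw [C.size_pair]
    have := norm_add (M.bang u + M.bang u) κ
    have := norm_add (M.bang u) (M.bang u)
    change M.norm u ≤ M.norm (M.bang u) at h4
    omega
  · have := dist_mono h7 h9
    have := Nat.mul_le_mul_left c (Nat.succ_le_succ h3)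
    simp only [Nat.succ_eq_add_one] at this
    omega

/-- The premise leaves its time as a distance under `!`, while the rule needs it outside; `payBang`
makes this transfer with a summand `φ'` that depends on `φ` alone. -/
theorem bangMap (hM : Paying M) {f : ∀ i, (A i).Carrier → (B i).Carrier} (hf : Unif A B f) :
    Unif (fun i => bangSpace (A i)) (fun i => bangSpace (B i)) f := by
  obtain ⟨φ, e, h⟩ := hf
  obtain ⟨φ', hφ⟩ := hM.payBang φ
  refine of_step e 0 φ' ?_
  rintro i α d a ⟨u, hu, hl⟩
  obtain ⟨β, y, h1, h2, h3, h4⟩ := (h i).2 u d a hu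
  obtain ⟨δ, h5, h6, h7⟩ := hφ u β _ h2 h4
  have h8 := add_le_add_left φ' hl
  exact ⟨y, M.bang δ, h3, ⟨δ, (B i).isLengthSpace.mono h1 h5, M.le_refl _⟩, M.le_trans h6 h8,
    h7.trans (dist_mono h6 h8)⟩

/-- Without hypotheses the value has a fixed realizer and a fixed majorizer. No time is spent under
`!`, so no payment is needed. -/
theorem bangPoint {f : ∀ i, (unitSpace M.toResourceMonoid C).Carrier → (B i).Carrier}
    (hf : Unif (fun _ => unitSpace M.toResourceMonoid C) B f) :
    Unif (fun _ => unitSpace M.toResourceMonoid C) (fun i => bangSpace (B i)) f := by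
  obtain ⟨α, x, h⟩ := point hf
  exact ofPoint (B := fun i => bangSpace (B i)) (a := fun i => f i ()) (α := M.bang α) (x := x)
    fun i => ⟨α, h i, M.le_refl _⟩

/-- On majorizers `§` is additive and does not shrink distances, so time spent under `§` remains
available outside. -/
theorem secMap (hM : Grounded M) {f : ∀ i, (A i).Carrier → (B i).Carrier} (hf : Unif A B f) :
    Unif (fun i => secSpace (A i)) (fun i => secSpace (B i)) f := by
  obtain ⟨φ, e, h⟩ := hf
  refine of_step e 0 (M.sec φ) ?_
  rintro i α d a ⟨u, hu, hl⟩
  obtain ⟨β, y, h1, h2, h3, h4⟩ := (h i).2 u d a hu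
  obtain ⟨h5, h6⟩ := hM.sec_le_sec h2
  rw [hM.sec_add] at h5 h6
  have h8 := add_le_add_left (M.sec φ) hl
  exact ⟨y, M.sec β, h3, ⟨β, h1, M.le_refl _⟩, M.le_trans h5 h8,
    (h4.trans h6).trans (dist_mono h5 h8)⟩

theorem secTensor (hM : Grounded M) :
    Unif (fun i => tensorSpace (secSpace (A i)) (secSpace (B i)))
      (fun i => secSpace (tensorSpace (A i) (B i))) fun _ a => a := by
  obtain ⟨κ, hκ⟩ := exists_le_norm (M := M.toResourceMonoid) C.cp
  refine of_rel (M.sec κ) ?_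
  rintro i α d ⟨a, b⟩ ⟨-, g, h, β, γ, ⟨u, hu, hul⟩, ⟨v, hv, hvl⟩, rfl, hl⟩
  refine ⟨M.sec (κ + (u + v)), ⟨κ + (u + v), ⟨?_, g, h, u, v, hu, hv, rfl, le_add_left _ _⟩,
    M.le_refl _⟩, ?_⟩
  · rw [C.size_pair]
    have := (A i).isLengthSpace.size_le hu
    have := (B i).isLengthSpace.size_le hv
    have := norm_add κ (u + v)
    have := norm_add u v
    omega
  · rw [hM.sec_add, hM.sec_add]
    exact add_le_add_left _ (M.le_trans (add_le_add' hul hvl) hl)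

theorem secUnit : Unif (fun _ : I => unitSpace M.toResourceMonoid C)
    (fun _ => secSpace (unitSpace M.toResourceMonoid C)) fun _ a => a := by
  obtain ⟨d, -⟩ := C.ident
  obtain ⟨α, hα⟩ := exists_le_norm (M := M.toResourceMonoid) (C.size d)
  exact ofPoint (B := fun _ => secSpace (unitSpace M.toResourceMonoid C)) (a := fun _ => ())
    (α := M.sec α) (x := d) fun i => ⟨α, hα, M.le_refl _⟩

theorem bangToSec (hM : Grounded M) : Unif (fun i => bangSpace (A i)) (fun i => secSpace (A i))
    fun _ a => a :=
  of_rel_self fun _ _ _ _ ⟨u, hu, hl⟩ => ⟨u, hu, M.le_trans (hM.sec_le_bang u) hl⟩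

end Unif

end Modal
end Unif
end LAL

namespace LAL

/-! ### Interpretation of renamings and substitutions -/

section Isomorphism

variable {M : ResourceMonoid} {C : CompModel}

/-- Isomorphism by a bijection that preserves majorized realizers. -/
def Iso (A B : LengthSpace M C) : Prop :=
  ∃ e : A.Carrier ≃ B.Carrier, ∀ α x a, A.rel α x a ↔ B.rel α x (e a)

namespace Iso

variable {A A' B B' : LengthSpace M C}

theorem refl (A : LengthSpace M C) : Iso A A := ⟨Equiv.refl _, fun _ _ _ => Iff.rfl⟩

theorem symm (h : Iso A B) : Iso B A := by
  obtain ⟨e, he⟩ := h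
  exact ⟨e.symm, fun α x b => by rw [he, Equiv.apply_symm_apply]⟩

theorem of_eq (h : A = B) : Iso A B := h ▸ refl A

theorem trans {D : LengthSpace M C} (h : Iso A B) (h2 : Iso B D) : Iso A D := by
  obtain ⟨e, he⟩ := h
  obtain ⟨e', he'⟩ := h2
  exact ⟨e.trans e', fun α x a => (he _ _ _).trans (he' _ _ _)⟩

theorem lolli (hA : Iso A A') (hB : Iso B B') : Iso (lolliSpace A B) (lolliSpace A' B') := by
  obtain ⟨e, he⟩ := hA
  obtain ⟨e', he'⟩ := hB
  have key : ∀ φ x (f : A.Carrier → B.Carrier),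
      Realizes A B φ x f ↔ Realizes A' B' φ x (Equiv.arrowCongr e e' f) := by
    intro φ x f
    refine and_congr_right fun _ => ?_
    constructor
    · intro h α d a ha
      obtain ⟨β, c, h1, h2⟩ := h α d (e.symm a) (by rw [he, e.apply_symm_apply]; exact ha)
      exact ⟨β, c, (he' _ _ _).1 h1, h2⟩
    · intro h α d a ha
      obtain ⟨β, c, h1, h2⟩ := h α d (e a) ((he _ _ _).1 ha)
      refine ⟨β, c, ?_, h2⟩
      rw [he']
      simpa using h1
  exact ⟨(Equiv.arrowCongr e e').subtypeEquiv fun f =>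
    exists_congr fun φ => exists_congr fun x => key φ x f, fun φ x f => key φ x f.1⟩

theorem tensor (hA : Iso A A') (hB : Iso B B') : Iso (tensorSpace A B) (tensorSpace A' B') := by
  obtain ⟨e, he⟩ := hA
  obtain ⟨e', he'⟩ := hB
  refine ⟨e.prodCongr e', fun α x a => and_congr_right fun _ => exists_congr fun f =>
    exists_congr fun g => exists_congr fun β => exists_congr fun γ => ?_⟩
  exact and_congr (he _ _ _) (and_congr_left fun _ => he' _ _ _)

theorem all {T T' : SmallSpace M C → LengthSpace M C} (h : ∀ S, Iso (T S) (T' S)) :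
    Iso (forallSpace T) (forallSpace T') := by
  choose e he using h
  exact ⟨(Equiv.piCongrRight e).subtypeEquiv fun a => exists_congr fun α => exists_congr fun x =>
    forall_congr' fun S => he S _ _ _, fun α x a => forall_congr' fun S => he S _ _ _⟩

/-- No code realizes two different elements, hence an element is determined by the set of its
realizers. -/
theorem canon (A : LengthSpace M C) : Iso A (canon A).toLengthSpace := by
  have hinj : Function.Injective (classOf A) := by
    intro a b h
    obtain ⟨α, x, hx⟩ := A.isLengthSpace.exists_rel a
    have h1 : x ∈ (classOf A a).1 := ⟨α, hx⟩
    rw [h] at h1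
    obtain ⟨β, hb⟩ := h1
    exact A.isLengthSpace.unique' hx hb
  refine ⟨Equiv.ofBijective (classOf A) ⟨hinj, fun c => ?_⟩,
    fun α x a => ⟨fun h => ⟨a, h, rfl⟩, ?_⟩⟩
  · obtain ⟨α, x, a, -, rfl⟩ := (LAL.canon A).isLengthSpace.exists_rel c
    exact ⟨a, rfl⟩
  · rintro ⟨b, hb, h⟩
    rwa [hinj h]

end Iso

theorem Same.unique {A B : LengthSpace M C} {a : A.Carrier} {b b' : B.Carrier}
    (h : Same a b) (h' : Same a b') : b = b' := by
  obtain ⟨α, x, hx⟩ := B.isLengthSpace.exists_rel b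
  exact B.isLengthSpace.unique hx ((h' _ _).1 ((h _ _).2 hx))

end Isomorphism

/-! ### Isomorphic environments, renaming and substitution -/

section Substitution

variable {M : LightMonoid} {C : CompModel}

theorem Iso.interp (A : Formula) {η η' : Env M C} (h : ∀ n, Iso (η n) (η' n)) :
    Iso (interp A η) (interp A η') := by
  induction A generalizing η η' with
  | var n => exact h n
  | lolli A B ihA ihB => exact (ihA h).lolli (ihB h)
  | tensor A B ihA ihB => exact (ihA h).tensor (ihB h)
  | all A ih =>
    refine Iso.all fun S => ih fun n => ?_
    rcases n with _ | n
    · exact Iso.refl _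
    · exact h n
  | bang A ih =>
    obtain ⟨e, he⟩ := ih h
    exact ⟨e, fun α x a => exists_congr fun u => and_congr_left fun _ => he _ _ _⟩
  | sec A ih =>
    obtain ⟨e, he⟩ := ih h
    exact ⟨e, fun α x a => exists_congr fun u => and_congr_left fun _ => he _ _ _⟩

theorem interp_rename (A : Formula) (ρ : ℕ → ℕ) (η : Env M C) :
    interp (A.rename ρ) η = interp A fun n => η (ρ n) := by
  induction A generalizing ρ η with
  | var n => rfl
  | lolli A B ihA ihB => simp only [Formula.rename, interp, ihA, ihB]
  | tensor A B ihA ihB => simp only [Formula.rename, interp, ihA, ihB]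
  | all A ih =>
    simp only [Formula.rename, interp, ih]
    congr 1
    funext S
    congr 1
    funext n
    rcases n with _ | n <;> rfl
  | bang A ih => simp only [Formula.rename, interp, ih]
  | sec A ih => simp only [Formula.rename, interp, ih]

theorem interp_shift (A : Formula) (S : LengthSpace M.toResourceMonoid C) (η : Env M C) :
    interp A.shift (Env.cons S η) = interp A η := interp_rename A Nat.succ _

theorem interp_subst (A : Formula) (σ : ℕ → Formula) (η : Env M C) :
    interp (A.subst σ) η = interp A fun n => interp (σ n) η := by
  induction A generalizing σ η with
  | var n => rfl
  | lolli A B ihA ihB => simp only [Formula.subst, interp, ihA, ihB]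
  | tensor A B ihA ihB => simp only [Formula.subst, interp, ihA, ihB]
  | all A ih =>
    simp only [Formula.subst, interp, ih]
    congr 1
    funext S
    congr 1
    funext n
    rcases n with _ | n
    · rfl
    · exact interp_shift _ _ _
  | bang A ih => simp only [Formula.subst, interp, ih]
  | sec A ih => simp only [Formula.subst, interp, ih]

theorem interp_inst (A D : Formula) (η : Env M C) :
    interp (Formula.inst A D) η = interp A (Env.cons (interp D η) η) := by
  rw [Formula.inst, interp_subst]
  congr 1
  funext n
  rcases n with _ | n <;> rfl

/-- Substitution is interpreted by an equality of spaces. An isomorphism is needed only because the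
quantifier is instantiated at the small copy of the interpretation of `D`. -/
theorem Iso.inst (A D : Formula) (η : Env M C) :
    Iso (LAL.interp A (Env.cons (LAL.canon (LAL.interp D η)).toLengthSpace η))
      (LAL.interp (Formula.inst A D) η) := by
  rw [interp_inst]
  refine Iso.interp A fun n => ?_
  rcases n with _ | n
  · exact (Iso.canon _).symm
  · exact Iso.refl _

theorem ctx_map_shift (Γ : List Formula) (S : LengthSpace M.toResourceMonoid C) (η : Env M C) :
    ctx (Γ.map Formula.shift) (Env.cons S η) = ctx Γ η := by
  induction Γ with
  | nil => rfl
  | cons A Γ ih => rw [List.map_cons, ctx, ctx, ih, interp_shift]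

end Substitution

/-! ### Denotations are unique -/

section Denotations

variable {M : LightMonoid} {C : CompModel}

/-- The inverse of `joinCtx`. -/
def splitCtx {η : Env M C} {Γ : List Formula} : (Δ : List Formula) →
    (ctx (Δ ++ Γ) η).Carrier → (ctx Γ η).Carrier × (ctx Δ η).Carrier
  | [], x => (x, ())
  | _ :: Δ, x => ((splitCtx Δ x.1).1, ((splitCtx Δ x.1).2, x.2))

theorem splitCtx_joinCtx {η : Env M C} {Γ : List Formula} (g : (ctx Γ η).Carrier)
    (Δ : List Formula) (d : (ctx Δ η).Carrier) : splitCtx Δ (joinCtx g Δ d) = (g, d) := by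
  induction Δ with
  | nil => rfl
  | cons A Δ ih =>
    simp only [joinCtx, splitCtx, ih d.1]
    rfl

theorem joinCtx_splitCtx {η : Env M C} {Γ : List Formula} (Δ : List Formula)
    (x : (ctx (Δ ++ Γ) η).Carrier) : joinCtx (splitCtx Δ x).1 Δ (splitCtx Δ x).2 = x := by
  induction Δ with
  | nil => rfl
  | cons A Δ ih =>
    exact Prod.ext (ih x.1) rfl

/-- Each clause gives the value at every point: every element of a joined context arises from its
parts, and an element corresponds to at most one element of another space. -/
theorem Denotes.unique {Γ : List Formula} {A : Formula} (π : Proof Γ A) (η : Env M C)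
    {F F' : Hom (ctx Γ η) (interp A η)} (h : Denotes π η F) (h' : Denotes π η F') : F = F' := by
  refine Subtype.ext (funext fun x => ?_)
  induction π generalizing η with
  | ax A => exact (h x).trans (h' x).symm
  | @cut Γ Δ A B π ρ ih ih' =>
    obtain ⟨G, H, hG, hH, hF⟩ := h
    obtain ⟨G', H', hG', hH', hF'⟩ := h'
    rw [← joinCtx_splitCtx Δ x, hF, hF', ih η hG hG']
    exact ih' η hH hH' _
  | weak B π ih =>
    obtain ⟨G, hG, hF⟩ := h
    obtain ⟨G', hG', hF'⟩ := h'
    rw [hF, hF', ih η hG hG']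
  | exch Γ π ih =>
    obtain ⟨G, hG, hF⟩ := h
    obtain ⟨G', hG', hF'⟩ := h'
    rw [hF, hF', ih η hG hG']
  | tensorL π ih =>
    obtain ⟨G, hG, hF⟩ := h
    obtain ⟨G', hG', hF'⟩ := h'
    exact (hF x.1 x.2.1 x.2.2).trans ((ih η hG hG' _).trans (hF' _ _ _).symm)
  | @tensorR Γ Δ A B π ρ ih ih' =>
    obtain ⟨G, H, hG, hH, hF⟩ := h
    obtain ⟨G', H', hG', hH', hF'⟩ := h'
    rw [← joinCtx_splitCtx Δ x, hF, hF', ih η hG hG', ih' η hH hH']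
  | @lolliL Γ Δ A B D π ρ ih ih' =>
    obtain ⟨G, H, hG, hH, hF⟩ := h
    obtain ⟨G', H', hG', hH', hF'⟩ := h'
    obtain ⟨x, f⟩ := x
    rw [← joinCtx_splitCtx Δ x, hF, hF', ih η hG hG']
    exact ih' η hH hH' _
  | lolliR π ih =>
    obtain ⟨G, hG, hF⟩ := h
    obtain ⟨G', hG', hF'⟩ := h'
    exact Subtype.ext (funext fun a => (hF x a).trans ((ih η hG hG' _).trans (hF' x a).symm))
  | allL D π ih =>
    obtain ⟨G, hG, hF⟩ := h
    obtain ⟨G', hG', hF'⟩ := h'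
    obtain ⟨b, hb, hFb⟩ := hF x.1 x.2
    obtain ⟨b', hb', hFb'⟩ := hF' x.1 x.2
    obtain rfl := hb.unique hb'
    exact hFb.trans ((ih η hG hG' _).trans hFb'.symm)
  | allR π ih =>
    refine Subtype.ext (funext fun S => ?_)
    obtain ⟨G, hG, hF⟩ := h S
    obtain ⟨G', hG', hF'⟩ := h' S
    obtain ⟨g, hg, hFg⟩ := hF x
    obtain ⟨g', hg', hFg'⟩ := hF' x
    obtain rfl := hg.unique hg'
    exact hFg.trans ((ih _ hG hG' _).trans hFg'.symm)
  | secP π ih =>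
    obtain ⟨G, hG, hF⟩ := h
    obtain ⟨G', hG', hF'⟩ := h'
    exact (hF x).trans ((ih η hG hG' _).trans (hF' x).symm)
  | bangP1 π ih =>
    obtain ⟨G, hG, hF⟩ := h
    obtain ⟨G', hG', hF'⟩ := h'
    exact (hF x).trans ((ih η hG hG' _).trans (hF' x).symm)
  | bangP2 π ih =>
    obtain ⟨G, hG, hF⟩ := h
    obtain ⟨G', hG', hF'⟩ := h'
    exact (hF x).trans ((ih η hG hG' _).trans (hF' x).symm)
  | contr π ih =>
    obtain ⟨G, hG, hF⟩ := h
    obtain ⟨G', hG', hF'⟩ := h'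
    exact (hF x.1 x.2).trans ((ih η hG hG' _).trans (hF' _ _).symm)

/-! ### Existence of denotations -/

/-- Proofs without the rule `A ⊢ B / !A ⊢ !B` and without the right rule for `∀`. -/
def Proof.Plain : {Γ : List Formula} → {A : Formula} → Proof Γ A → Prop
  | _, _, .ax _ => True
  | _, _, .cut π ρ => Plain π ∧ Plain ρ
  | _, _, .weak _ π => Plain π
  | _, _, .exch _ π => Plain π
  | _, _, .tensorL π => Plain π
  | _, _, .tensorR π ρ => Plain π ∧ Plain ρ
  | _, _, .lolliL π ρ => Plain π ∧ Plain ρ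
  | _, _, .lolliR π => Plain π
  | _, _, .allL _ π => Plain π
  | _, _, .allR _ => False
  | _, _, .secP π => Plain π
  | _, _, .bangP1 _ => False
  | _, _, .bangP2 π => Plain π
  | _, _, .contr π => Plain π

theorem Unif.hom {M : ResourceMonoid} {I : Type*} {A B : I → LengthSpace M C}
    {f : ∀ i, (A i).Carrier → (B i).Carrier} (hf : Unif A B f) (i : I) :
    ∃ φ e, Realizes (A i) (B i) φ e (f i) := by
  obtain ⟨φ, e, h⟩ := hf
  exact ⟨φ, e, h i⟩

theorem unif_splitCtx (Γ Δ : List Formula) : Unif (I := Env M C) (fun η => ctx (Δ ++ Γ) η)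
    (fun η => tensorSpace (ctx Γ η) (ctx Δ η)) fun _ x => splitCtx Δ x := by
  induction Δ with
  | nil =>
    obtain ⟨d, -⟩ := C.ident
    obtain ⟨α, hα⟩ := ResourceMonoid.exists_le_norm (M := M.toResourceMonoid) (C.size d)
    exact Unif.pairPoint (B := fun _ => unitSpace M.toResourceMonoid C) (a := fun _ => ())
      fun _ => hα
  | cons A Δ ih => exact Unif.assr.comp (ih.tensLeft fun η => interp A η)

theorem unif_swapCtx (Γ : List Formula) {Δ : List Formula} {A B : Formula} :
    Unif (I := Env M C) (fun η => ctx (Γ ++ B :: A :: Δ) η) (fun η => ctx (Γ ++ A :: B :: Δ) η)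
      fun _ x => swapCtx Γ x := by
  induction Γ with
  | nil =>
    have h1 : Unif (I := Env M C)
        (fun η => tensorSpace (ctx Δ η) (tensorSpace (interp A η) (interp B η)))
        (fun η => tensorSpace (tensorSpace (ctx Δ η) (interp B η)) (interp A η))
        fun _ x => ((x.1, x.2.2), x.2.1) :=
      Unif.assl.comp (Unif.swap.tensRight fun η => ctx Δ η)
    exact h1.comp Unif.assr
  | cons D Γ ih => exact ih.tensLeft fun η => interp D η

/-- Each `!` is weakened to `§`, and the modalities of the factors are then collected in front of
the tensor product. -/
theorem unif_unmodal (hM : Grounded M) (Γ Δ : List Formula) :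
    Unif (I := Env M C) (fun η => ctx (Δ.map Formula.bang ++ Γ.map Formula.sec) η)
      (fun η => secSpace (ctx (Δ ++ Γ) η)) fun _ x => unmodal Γ Δ x := by
  induction Δ with
  | nil =>
    change Unif (I := Env M C) (fun η => ctx (Γ.map Formula.sec) η)
      (fun η => secSpace (ctx Γ η)) fun _ x => unsec Γ x
    induction Γ with
    | nil => exact Unif.secUnit
    | cons A Γ ih => exact (Unif.secTensor hM).comp (ih.tensLeft fun η => secSpace (interp A η))
  | cons A Δ ih =>
    exact (Unif.secTensor hM).comp (((Unif.bangToSec hM).tensRight fun η =>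
      secSpace (ctx (Δ ++ Γ) η)).comp (ih.tensLeft fun η => bangSpace (interp A η)))

/-- Uniformity in the environment strengthens the induction hypothesis: the right rule of the
quantifier uses the premise in all environments extended by a small space at once. Only this rule
and the functoriality of `!` need a paying monoid. -/
theorem exists_denotes (hM : Grounded M) {Γ : List Formula} {A : Formula} (π : Proof Γ A)
    (hπ : Paying M ∨ π.Plain) :
    ∃ (f : ∀ η : Env M C, (ctx Γ η).Carrier → (interp A η).Carrier)
      (hf : Unif (fun η => ctx Γ η) (fun η => interp A η) f), ∀ η, Denotes π η ⟨f η, hf.hom η⟩ := by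
  induction π with
  | ax A => exact ⟨fun _ x => x.2, Unif.snd, fun _ _ => rfl⟩
  | @cut Γ Δ A B π ρ ih ih' =>
    obtain ⟨g, hg, hgd⟩ := ih (hπ.imp_right And.left)
    obtain ⟨h, hh, hhd⟩ := ih' (hπ.imp_right And.right)
    refine ⟨fun η x => h η ((splitCtx Δ x).2, g η (splitCtx Δ x).1),
      hh.comp (Unif.swap.comp ((hg.tensLeft fun η => ctx Δ η).comp (unif_splitCtx Γ Δ))),
      fun η => ⟨_, _, hgd η, hhd η, fun x d => ?_⟩⟩
    simp only [splitCtx_joinCtx]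
  | weak B π ih =>
    obtain ⟨g, hg, hgd⟩ := ih hπ
    exact ⟨fun η x => g η x.1, hg.comp Unif.fst, fun η => ⟨_, hgd η, fun _ => rfl⟩⟩
  | exch Γ π ih =>
    obtain ⟨g, hg, hgd⟩ := ih hπ
    exact ⟨fun η x => g η (swapCtx Γ x), hg.comp (unif_swapCtx Γ), fun η =>
      ⟨_, hgd η, fun _ => rfl⟩⟩
  | tensorL π ih =>
    obtain ⟨g, hg, hgd⟩ := ih hπ
    exact ⟨fun η x => g η ((x.1, x.2.1), x.2.2), hg.comp Unif.assl, fun η =>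
      ⟨_, hgd η, fun _ _ _ => rfl⟩⟩
  | @tensorR Γ Δ A B π ρ ih ih' =>
    obtain ⟨g, hg, hgd⟩ := ih (hπ.imp_right And.left)
    obtain ⟨h, hh, hhd⟩ := ih' (hπ.imp_right And.right)
    refine ⟨fun η x => (g η (splitCtx Δ x).1, h η (splitCtx Δ x).2),
      (hh.tensRight fun η => interp A η).comp ((hg.tensLeft fun η => ctx Δ η).comp
        (unif_splitCtx Γ Δ)), fun η => ⟨_, _, hgd η, hhd η, fun x d => ?_⟩⟩
    simp only [splitCtx_joinCtx]
    rfl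
  | @lolliL Γ Δ A B D π ρ ih ih' =>
    obtain ⟨g, hg, hgd⟩ := ih (hπ.imp_right And.left)
    obtain ⟨h, hh, hhd⟩ := ih' (hπ.imp_right And.right)
    have h1 : Unif (I := Env M C) (fun η => tensorSpace (tensorSpace (interp A η) (ctx Δ η))
        (lolliSpace (interp A η) (interp B η))) (fun η => tensorSpace (ctx Δ η) (interp B η))
        fun _ x => (x.1.2, x.2.1 x.1.1) :=
      Unif.swap.comp ((Unif.eval.tensLeft fun η => ctx Δ η).comp (Unif.assl.comp Unif.swap))
    refine ⟨fun η x => h η ((splitCtx Δ x.1).2, x.2.1 (g η (splitCtx Δ x.1).1)),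
      hh.comp (h1.comp ((((hg.tensLeft fun η => ctx Δ η).comp (unif_splitCtx Γ Δ)).tensLeft _))),
      fun η => ⟨_, _, hgd η, hhd η, fun x d f => ?_⟩⟩
    simp only [splitCtx_joinCtx]
  | lolliR π ih =>
    obtain ⟨g, hg, hgd⟩ := ih hπ
    obtain ⟨f, hf, hf2⟩ := Unif.curry hg
    exact ⟨f, hf2, fun η => ⟨_, hgd η, fun x a => hf η x a⟩⟩
  | @allL Γ A B D π ih =>
    obtain ⟨g, hg, hgd⟩ := ih hπ
    -- The isomorphism depends on `η`, but it preserves realizers, so the identity code realizes all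
    -- of these maps.
    choose e he using fun η : Env M C => Iso.inst A D η
    have h1 : Unif (I := Env M C) (fun η => interp (.all A) η)
        (fun η => interp (Formula.inst A D) η) fun η a => e η (a.1 (canon (interp D η))) :=
      Unif.of_rel_self fun η α d a h => (he η _ _ _).1 (h _)
    exact ⟨fun η x => g η (x.1, e η (x.2.1 (canon (interp D η)))),
      hg.comp (h1.tensRight fun η => ctx Γ η), fun η => ⟨_, hgd η, fun x a =>
        ⟨e η (a.1 (canon (interp D η))), fun α d => he η α d _, rfl⟩⟩⟩
  | @allR Γ A π ih =>
    obtain hM' := hπ.resolve_right fun h => h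
    obtain ⟨g, hg, hgd⟩ := ih (.inl hM')
    -- The spaces of the shifted context are equal to the original ones. Treating the equality as an
    -- isomorphism gives a map with an identity code and avoids transports.
    choose e he using fun p : Env M C × SmallSpace M.toResourceMonoid C =>
      Iso.of_eq (ctx_map_shift Γ p.2.toLengthSpace p.1).symm
    have h1 : Unif (I := Env M C × SmallSpace M.toResourceMonoid C) (fun p => ctx Γ p.1)
        (fun p => ctx (Γ.map Formula.shift) (Env.cons p.2.toLengthSpace p.1)) fun p a => e p a :=
      Unif.of_rel_self fun p α d a h => (he p _ _ _).1 h
    obtain ⟨f, hf, hf2⟩ := Unif.forallGen hM' (A := fun η => ctx Γ η)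
      (T := fun η S => interp A (Env.cons S.toLengthSpace η)) ((hg.reindex fun p :
      Env M C × SmallSpace M.toResourceMonoid C => Env.cons p.2.toLengthSpace p.1).comp h1)
    exact ⟨f, hf2, fun η S => ⟨_, hgd _, fun x => ⟨e (η, S) x, fun α d => he (η, S) α d x,
      hf η x S⟩⟩⟩
  | secP π ih =>
    obtain ⟨g, hg, hgd⟩ := ih hπ
    exact ⟨fun η x => g η (unmodal _ _ x), (hg.secMap hM).comp (unif_unmodal hM _ _), fun η =>
      ⟨_, hgd η, fun _ => rfl⟩⟩
  | @bangP1 A B π ih =>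
    obtain hM' := hπ.resolve_right fun h => h
    obtain ⟨g, hg, hgd⟩ := ih (.inl hM')
    obtain ⟨d, -⟩ := C.ident
    obtain ⟨α, hα⟩ := ResourceMonoid.exists_le_norm (M := M.toResourceMonoid) (C.size d)
    have h1 : Unif (I := Env M C) (fun η => interp A η) (fun η => ctx [A] η)
        fun _ a => ((), a) :=
      Unif.swap.comp (Unif.pairPoint (B := fun _ => unitSpace M.toResourceMonoid C)
        (a := fun _ => ()) fun _ => hα)
    exact ⟨fun η x => g η ((), x.2), ((hg.comp h1).bangMap hM').comp Unif.snd, fun η =>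
      ⟨_, hgd η, fun _ => rfl⟩⟩
  | bangP2 π ih =>
    obtain ⟨g, hg, hgd⟩ := ih hπ
    exact ⟨g, hg.bangPoint, fun η => ⟨_, hgd η, fun _ => rfl⟩⟩
  | @contr Γ A B π ih =>
    obtain ⟨g, hg, hgd⟩ := ih hπ
    exact ⟨fun η x => g η ((x.1, x.2), x.2),
      hg.comp (Unif.assl.comp ((Unif.bangContr hM).tensRight fun η => ctx Γ η)),
      fun η => ⟨_, hgd η, fun _ _ => rfl⟩⟩

end Denotations

end LAL

namespace LAL

/-! ### Realizers of words -/

namespace CompModel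

/-- `e` applied to `x` yields `y` in time at most `t`. -/
def Ev (C : CompModel) (e x y : C.L) (t : ℕ) : Prop := y ∈ C.app e x ∧ C.time e x ≤ t

variable {C : CompModel}

theorem Ev.of_some {e x y : C.L} {t : ℕ} (h : C.app e x = Part.some y ∧ C.time e x ≤ t) :
    C.Ev e x y t := ⟨by rw [h.1]; exact Part.mem_some y, h.2⟩

theorem Ev.mono {e x y : C.L} {s t : ℕ} (h : C.Ev e x y s) (hst : s ≤ t) : C.Ev e x y t :=
  ⟨h.1, h.2.trans hst⟩

theorem Ev.comp {c s t : ℕ} {x y z w v u : C.L} (hz : C.IsComp c x y z) (h : C.Ev x w v s)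
    (h2 : C.Ev y v u t) : C.Ev z w u (s + t + c) := by
  obtain ⟨h3, h4⟩ := hz.mem h.1 h2.1
  have := h.2
  have := h2.2
  exact ⟨h3, by omega⟩

theorem exists_ev_comp (C : CompModel) : ∃ e c, ∀ x y, ∃ z, C.Ev e (C.pair x y) z c ∧
    C.IsComp c x y z := by
  obtain ⟨e, c, he⟩ := C.comp
  refine ⟨e, c, fun x y => ?_⟩
  obtain ⟨z, h1, h2, h3⟩ := he x y
  exact ⟨z, .of_some ⟨h1, h2⟩, h3⟩

/-- The map that sends `f j` to `g j` is realized in bounded time. -/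
def Fast (C : CompModel) {J : Type*} (f g : J → C.L) : Prop := ∃ e c, ∀ j, C.Ev e (f j) (g j) c

namespace Fast

variable {J : Type*} {f g h : J → C.L}

theorem trans (hf : C.Fast f g) (hg : C.Fast g h) : C.Fast f h := by
  obtain ⟨k, c, hk⟩ := C.exists_ev_comp
  obtain ⟨x, s, hx⟩ := hf
  obtain ⟨y, t, hy⟩ := hg
  obtain ⟨z, -, hz⟩ := hk x y
  exact ⟨z, _, fun j => (hx j).comp hz (hy j)⟩

theorem reindex {K : Type*} (hf : C.Fast f g) (r : K → J) :
    C.Fast (fun k => f (r k)) fun k => g (r k) := by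
  obtain ⟨e, c, h⟩ := hf
  exact ⟨e, c, fun k => h (r k)⟩

theorem pairConst (f : J → C.L) (x : C.L) : C.Fast f fun j => C.pair (f j) x := by
  obtain ⟨e, c, h⟩ := C.tensConst x
  exact ⟨e, c, fun j => .of_some (h (f j))⟩

theorem swap (f g : J → C.L) :
    C.Fast (fun j => C.pair (f j) (g j)) fun j => C.pair (g j) (f j) := by
  obtain ⟨e, c, h⟩ := C.swap
  exact ⟨e, c, fun j => .of_some (h (f j) (g j))⟩

theorem snd (f g : J → C.L) : C.Fast (fun j => C.pair (f j) (g j)) g := by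
  obtain ⟨e, c, h⟩ := C.throwFirst
  exact ⟨e, c, fun j => .of_some (h (f j) (g j))⟩

theorem tens (hf : C.Fast f g) (h : J → C.L) :
    C.Fast (fun j => C.pair (f j) (h j)) fun j => C.pair (g j) (h j) := by
  obtain ⟨e, c, ht⟩ := C.tens
  obtain ⟨x, s, hx⟩ := hf
  obtain ⟨y, -, -, -, hy⟩ := ht x
  refine ⟨y, s + c, fun j => ⟨?_, ?_⟩⟩
  · rw [(hy (f j) (h j)).1]
    exact Part.mem_map _ (hx j).1
  · have h1 := (hy (f j) (h j)).2 _ (hx j).1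
    have h2 := (hx j).2
    change C.time y (C.pair (f j) (h j)) ≤ s + c
    omega

end Fast

/-- The component of a pair that belongs to a letter. -/
theorem fast_proj (C : CompModel) (b : Bool) :
    C.Fast (fun r : Bool → C.L => C.pair (r false) (r true)) fun r => r b := by
  cases b
  · exact (Fast.swap _ _).trans (Fast.snd _ _)
  · exact Fast.snd _ _

end CompModel

open CompModel ResourceMonoid

theorem Realizes.mono {M : ResourceMonoid} {C : CompModel} {A B : LengthSpace M C}
    {φ ψ : M.Carrier} {e : C.L} {f : A.Carrier → B.Carrier} (h : Realizes A B φ e f)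
    (hl : M.le φ ψ) : Realizes A B ψ e f :=
  (lolliSpace A B).isLengthSpace.mono (a := ⟨f, φ, e, h⟩) h hl

theorem exists_realizes_id (M : ResourceMonoid) (C : CompModel) {e : C.L} {c : ℕ}
    (he : ∀ x, C.app e x = Part.some x ∧ C.time e x ≤ c) :
    ∃ κ : M.Carrier, ∀ A : LengthSpace M C, Realizes A A κ e fun a => a := by
  obtain ⟨φ, h1, h2⟩ := exists_cover (M := M) (c + C.size e) 0
  refine ⟨φ, fun A => ⟨by omega, fun α d a ha => ?_⟩⟩
  obtain ⟨h3, h4⟩ := Ev.of_some (he d)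
  obtain ⟨h5, h6⟩ := h2 α α (C.time e d) (le_of_eq (zero_add α).symm) (by omega)
  exact ⟨α, d, ha, h5, h3, h6⟩

/-- Realizers `x w` of the maps that send two endomorphisms to their composition along `w`. -/
theorem exists_word_codes (C : CompModel) : ∃ (d : Bool → C.L) (c : ℕ) (x : List Bool → C.L),
    (∀ w b, C.Ev (d b) (x w) (x (w ++ [b])) c) ∧ (∀ w, C.size (x w) ≤ c * (w.length + 1)) ∧
    ∀ M : ResourceMonoid, ∃ κ : M.Carrier, ∀ (w : List Bool) (r : Bool → C.L), ∃ y,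
      C.Ev (x w) (C.pair (r false) (r true)) y
        (c * (w.length + 1) * (C.size (r false) + C.size (r true) + 1)) ∧
      ∀ (S : LengthSpace M C) (z : Bool → S.Carrier → S.Carrier) (a : Bool → M.Carrier),
        (∀ b, Realizes S S (a b) (r b) (z b)) →
        Realizes S S ((w.length + 1) • κ + (w.map a).sum) y fun s => w.foldr z s := by
  obtain ⟨ec, kc, hc⟩ := C.exists_ev_comp
  choose comp hcomp hcomp2 using hc
  obtain ⟨et, kt, ht⟩ := C.tens
  choose tens ht1 ht2 ht3 ht4 using ht
  obtain ⟨ei, ki, hi⟩ := C.ident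
  obtain ⟨x₀, k₀, hx₀⟩ := C.const ei
  obtain ⟨ed, kd, hd⟩ := C.contr
  -- Given a code and the pair of the two letter codes, select the one for `b` and compose it in
  -- front of the given code.
  have hpost : ∀ b, C.Fast (J := C.L × (Bool → C.L))
      (fun j => C.pair j.1 (C.pair (j.2 false) (j.2 true))) fun j => comp (j.2 b) j.1 := by
    intro b
    refine (Fast.swap _ _).trans (((((fast_proj C b).reindex Prod.snd).tens _)).trans ?_)
    exact ⟨ec, kc, fun j => hcomp _ _⟩
  choose post kp hp using hpost
  -- Duplicate the pair of letter codes, run `x` on one copy to get the code for `w`, and use the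
  -- other copy to compose with the code of the new letter `b`. That letter is last in `w ++ [b]`,
  -- so its function acts first.
  let step : Bool → C.L → C.L := fun b x => comp ed (comp (tens x) (post b))
  have hstep : ∀ b, C.Fast (fun x : C.L => x) (step b) := by
    intro b
    have h1 : C.Fast (fun x : C.L => x) tens := ⟨et, kt, fun x => .of_some ⟨ht1 x, ht2 x⟩⟩
    have h2 : C.Fast (fun x => C.pair (tens x) (post b)) fun x => comp (tens x) (post b) :=
      ⟨ec, kc, fun x => hcomp _ _⟩
    have h3 : C.Fast (fun x => C.pair ed (comp (tens x) (post b))) (step b) :=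
      ⟨ec, kc, fun x => hcomp _ _⟩
    exact (((h1.trans (Fast.pairConst _ (post b))).trans h2).trans
      ((Fast.pairConst _ ed).trans (Fast.swap _ _))).trans h3
  choose d ks hs using hstep
  let x : List Bool → C.L := fun w => w.foldl (fun x b => step b x) x₀
  have hx : ∀ w b, x (w ++ [b]) = step b (x w) := fun w b => by simp [x]
  -- Per letter the time grows by at most `K * (s + 1)`, where `s` is the total length of the two
  -- letter codes. Only the duplication depends on `s`; the other summands are overheads of
  -- composing.
  let K := kd * (C.cp + 1) + kt + kp false + kp true + 2 * kc
  let c := K + k₀ + ks false + ks true + C.size x₀ + C.size ed + C.size (post false) +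
    C.size (post true) + kt + 2 * kc
  refine ⟨d, c, x, fun w b => ?_, fun w => ?_, fun M => ?_⟩
  · rw [hx]
    exact (hs b (x w)).mono (by cases b <;> omega)
  · induction w using List.reverseRecOn with
    | nil =>
      change C.size x₀ ≤ c * (0 + 1)
      omega
    | append_singleton w b ih =>
      rw [hx, List.length_append, List.length_singleton, Nat.mul_succ]
      have h1 := (hcomp2 ed (comp (tens (x w)) (post b))).1
      have h2 := (hcomp2 (tens (x w)) (post b)).1
      have h3 := ht3 (x w)
      have h4 : C.size (post b) ≤ C.size (post false) + C.size (post true) := by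
        cases b <;> omega
      change C.size (comp ed (comp (tens (x w)) (post b))) ≤ _
      omega
  · obtain ⟨κ₁, hκ₁⟩ := exists_realizes_id M C hi
    obtain ⟨κ₂, hκ₂⟩ := exists_realizes_comp M C kc
    refine ⟨κ₁ + κ₂, fun w r => ?_⟩
    set s := C.size (r false) + C.size (r true) with hsdef
    suffices h : ∃ y, C.Ev (x w) (C.pair (r false) (r true)) y (k₀ + w.length * (K * (s + 1))) ∧
        ∀ (S : LengthSpace M C) (z : Bool → S.Carrier → S.Carrier) (a : Bool → M.Carrier),
        (∀ b, Realizes S S (a b) (r b) (z b)) →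
        Realizes S S ((w.length + 1) • (κ₁ + κ₂) + (w.map a).sum) y fun s => w.foldr z s by
      obtain ⟨y, hy, hy2⟩ := h
      refine ⟨y, hy.mono ?_, hy2⟩
      have h1 : (K + k₀) * (w.length + 1) * (s + 1) ≤ c * (w.length + 1) * (s + 1) :=
        Nat.mul_le_mul_right _ (Nat.mul_le_mul_right _ (by omega))
      refine le_trans ?_ h1
      nlinarith [Nat.zero_le (k₀ * w.length), Nat.zero_le (k₀ * w.length * s),
        Nat.zero_le (k₀ * s), Nat.zero_le (K * s)]
    induction w using List.reverseRecOn with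
    | nil =>
      refine ⟨ei, (Ev.of_some (hx₀ _)).mono (by simp), fun S z a ha => (hκ₁ S).mono ?_⟩
      rw [List.length_nil, zero_add, one_nsmul, List.map_nil, List.sum_nil, add_zero]
      exact le_add_right _ _
    | append_singleton w b ih =>
      obtain ⟨y, hy, hy2⟩ := ih
      set p := C.pair (r false) (r true) with hpdef
      have e1 : C.Ev ed p (C.pair p p) (kd * (C.size p + 1)) := .of_some (hd p)
      have e2 : C.Ev (tens (x w)) (C.pair p p) (C.pair y p)
          (k₀ + w.length * (K * (s + 1)) + kt) := by
        obtain ⟨h1, h2⟩ := ht4 (x w) p p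
        refine ⟨?_, ?_⟩
        · rw [h1]
          exact Part.mem_map _ hy.1
        · have := h2 y hy.1
          have := hy.2
          omega
      have e3 := hp b (y, r)
      have e4 := e1.comp (hcomp2 ed (comp (tens (x w)) (post b)))
        (e2.comp (hcomp2 (tens (x w)) (post b)) e3)
      refine ⟨comp (r b) y, ?_, fun S z a ha => ?_⟩
      · rw [hx]
        refine e4.mono ?_
        rw [List.length_append, List.length_singleton, hpdef, C.size_pair, ← hsdef]
        have h1 : kp b ≤ kp false + kp true := by cases b <;> omega
        have h2 : K * (s + 1) = K + K * s := by ring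
        have h3 : kd * s ≤ K * s := Nat.mul_le_mul_right _ (by
          have : kd * 1 ≤ kd * (C.cp + 1) := Nat.mul_le_mul_left _ (by omega)
          omega)
        have h4 : kd * (s + C.cp + 1) = kd * s + kd * (C.cp + 1) := by ring
        rw [Nat.succ_mul]
        omega
      · have h1 := (hκ₂ (hcomp2 (r b) y) (ha b) (hy2 S z a ha))
        simp only [List.foldr_append, List.foldr_cons, List.foldr_nil]
        refine h1.mono ?_
        rw [List.length_append, List.length_singleton, List.map_append, List.sum_append,
          List.map_singleton, List.sum_singleton, succ_nsmul (κ₁ + κ₂) (w.length + 1)]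
        rw [show (w.length + 1) • (κ₁ + κ₂) + (κ₁ + κ₂) + ((w.map a).sum + a b) =
          κ₁ + (κ₂ + (a b + ((w.length + 1) • (κ₁ + κ₂) + (w.map a).sum))) by abel]
        exact le_add_left _ _

/-! ### The denotations of the proofs that represent words -/

section Words

variable {M : LightMonoid} {C : CompModel}

/-- One endomorphism for each letter. -/
def letterVals {η : Env M C} (z : Bool → Hom (η 0) (η 0)) :
    (w : List Bool) → (ctx ((letters w).map .bang ++ []) η).Carrier
  | [] => ()
  | b :: w => (letterVals z w, z b)

/-- Each contraction feeds one of the two list arguments to another letter, so the hypotheses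
receive the values `letterVals z w`. -/
theorem denotes_collect {η : Env M C} (z : Bool → Hom (η 0) (η 0)) {A : Formula} (w : List Bool)
    (π : Proof (.bang endo :: .bang endo :: ((letters w).map .bang ++ [])) A)
    {F : Hom (ctx [.bang endo, .bang endo] η) (interp A η)} (hF : Denotes (collect w π) η F) :
    ∃ G, Denotes π η G ∧
      F.1 (((), z false), z true) = G.1 ((letterVals z w, z false), z true) := by
  induction w with
  | nil => exact ⟨F, hF, rfl⟩
  | cons b w ih =>
    cases b
    · obtain ⟨G1, ⟨G2, ⟨G3, ⟨G4, ⟨G5, h5, e5⟩, e4⟩, e3⟩, e2⟩, e1⟩ := ih _ hF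
      exact ⟨G5, h5, e1.trans ((e2 _).trans ((e3 _ _).trans ((e4 _).trans (e5 _))))⟩
    · obtain ⟨G1, ⟨G2, ⟨G3, h3, e3⟩, e2⟩, e1⟩ := ih _ hF
      exact ⟨G3, h3, e1.trans ((e2 _ _).trans (e3 _))⟩

/-- The head of `w` belongs to the last application of the left rule, hence its function is applied
last; this is the order of `foldr`. -/
theorem denotes_iterProof {η : Env M C} (z : Bool → Hom (η 0) (η 0)) (w : List Bool)
    {F : Hom (ctx (.var 0 :: (letters w ++ [])) η) (interp (.var 0) η)}
    (hF : Denotes (iterProof w) η F) (s : (η 0).Carrier) :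
    F.1 (unmodal [] (letters w) (letterVals z w), s) = w.foldr (fun b => (z b).1) s := by
  induction w with
  | nil => exact hF _
  | cons b w ih =>
    obtain ⟨G1, ⟨G2, G3, h2, h3, e1⟩, e0⟩ := hF
    refine (e0 _).trans ((e1 (unmodal [] (letters w) (letterVals z w), s) () (z b)).trans
      ((h3 _).trans ?_))
    exact congrArg (z b).1 (ih h2)

theorem denotes_word {η : Env M C} (z : Bool → Hom (η 0) (η 0)) (w : List Bool)
    {F : Hom (ctx [] η) (interp (.lolli (.bang endo) (.lolli (.bang endo) (.sec endo))) η)}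
    (hF : Denotes (.lolliR (.lolliR (collect w
      (.weak _ (.weak _ (.secP (Γ := []) (Δ := letters w) (.lolliR (iterProof w)))))))) η F)
    (s : (η 0).Carrier) :
    (((F.1 ()).1 (z false)).1 (z true)).1 s = w.foldr (fun b => (z b).1) s := by
  obtain ⟨G1, ⟨G2, h2, e2⟩, e1⟩ := hF
  obtain ⟨G3, ⟨G4, ⟨G5, ⟨G6, ⟨G7, h7, e7⟩, e6⟩, e5⟩, e4⟩, e3⟩ := denotes_collect z w _ h2
  have h : ((F.1 ()).1 (z false)).1 (z true) = G6.1 (unmodal [] (letters w) (letterVals z w)) :=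
    (congrArg (fun q : Hom (bangSpace (interp endo η)) (secSpace (interp endo η)) =>
      q.1 (z true)) (e1 () (z false))).trans
      ((e2 _ _).trans (e3.trans ((e4 _).trans ((e5 _).trans (e6 _)))))
  exact (congrArg (fun q : Hom (η 0) (η 0) => q.1 s) h).trans
    ((e7 _ _).trans (denotes_iterProof z w h7 s))

theorem plain_collect {A : Formula} (w : List Bool)
    (π : Proof (.bang endo :: .bang endo :: ((letters w).map .bang ++ [])) A) (h : π.Plain) :
    (collect w π).Plain := by
  induction w with
  | nil => exact h
  | cons b w ih =>
    cases b
    · exact ih _ h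
    · exact ih _ h

theorem plain_iterProof (w : List Bool) : (iterProof w).Plain := by
  induction w with
  | nil => trivial
  | cons b w ih => exact ⟨ih, trivial⟩

end Words

end LAL

namespace LAL

open CompModel ResourceMonoid

/-! ### Realizers and majorizers of the lists -/

section ListRealizers

variable {M : LightMonoid} {C : CompModel}

/-- The premise of the last rule of `listProof`. -/
def listBody (w : List Bool) :
    Proof [] (.lolli (.bang endo) (.lolli (.bang endo) (.sec endo))) :=
  .lolliR (.lolliR (collect w
    (.weak _ (.weak _ (.secP (Γ := []) (Δ := letters w) (.lolliR (iterProof w)))))))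

theorem plain_listBody (w : List Bool) : (listBody w).Plain :=
  plain_collect w _ (plain_iterProof w)

/-- The proofs that represent strings are denoted by elements with realizers that are computed step
by step and with majorizers of polynomial size. -/
theorem exists_list_realizers (hM : Grounded M) (C : CompModel) :
    ∃ (d : Bool → C.L) (e : C.L) (c : ℕ) (x y : List Bool → C.L) (θ : ℕ → M.Carrier),
      (∀ w b, C.Ev (d b) (x w) (x (w ++ [b])) c) ∧
      (∀ w, C.size (x w) ≤ c * (w.length + 1)) ∧
      (∀ w, C.Ev e (x w) (y w) c) ∧
      Tree.PolyFamily (fun n => hM.maj (θ n)) ∧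
      ∀ (η : Env M C) w, ∃ l, IsDenotation (listProof w) η l ∧
        (interp listLAL η).rel (θ w.length) (y w) l := by
  obtain ⟨d, c, x, hstep, hsize, hword⟩ := exists_word_codes C
  obtain ⟨κ, hκ⟩ := hword M.toResourceMonoid
  obtain ⟨e, k, he⟩ := C.curry
  choose y hy1 hy2 hy3 hy4 using fun w => he (x w)
  -- The constant `c` pays for running `x w`. The summand `2 * k` covers the two increments of
  -- length in currying and the overhead when the second argument arrives; `τ` below pays for the
  -- first argument.
  obtain ⟨α, hα, hα2, hα3⟩ := hM.word κ (c + 2 * k)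
  obtain ⟨τ, hτ⟩ := exists_le_norm (M := M.toResourceMonoid) k
  have hsz : ∀ w : List Bool, C.size (x w) + 2 * k ≤ M.norm (α w.length) := by
    intro w
    refine le_trans ?_ (hα2 w.length)
    have := hsize w
    rw [Nat.add_mul]
    have : 2 * k * 1 ≤ 2 * k * (w.length + 1) := Nat.mul_le_mul_left _ (by omega)
    omega
  refine ⟨d, e, c + k, x, y, fun n => τ + α n, fun w b => (hstep w b).mono (by omega),
    fun w => (hsize w).trans (Nat.mul_le_mul_right _ (by omega)),
    fun w => (Ev.of_some ⟨hy1 w, hy2 w⟩).mono (by omega), ?_, fun η w => ?_⟩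
  · simp only [hM.maj_add]
    exact (Tree.polyFamily_const _).add hα
  obtain ⟨f, hf, hfd⟩ := exists_denotes (C := C) hM (listBody w) (.inr (plain_listBody w))
  -- This takes the place of the quantifier rule and holds also over plain trees: neither `y w` nor
  -- `τ + α w.length` involves `S`.
  have hrel : ∀ S : SmallSpace M.toResourceMonoid C,
      (interp (.lolli (.bang endo) (.lolli (.bang endo) (.sec endo)))
        (Env.cons S.toLengthSpace η)).rel (τ + α w.length) (y w)
        (f (Env.cons S.toLengthSpace η) ()) := by
    intro S
    have hn := norm_add τ (α w.length)
    have := hsz w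
    refine ⟨by have := hy3 w; omega, ?_⟩
    rintro σ₀ r₀ z₀ ⟨β₀, hr₀, hβ₀⟩
    obtain ⟨u, hu1, hu2, hu3, hu4⟩ := hy4 w r₀
    have hs0 : C.size r₀ ≤ M.norm β₀ := hr₀.1
    have hs0' : M.norm β₀ ≤ M.norm σ₀ := (M.norm_le_bang β₀).trans (norm_mono hβ₀)
    refine ⟨α w.length + σ₀, u, ⟨?_, ?_⟩, ?_, by rw [hu1]; exact Part.mem_some u, ?_⟩
    · have := norm_add (α w.length) σ₀
      have := hy3 w
      omega
    · rintro σ₁ r₁ z₁ ⟨β₁, hr₁, hβ₁⟩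
      have hs1 : C.size r₁ ≤ M.norm β₁ := hr₁.1
      let z : Bool → Hom S.toLengthSpace S.toLengthSpace := fun b => cond b z₁ z₀
      let a : Bool → M.Carrier := fun b => cond b β₁ β₀
      obtain ⟨v, hv, hv2⟩ := hκ w fun b => cond b r₁ r₀
      have hz : ∀ b, Realizes S.toLengthSpace S.toLengthSpace (a b) (cond b r₁ r₀) (z b).1 := by
        intro b
        cases b
        · exact hr₀
        · exact hr₁
      have hv3 := hv2 S.toLengthSpace (fun b => (z b).1) a hz
      obtain ⟨h1, h2⟩ := hα3 a w
      have h3 : M.le (α w.length + M.bang β₀ + M.bang β₁) (α w.length + σ₀ + σ₁) :=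
        add_le_add' (add_le_add_left _ hβ₀) hβ₁
      obtain ⟨h4, h5⟩ := hu4 r₁
      refine ⟨_, v, ⟨_, ?_, M.le_refl _⟩, M.le_trans h1 h3, by rw [h4]; exact hv.1, ?_⟩
      · have hd := denotes_word (η := Env.cons S.toLengthSpace η) z w
          (hfd (Env.cons S.toLengthSpace η))
        exact (congrArg (Realizes S.toLengthSpace S.toLengthSpace _ v) (funext hd)).mpr hv3
      · refine le_trans ?_ (h2.trans (dist_mono h1 h3))
        refine (h5 v hv.1).trans ((Nat.add_le_add_right hv.2 k).trans ?_)
        change c * (w.length + 1) * (C.size r₀ + C.size r₁ + 1) + k ≤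
          (c + 2 * k) * (w.length + 1) * (M.norm β₀ + M.norm β₁ + 1)
        have h6 : c * (w.length + 1) * (C.size r₀ + C.size r₁ + 1) ≤
            c * (w.length + 1) * (M.norm β₀ + M.norm β₁ + 1) :=
          Nat.mul_le_mul_left _ (by omega)
        have h7 : k * 1 * 1 ≤ 2 * k * (w.length + 1) * (M.norm β₀ + M.norm β₁ + 1) :=
          Nat.mul_le_mul (Nat.mul_le_mul (by omega) (by omega)) (by omega)
        rw [Nat.add_mul, Nat.add_mul]
        omega
    · rw [add_assoc]
      exact le_add_left _ _
    · refine hu2.trans (hτ.trans ?_)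
      rw [add_assoc]
      exact (Nat.le_add_left _ _).trans (dist_add_norm_le (M.le_refl _) τ)
  let l : (interp listLAL η).Carrier := ⟨fun S => f (Env.cons S.toLengthSpace η) (), _, _, hrel⟩
  have hl : Unif (I := Unit) (fun _ => ctx [] η) (fun _ => interp listLAL η) fun _ _ => l :=
    Unif.ofPoint (α := τ + α w.length) (x := y w) fun _ => hrel
  exact ⟨l, ⟨⟨fun _ => l, hl.hom ()⟩,
    fun S => ⟨_, hfd _, fun _ => ⟨(), fun _ _ => Iff.rfl, rfl⟩⟩, rfl⟩, hrel⟩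

end ListRealizers

/-! ### Modalities -/

/-- A word of modalities as an operation on majorizers. -/
def LightMonoid.mods (M : LightMonoid) : List Modality → M.Carrier → M.Carrier
  | [], a => a
  | .bang :: m, a => M.bang (mods M m a)
  | .sec :: m, a => M.sec (mods M m a)

namespace Tree

/-- A word of modalities as an operation on trees. -/
def mods : List Modality → Tree → Tree
  | [], a => a
  | .bang :: m, a => bang (mods m a)
  | .sec :: m, a => sec (mods m a)

theorem norm_le_mods (m : List Modality) (t : Tree) : dist 0 t ≤ dist 0 (mods m t) := by
  induction m with
  | nil => exact le_rfl
  | cons q m ih =>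
    cases q
    · exact ih.trans (norm_bang _)
    · exact ih.trans (norm_sec _)

/-- A fixed summand leaves each modality at the price of another fixed tree: by additivity for `§`,
and by `exists_bang_add_le` for `!`. Reading off below `Q₂` needs this. -/
theorem exists_mods_add_le (m : List Modality) (s : Tree) :
    ∃ s', ∀ t, le (mods m (t + s)) (s' + mods m t) := by
  induction m with
  | nil => exact ⟨s, fun t => by rw [mods, mods, add_comm]; exact le_refl' _⟩
  | cons q m ih =>
    obtain ⟨r, hr⟩ := ih
    cases q
    · obtain ⟨s', hs'⟩ := exists_bang_add_le r
      refine ⟨s', fun t => (le_trans' (bang_le_bang (hr t)) ?_).1⟩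
      rw [add_comm r]
      exact hs' _
    · exact ⟨sec r, fun t => by
        have := (sec_le_sec (hr t)).1
        rwa [sec_add] at this⟩

theorem PolyFamily.mods {T : ℕ → Tree} (hT : PolyFamily T) (m : List Modality) :
    PolyFamily fun n => Tree.mods m (T n) := by
  induction m with
  | nil => exact hT
  | cons q m ih =>
    cases q
    · exact ih.bang
    · exact ih.sec

end Tree

section Mods

variable {M : LightMonoid} {C : CompModel} {η : Env M C} {A : Formula}

theorem Grounded.maj_mods (hM : Grounded M) (m : List Modality) (a : M.Carrier) :
    hM.maj (M.mods m a) = Tree.mods m (hM.maj a) := by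
  induction m with
  | nil => rfl
  | cons q m ih =>
    cases q
    · exact (hM.maj_bang _).trans (congrArg _ ih)
    · exact (hM.maj_sec _).trans (congrArg _ ih)

theorem rel_addMods (m : List Modality) {α : M.Carrier} {e : C.L} {a : (interp A η).Carrier}
    (h : (interp A η).rel α e a) : (interp (mods m A) η).rel (M.mods m α) e (addMods m a) := by
  induction m with
  | nil => exact h
  | cons q m ih =>
    cases q
    · exact ⟨_, ih, M.le_refl _⟩
    · exact ⟨_, ih, M.le_refl _⟩

/-- The majorizer of the stripped element is remembered through its tree, which stays below the
original one once the modalities are put back. -/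
theorem rel_stripMods (hM : Grounded M) (m : List Modality) {α : M.Carrier} {e : C.L}
    {a : (interp (mods m A) η).Carrier} (h : (interp (mods m A) η).rel α e a) :
    ∃ β, (interp A η).rel β e (stripMods m a) ∧ Tree.le (Tree.mods m (hM.maj β)) (hM.maj α) := by
  induction m generalizing α with
  | nil => exact ⟨α, h, Tree.le_refl' _⟩
  | cons q m ih =>
    cases q
    · obtain ⟨u, hu, hl⟩ := h
      obtain ⟨β, hβ, hl2⟩ := ih hu
      have h1 := hM.maj_le hl
      rw [hM.maj_bang] at h1
      exact ⟨β, hβ, (Tree.le_trans' (Tree.bang_le_bang hl2) h1).1⟩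
    · obtain ⟨u, hu, hl⟩ := h
      obtain ⟨β, hβ, hl2⟩ := ih hu
      have h1 := hM.maj_le hl
      rw [hM.maj_sec] at h1
      exact ⟨β, hβ, (Tree.le_trans' (Tree.sec_le_sec hl2).1 h1).1⟩

end Mods

/-! ### Reading off strings -/

/-- Application to a fixed argument. -/
theorem CompModel.exists_apply_to (C : CompModel) (r : C.L) : ∃ e c, ∀ x y t, C.Ev x r y t →
    C.Ev e x y (t + c) := by
  obtain ⟨k, a, hk⟩ := C.exists_ev_comp
  obtain ⟨p, b, hp⟩ := C.tensConst r
  obtain ⟨q, c, hq⟩ := C.eval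
  obtain ⟨e, -, he⟩ := hk p q
  refine ⟨e, b + c + a, fun x y t h => ?_⟩
  have h1 : C.Ev q (C.pair x r) y (t + c) := by
    refine ⟨by rw [(hq x r).1]; exact h.1, ?_⟩
    have := (hq x r).2 y h.1
    have := h.2
    omega
  exact ((Ev.of_some (hp x)).comp he h1).mono (by omega)

section Reading

variable {M : LightMonoid} {C : CompModel} {η : Env M C}

theorem str_injective : Function.Injective (str M C) := by
  intro v w h
  obtain ⟨α, hα⟩ := exists_le_norm (M := M.toResourceMonoid) (C.size (C.emb v))
  have h1 : C.emb v ∈ (str M C v).1 := ⟨α, rfl, hα⟩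
  rw [h] at h1
  obtain ⟨β, hβ, -⟩ := h1
  exact C.emb_injective hβ

theorem str_surjective : Function.Surjective (str M C) := by
  intro c
  obtain ⟨-, -, a, -, rfl⟩ := (binSmall M C).isLengthSpace.exists_rel c
  exact ⟨a, rfl⟩

theorem Reads.unique {l : (interp listLAL η).Carrier} {v v' : List Bool} (h : Reads l v)
    (h' : Reads l v') : v = v' := by
  obtain ⟨s₀, s₁, h0, h1, h2⟩ := h
  obtain ⟨t₀, t₁, h0', h1', h2'⟩ := h'
  have e0 : s₀ = t₀ := by
    refine Subtype.ext (funext fun c => ?_)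
    obtain ⟨w, rfl⟩ := str_surjective c
    rw [h0, h0']
  have e1 : s₁ = t₁ := by
    refine Subtype.ext (funext fun c => ?_)
    obtain ⟨w, rfl⟩ := str_surjective c
    rw [h1, h1']
  subst e0
  subst e1
  exact str_injective (h2.symm.trans h2')

/-- The functions that append a letter. -/
theorem exists_cons_hom (M : LightMonoid) (C : CompModel) (b : Bool) :
    ∃ (s : Hom (binSmall M C).toLengthSpace (binSmall M C).toLengthSpace) (φ : M.Carrier)
      (r : C.L), Realizes _ _ φ r s.1 ∧ ∀ w, s.1 (str M C w) = str M C (b :: w) := by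
  obtain ⟨c, hc⟩ := C.emb_cons
  obtain ⟨r, hr⟩ := hc b
  obtain ⟨κ, hκ⟩ := exists_le_norm (M := M.toResourceMonoid) c
  choose g hg using str_surjective (M := M) (C := C)
  have hg2 : ∀ w, g (str M C w) = w := fun w => str_injective (hg _)
  have h : Unif (I := Unit) (fun _ => (binSmall M C).toLengthSpace)
      (fun _ => (binSmall M C).toLengthSpace) fun _ w => str M C (b :: g w) := by
    refine Unif.of_step r c κ ?_
    rintro - α d - ⟨w, ⟨rfl, hw⟩, rfl⟩
    obtain ⟨h1, h2, h3⟩ := hr w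
    refine ⟨_, κ + α, by rw [h1]; exact Part.mem_some _, ⟨b :: w, ⟨rfl, ?_⟩, ?_⟩, M.le_refl _,
      by omega⟩
    · have := norm_add κ α
      omega
    · exact congrArg (fun v => str M C (b :: v)) (hg2 w)
  obtain ⟨φ, e, he⟩ := id h
  exact ⟨⟨_, h.hom ()⟩, φ, e, he (), fun w => congrArg (fun v => str M C (b :: v)) (hg2 w)⟩

/-- Strings are read off in time bounded by the majorizer. -/
theorem exists_reads (hM : Grounded M) (C : CompModel) : ∃ (σ : M.Carrier) (e : C.L) (c : ℕ),
    ∀ (η : Env M C) α x (l : (interp listLAL η).Carrier), (interp listLAL η).rel α x l →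
      ∃ v, Reads l v ∧ C.Ev e x (C.emb v) (3 * M.norm (α + σ) + c) := by
  obtain ⟨s₀, φ₀, r₀, hr₀, hs₀⟩ := exists_cons_hom M C false
  obtain ⟨s₁, φ₁, r₁, hr₁, hs₁⟩ := exists_cons_hom M C true
  obtain ⟨ε, hε⟩ := exists_le_norm (M := M.toResourceMonoid) (C.size (C.emb []))
  obtain ⟨a₀, c₀, ha₀⟩ := C.exists_apply_to r₀
  obtain ⟨a₁, c₁, ha₁⟩ := C.exists_apply_to r₁
  obtain ⟨a₂, c₂, ha₂⟩ := C.exists_apply_to (C.emb [])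
  obtain ⟨k, c, hk⟩ := C.exists_ev_comp
  obtain ⟨g, -, hg⟩ := hk a₁ a₂
  obtain ⟨e, -, he⟩ := hk a₀ g
  -- The three summands majorize the arguments. The third one is `sec ε` because the last
  -- application happens under `§`: the norm of `δ + ε` is at most that of `sec δ + sec ε`. Each of
  -- the three applications then takes time at most the norm of `α + σ`.
  refine ⟨M.bang φ₀ + M.bang φ₁ + M.sec ε, e, c₀ + c₁ + c₂ + 2 * c, fun η α x l hl => ?_⟩
  have hl' : Realizes (bangSpace (lolliSpace (binSmall M C).toLengthSpace
      (binSmall M C).toLengthSpace)) (lolliSpace (bangSpace (lolliSpace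
      (binSmall M C).toLengthSpace (binSmall M C).toLengthSpace)) (secSpace (lolliSpace
      (binSmall M C).toLengthSpace (binSmall M C).toLengthSpace))) α x
      (l.1 (binSmall M C)).1 := hl (binSmall M C)
  obtain ⟨β, u, hu, hβ, hu2, hu3⟩ := hl'.2 (M.bang φ₀) r₀ s₀ ⟨φ₀, hr₀, M.le_refl _⟩
  obtain ⟨γ, y, ⟨δ, hy, hδ⟩, hγ, hy2, hy3⟩ := hu.2 (M.bang φ₁) r₁ s₁ ⟨φ₁, hr₁, M.le_refl _⟩
  obtain ⟨ζ, z, ⟨v, ⟨rfl, -⟩, hv⟩, hz, hz2, hz3⟩ := hy.2 ε (C.emb []) (str M C [])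
    ⟨[], ⟨rfl, hε⟩, rfl⟩
  refine ⟨v, ⟨s₀, s₁, hs₀, hs₁, hv⟩, ?_⟩
  have dist_le : ∀ {a b : M.Carrier}, M.le a b → M.dist a b ≤ M.norm b := fun {a b} h =>
    (Nat.le_add_left _ _).trans (M.dist_triangle (M.zero_le a) h)
  have l1 : M.norm (α + M.bang φ₀) ≤ M.norm (α + (M.bang φ₀ + M.bang φ₁ + M.sec ε)) := by
    rw [add_assoc (M.bang φ₀), ← add_assoc α]
    exact norm_mono (le_add_right _ _)
  have h2 : M.le (β + M.bang φ₁) (α + M.bang φ₀ + M.bang φ₁) := M.add_le_add _ hβ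
  have l2 : M.norm (β + M.bang φ₁) ≤ M.norm (α + (M.bang φ₀ + M.bang φ₁ + M.sec ε)) := by
    rw [← add_assoc, ← add_assoc]
    exact norm_mono (M.le_trans h2 (le_add_right _ _))
  have l3 : M.norm (δ + ε) ≤ M.norm (α + (M.bang φ₀ + M.bang φ₁ + M.sec ε)) := by
    refine (M.norm_le_sec (δ + ε)).trans ?_
    rw [hM.sec_add, ← add_assoc, ← add_assoc]
    exact norm_mono (M.add_le_add _ (M.le_trans hδ (M.le_trans hγ h2)))
  have t1 := (ha₁ _ _ _ ⟨hy2, le_rfl⟩).comp hg (ha₂ _ _ _ ⟨hz2, le_rfl⟩)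
  refine ((ha₀ _ _ _ ⟨hu2, le_rfl⟩).comp he t1).mono ?_
  have := hu3.trans (dist_le hβ)
  have := hy3.trans (dist_le hγ)
  have := hz3.trans (dist_le hz)
  omega

/-! ### The induced function -/

/-- Every element of the interpretation of a formula on lists induces exactly one function, and this
function is computable in polynomial time. -/
theorem exists_induced (hM : Grounded M) {m₁ m₂ : List Modality}
    (F : (interp (.lolli (mods m₁ listLAL) (mods m₂ listLAL)) η).Carrier) :
    ∃ f : List Bool → List Bool, (∀ g, InducedBy F g ↔ g = f) ∧ PolyTime f := by
  obtain ⟨d, a, c, x, y, θ, hd, hx, hy, hθ, hl⟩ := exists_list_realizers hM C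
  obtain ⟨σ, e, k, he⟩ := exists_reads hM C
  obtain ⟨φ, r, hr⟩ := F.2
  obtain ⟨σ', hσ'⟩ := Tree.exists_mods_add_le m₂ (hM.maj σ)
  obtain ⟨P, hP⟩ := ((Tree.polyFamily_const (σ' + hM.maj φ)).add (hθ.mods m₁)).norm_le
  obtain ⟨q, b, hq⟩ := C.exists_ev_comp
  -- First apply `F`, then read off; the next line puts the currying in front. The code `s` thus
  -- leads from `x w` directly to the string.
  obtain ⟨r', -, hr'⟩ := hq r e
  obtain ⟨s, -, hs⟩ := hq a r'
  have key : ∀ w : List Bool, ∃ l v, IsDenotation (listProof w) η l ∧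
      Reads (stripMods m₂ (F.1 (addMods m₁ l))) v ∧
      C.Ev s (x w) (C.emb v) (4 * P.eval w.length + (c + k + 2 * b)) := by
    intro w
    obtain ⟨l, hl1, hl2⟩ := hl η w
    obtain ⟨β, z, hz, hβ, hz2, hz3⟩ := hr.2 _ _ _ (rel_addMods m₁ hl2)
    obtain ⟨γ, hγ, hγ2⟩ := rel_stripMods hM m₂ hz
    obtain ⟨v, hv, hv2⟩ := he η _ _ _ hγ
    refine ⟨l, v, hl1, hv, ((hy w).comp hs (Ev.comp hr' ⟨hz2, le_rfl⟩ hv2)).mono ?_⟩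
    have hβ' : Tree.le (hM.maj β) (hM.maj φ + Tree.mods m₁ (hM.maj (θ w.length))) := by
      have := hM.maj_le hβ
      rwa [hM.maj_add, hM.maj_mods] at this
    have h1 : Tree.le (hM.maj φ + Tree.mods m₁ (hM.maj (θ w.length)))
        (σ' + hM.maj φ + Tree.mods m₁ (hM.maj (θ w.length))) := by
      rw [add_assoc]
      exact le_add_left (M := treeMonoid.toResourceMonoid) _ _
    have n1 : M.norm (φ + M.mods m₁ (θ w.length)) ≤ P.eval w.length := by
      refine (hM.norm_le _).trans (le_trans ?_ (hP w.length))
      rw [hM.maj_add, hM.maj_mods]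
      exact norm_mono (M := treeMonoid.toResourceMonoid) h1
    -- Modalities do not lower norms, so apply those of `Q₂` to `γ + σ`, move `σ` out as `σ'`, and
    -- use that `γ` under these modalities is below the majorizer of the value of `F`.
    have n2 : M.norm (γ + σ) ≤ P.eval w.length := by
      refine (hM.norm_le _).trans (le_trans ?_ (hP w.length))
      rw [hM.maj_add]
      refine (Tree.norm_le_mods m₂ _).trans
        (norm_mono (M := treeMonoid.toResourceMonoid) ((Tree.le_trans' (hσ' _) ?_).1))
      rw [add_assoc]
      exact add_le_add_left (M := treeMonoid.toResourceMonoid) σ'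
        (Tree.le_trans' hγ2 hβ').1
    have n3 : C.time r (y w) ≤ M.norm (φ + M.mods m₁ (θ w.length)) :=
      hz3.trans ((Nat.le_add_left _ _).trans (M.dist_triangle (M.zero_le β) hβ))
    omega
  choose l f hl1 hf hf2 using key
  refine ⟨f, fun g => ⟨fun hg => funext fun w => ?_, ?_⟩, ?_⟩
  · obtain ⟨l', ⟨G, hG, rfl⟩, hv⟩ := hg w
    obtain ⟨G', hG', hGl⟩ := hl1 w
    obtain rfl := Denotes.unique _ _ hG hG'
    rw [hGl] at hv
    exact hv.unique (hf w)
  · rintro rfl w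
    exact ⟨l w, hl1 w, hf w⟩
  have := C.sym_finite
  obtain ⟨U, p, hU⟩ := C.invariance
  obtain ⟨V⟩ := C.emb_inv_polyTime
  -- Over an empty alphabet there would be only one string, against the injectivity of the embedding
  -- of binary strings.
  have hS : Nonempty C.Sym := by
    by_contra h
    rw [not_nonempty_iff] at h
    exact absurd (C.emb_injective (a₁ := []) (a₂ := [true]) (Subtype.ext (Subsingleton.elim _ _)))
      (by simp)
  have := Classical.inhabited_of_nonempty hS
  -- A bound for time plus lengths in every call: applying `F` costs `P`, reading off costs `3 * P`,
  -- and the last summand bounds the length of `x w`.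
  let Q : Polynomial ℕ := 4 * P + .C (2 * c + k + 2 * b + C.size (d false) + C.size (d true) +
    C.size s) + .C c * (.X + 1)
  have hrun : ∀ (w : List Bool) (u z : C.L) (t : ℕ), C.Ev u (x w) z t →
      t + C.size u + C.size (x w) ≤ Q.eval w.length →
      ReachesIn U.tm.step ((p.comp Q).eval w.length)
        (Turing.initList U.tm ((u.1.map some ++ none :: (x w).1.map some).map U.inputAlphabet.symm))
        (Turing.haltList U.tm (z.1.map U.outputAlphabet.symm)) := by
    intro w u z t h ht
    obtain ⟨h1⟩ := hU u (x w) z h.1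
    refine (ReachesIn.of_evals h1).mono ?_
    rw [Polynomial.eval_comp]
    have := h.2
    exact eval_mono p (by omega)
  have hQ : ∀ n, Q.eval n = 4 * P.eval n + (2 * c + k + 2 * b + C.size (d false) +
      C.size (d true) + C.size s) + c * (n + 1) := fun n => by simp [Q]
  refine polyTime_of_fold (U := U) (V := V.toTM2ComputableAux) (d := fun b => (d b).1) (d' := s.1)
    (p := p.comp Q) (q := V.time) (x := fun w => (x w).1) (y := fun w => (C.emb (f w)).1)
    (fun w b => hrun w _ _ _ (hd w b) ?_) (fun w => hrun w _ _ _ (hf2 w) ?_)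
    fun w => ReachesIn.of_evals (V.outputsFun (f w))
  · rw [hQ]
    have := hx w
    cases b <;> omega
  · rw [hQ]
    have := hx w
    omega

end Reading

end LAL

theorem mainTheorem2 (C : LAL.CompModel) (m₁ m₂ : List LAL.Modality)
    (π : LAL.Proof [] (.lolli (LAL.mods m₁ LAL.listLAL) (LAL.mods m₂ LAL.listLAL))) :
    -- every denotation of the proof in light length spaces
    (∀ (η : LAL.Env LAL.treeMonoid C)
      (F : (LAL.interp (.lolli (LAL.mods m₁ LAL.listLAL) (LAL.mods m₂ LAL.listLAL)) η).Carrier),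
      LAL.IsDenotation π η F →
        ∃ f : List Bool → List Bool, (∀ g, LAL.InducedBy F g ↔ g = f) ∧ LAL.PolyTime f) ∧
    -- existence of the denotation over the monoid of trees with time debts
    (∀ η : LAL.Env (LAL.withDebt LAL.treeMonoid) C,
      ∃ F : (LAL.interp (.lolli (LAL.mods m₁ LAL.listLAL) (LAL.mods m₂ LAL.listLAL)) η).Carrier,
        (∀ G, LAL.IsDenotation π η G ↔ G = F) ∧
        ∃ f : List Bool → List Bool, (∀ g, LAL.InducedBy F g ↔ g = f) ∧ LAL.PolyTime f) := by
  refine ⟨fun η F _ => LAL.exists_induced LAL.groundedTree F, fun η => ?_⟩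
  obtain ⟨f, hf, hd⟩ := LAL.exists_denotes (C := C) LAL.groundedDebt π (.inl LAL.payingDebt)
  refine ⟨f η (), fun G => ⟨?_, ?_⟩, LAL.exists_induced LAL.groundedDebt _⟩
  · rintro ⟨H, hH, rfl⟩
    rw [LAL.Denotes.unique π η hH (hd η)]
  · rintro rfl
    exact ⟨_, hd η, rfl⟩
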